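/- Let $k$ be a field of characteristic $0$ (for instance $k=\mathbf{C}$). Call a $k$-scheme *smooth, possibly of infinite type*, if Zariski locally it is étale over an affine space $\operatorname{Spec} k[x_j : j\in J]$ with $J$ a possibly infinite set of coordinates. A *log pair* $(X,D)$ is such a scheme $X$ with a reduced simple normal crossings divisor $D$: each point has an affine open neighbourhood with étale coordinates as above such that only finitely many irreducible components of $D$ meet it, and their ideals are generated by distinct coordinates. (Every smooth variety over $k$ with a simple normal crossings divisor is a log pair.) A morphism of log pairs $(Y,D_Y)\to(X,D)$ is a morphism of $k$-schemes $f:Y\to X$ with $f^{-1}(D)\subseteq D_Y$. A *log commutative vertex scheme* (lcvs) is a tuple $(X,D,\partial)$ with $(X,D)$ a log pair and $\partial$ a vector field on $X$, i.e. a $k$-linear derivation of $\mathcal{O}_X$, that is tangent to $D$, i.e. preserves the ideal sheaf of $D$; a morphism of lcvs is a morphism of log pairs compatible with the vector fields. For a $k$-algebra $B$ let $JB$ be the $k$-algebra generated by symbols $b(n)$ ($b\in B$, $n\ge 0$), $k$-linear in $b$, with $1(n)=\delta_{n,0}$ and $(ab)(n)=\sum_{i+j=n}a(i)b(j)$, with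 derivation $\partial b(n)=(n+1)b(n+1)$. For a log pair $(X,D)$ with components $D_i$, the *log jet space* $\pi: J_{\log D}(X)\to X$ is the relative spectrum over $X$ of the sheaf of algebras whose sections over an affine open $U$ form the smallest subring of $J\,\mathcal{O}(U\setminus D)$ that is closed under $\partial$ and contains $\mathcal{O}(U)$ and all $y\,\partial x$ with $x\in\mathcal{O}(-D_i)(U)$ and $y\in\mathcal{O}(D_i)(U)$. Locally, where $D_i$ has an equation $\gamma^i$, it is generated under $\partial$ by the functions on $X$ and the $\partial\gamma^i/\gamma^i$. Let $\widetilde D$ be the pull-back $\pi^{-1}(D)$. **Lemma.** For every log pair $(X,D)$, the scheme-theoretic pull-back of $D$ is reduced (so it is $\widetilde D$), and there is a vector field $\partial$ on $J_{\log D}(X)$ that restricts to the derivation $\partial$ of the algebra of log jets over each affine open $U\subseteq X$, such that $(J_{\log D}(X),\widetilde D,\partial)$ is an lcvs. It is the free lcvs on $(X,D)$: the assignment $(X,D)\mapsto (J_{\log D}(X),\widetilde D,\partial)$ is (the object part of) a right adjoint to the forgetful functor $(Y,D_Y,\partial_Y)\mapsto(Y,D_Y)$ from lcvs to log pairs, with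 the projections $\pi$ as counit. That is, every morphism of log pairs $(Y,D_Y)\to(X,D)$ from an lcvs $(Y,D_Y,\partial_Y)$ factors through $\pi$ by a unique morphism of lcvs $(Y,D_Y,\partial_Y)\to(J_{\log D}(X),\widetilde D,\partial)$. -/

import Mathlib

universe u

noncomputable section

namespace LogJets

section Jets

variable {k B C R : Type*} [CommRing k] [CommRing B] [CommRing C] [CommRing R]

/-- The relations imposed on the symbols `a(n)`, `a ∈ B`, `n ≥ 0`. -/
inductive JetRel (φ : k →+* B) : MvPolynomial (B × ℕ) k → MvPolynomial (B × ℕ) k → Prop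
  | const (c : k) (n : ℕ) :
      JetRel φ (MvPolynomial.X (φ c, n)) (if n = 0 then MvPolynomial.C c else 0)
  | add (a b : B) (n : ℕ) :
      JetRel φ (MvPolynomial.X (a + b, n)) (MvPolynomial.X (a, n) + MvPolynomial.X (b, n))
  | mul (a b : B) (n : ℕ) :
      JetRel φ (MvPolynomial.X (a * b, n))
        (∑ p ∈ Finset.HasAntidiagonal.antidiagonal n, MvPolynomial.X (a, p.1) * MvPolynomial.X (b, p.2))

/-- The ideal generated by the relations between the symbols `a(n)`. -/
def jetIdeal (φ : k →+* B) : Ideal (MvPolynomial (B × ℕ) k) :=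
  Ideal.span {p | ∃ q r, JetRel φ q r ∧ q - r = p}

/-- The algebra of functions on the jet space of `Spec B`, for a `k`-algebra `φ : k → B`: the
`k`-algebra generated by symbols `a(n)`, `k`-linear in `a`, subject to `1(n) = δ_{n,0}` and
`(ab)(n) = ∑_{i+j=n} a(i) b(j)`. -/
def JetAlgebra (φ : k →+* B) : Type _ := MvPolynomial (B × ℕ) k ⧸ jetIdeal φ

instance (φ : k →+* B) : CommRing (JetAlgebra φ) :=
  inferInstanceAs (CommRing (MvPolynomial (B × ℕ) k ⧸ jetIdeal φ))

instance (φ : k →+* B) : Algebra k (JetAlgebra φ) :=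
  inferInstanceAs (Algebra k (MvPolynomial (B × ℕ) k ⧸ jetIdeal φ))

namespace JetAlgebra

variable (φ : k →+* B)

/-- The quotient map from the polynomial algebra on the symbols `a(n)`. -/
def proj : MvPolynomial (B × ℕ) k →ₐ[k] JetAlgebra φ := Ideal.Quotient.mkₐ k (jetIdeal φ)

theorem proj_surjective : Function.Surjective (proj φ) := Ideal.Quotient.mkₐ_surjective k _

theorem proj_eq_zero_iff {p : MvPolynomial (B × ℕ) k} : proj φ p = 0 ↔ p ∈ jetIdeal φ :=
  Ideal.Quotient.eq_zero_iff_mem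

/-- The symbol `a(n)`. -/
def sym (a : B) (n : ℕ) : JetAlgebra φ := proj φ (MvPolynomial.X (a, n))

theorem proj_eq_of_rel {p q : MvPolynomial (B × ℕ) k} (h : JetRel φ p q) :
    proj φ p = proj φ q := by
  rw [← sub_eq_zero, ← map_sub, proj_eq_zero_iff]
  exact Ideal.subset_span ⟨p, q, h, rfl⟩

theorem sym_const (c : k) (n : ℕ) :
    sym φ (φ c) n = if n = 0 then algebraMap k (JetAlgebra φ) c else 0 := by
  refine (proj_eq_of_rel φ (.const c n)).trans ?_
  split_ifs
  · exact (proj φ).commutes c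
  · exact map_zero _

theorem sym_add (a b : B) (n : ℕ) : sym φ (a + b) n = sym φ a n + sym φ b n :=
  (proj_eq_of_rel φ (.add a b n)).trans (map_add _ _ _)

theorem sym_mul (a b : B) (n : ℕ) :
    sym φ (a * b) n = ∑ p ∈ Finset.HasAntidiagonal.antidiagonal n, sym φ a p.1 * sym φ b p.2 := by
  refine (proj_eq_of_rel φ (.mul a b n)).trans ?_
  simp [map_sum, sym]

theorem induction_on {P : JetAlgebra φ → Prop} (x : JetAlgebra φ)
    (const : ∀ c, P (algebraMap k _ c)) (sym : ∀ a n, P (sym φ a n))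
    (add : ∀ x y, P x → P y → P (x + y)) (mul : ∀ x y, P x → P y → P (x * y)) : P x := by
  obtain ⟨p, rfl⟩ := proj_surjective φ x
  induction p using MvPolynomial.induction_on with
  | C c => exact ((proj φ).commutes c).symm ▸ const c
  | add p q hp hq => rw [map_add]; exact add _ _ hp hq
  | mul_X p i hp => rw [map_mul]; exact mul _ _ hp (sym i.1 i.2)

/-- The derivation `a(n) ↦ (n + 1) a(n + 1)` of the polynomial algebra on the symbols `a(n)`. -/
def polyDer {S : Type*} : Derivation k (MvPolynomial (S × ℕ) k) (MvPolynomial (S × ℕ) k) :=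
  MvPolynomial.mkDerivation k fun p ↦ (p.2 + 1 : ℕ) • MvPolynomial.X (p.1, p.2 + 1)

theorem polyDer_X {S : Type*} (a : S) (n : ℕ) : polyDer (k := k) (MvPolynomial.X (a, n)) =
    (n + 1 : ℕ) • MvPolynomial.X (a, n + 1) := MvPolynomial.mkDerivation_X ..

theorem sum_antidiagonal_der (f g : ℕ → R) (n : ℕ) :
    ∑ p ∈ Finset.HasAntidiagonal.antidiagonal n,
      (f p.1 * ((p.2 + 1 : ℕ) • g (p.2 + 1)) + g p.2 * ((p.1 + 1 : ℕ) • f (p.1 + 1))) =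
    (n + 1 : ℕ) • ∑ p ∈ Finset.HasAntidiagonal.antidiagonal (n + 1), f p.1 * g p.2 := by
  have key : ∀ h : ℕ → ℕ → R, (∑ p ∈ Finset.HasAntidiagonal.antidiagonal (n + 1), p.2 • h p.1 p.2) =
      ∑ p ∈ Finset.HasAntidiagonal.antidiagonal n, (p.2 + 1) • h p.1 (p.2 + 1) := by
    intro h
    rw [Finset.Nat.sum_antidiagonal_succ']
    simp
  have key' : ∀ h : ℕ → ℕ → R, (∑ p ∈ Finset.HasAntidiagonal.antidiagonal (n + 1), p.1 • h p.1 p.2) =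
      ∑ p ∈ Finset.HasAntidiagonal.antidiagonal n, (p.1 + 1) • h (p.1 + 1) p.2 := by
    intro h
    rw [Finset.Nat.sum_antidiagonal_succ]
    simp
  rw [Finset.smul_sum, Finset.sum_add_distrib]
  have : ∑ p ∈ Finset.HasAntidiagonal.antidiagonal (n + 1), (n + 1) • (f p.1 * g p.2) =
      ∑ p ∈ Finset.HasAntidiagonal.antidiagonal (n + 1), (p.2 • (f p.1 * g p.2) + p.1 • (f p.1 * g p.2)) := by
    refine Finset.sum_congr rfl fun p hp ↦ ?_
    rw [← add_smul, add_comm p.2, Finset.HasAntidiagonal.mem_antidiagonal.mp hp]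
  rw [this, Finset.sum_add_distrib, key (fun i j ↦ f i * g j), key' (fun i j ↦ f i * g j)]
  congr 1
  · exact Finset.sum_congr rfl fun p _ ↦ mul_smul_comm _ _ _
  · refine Finset.sum_congr rfl fun p _ ↦ ?_
    rw [mul_smul_comm, mul_comm]

theorem proj_polyDer {p q : MvPolynomial (B × ℕ) k} (h : JetRel φ p q) :
    proj φ (polyDer p) = proj φ (polyDer q) := by
  cases h with
  | const c n =>
    rw [polyDer_X, map_nsmul]
    change _ • sym φ (φ c) (n + 1) = _
    rw [sym_const]
    split_ifs <;> simp_all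
  | add a b n =>
    simp only [map_add, polyDer_X, map_nsmul]
    change _ • sym φ (a + b) (n + 1) = _ • sym φ a (n + 1) + _ • sym φ b (n + 1)
    rw [sym_add, smul_add]
  | mul a b n =>
    simp only [map_sum, Derivation.leibniz, polyDer_X, map_nsmul, map_add, map_mul, smul_eq_mul]
    change _ • sym φ (a * b) (n + 1) = _
    rw [sym_mul]
    exact (sum_antidiagonal_der (sym φ a) (sym φ b) n).symm

theorem proj_polyDer_eq_zero (x : MvPolynomial (B × ℕ) k) (hx : proj φ x = 0) :
    proj φ (polyDer x) = 0 := by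
  rw [proj_eq_zero_iff] at hx
  refine Submodule.span_induction ?_ (by simp) ?_ ?_ hx
  · rintro _ ⟨p, q, h, rfl⟩
    rw [map_sub, map_sub, proj_polyDer φ h, sub_self]
  · intro x y _ _ hx hy
    rw [map_add, map_add, hx, hy, add_zero]
  · intro a x hx' hx
    have : proj φ x = 0 := (proj_eq_zero_iff φ).mpr hx'
    simp [hx, this]

/-- The translation derivation `∂` of the jet algebra, `∂ a(n) = (n + 1) a(n + 1)`. -/
def der : Derivation k (JetAlgebra φ) (JetAlgebra φ) :=
  Derivation.liftOfSurjective (proj_surjective φ) (proj_polyDer_eq_zero φ)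

theorem der_sym (a : B) (n : ℕ) : der φ (sym φ a n) = (n + 1 : ℕ) • sym φ a (n + 1) := by
  refine (Derivation.liftOfSurjective_apply (proj_surjective φ) (proj_polyDer_eq_zero φ) _).trans ?_
  rw [polyDer_X, map_nsmul]
  rfl

variable {φ}

/-- The ring homomorphism out of the jet algebra with prescribed values on the symbols. -/
def lift (g : k →+* R) (s : B → ℕ → R) (hc : ∀ c n, s (φ c) n = if n = 0 then g c else 0)
    (ha : ∀ a b n, s (a + b) n = s a n + s b n)
    (hm : ∀ a b n, s (a * b) n = ∑ p ∈ Finset.HasAntidiagonal.antidiagonal n, s a p.1 * s b p.2) :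
    JetAlgebra φ →+* R :=
  Ideal.Quotient.lift (jetIdeal φ) (MvPolynomial.eval₂Hom g fun p ↦ s p.1 p.2) <| by
    intro x hx
    rw [← RingHom.mem_ker]
    refine (Ideal.span_le.mpr ?_ : jetIdeal φ ≤ _) hx
    rintro _ ⟨p, q, h, rfl⟩
    simp only [SetLike.mem_coe, RingHom.mem_ker, map_sub, sub_eq_zero]
    cases h with
    | const c n => rw [MvPolynomial.coe_eval₂Hom, MvPolynomial.eval₂_X, hc]; split_ifs <;> simp
    | add a b n => simp [ha]
    | mul a b n => simp [hm, map_sum]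

theorem lift_sym (g : k →+* R) (s : B → ℕ → R) (hc ha hm) (a : B) (n : ℕ) :
    lift (φ := φ) g s hc ha hm (sym φ a n) = s a n := by
  refine (Ideal.Quotient.lift_mk _ _ _).trans ?_
  simp

theorem lift_algebraMap (g : k →+* R) (s : B → ℕ → R) (hc ha hm) (c : k) :
    lift (φ := φ) g s hc ha hm (algebraMap k _ c) = g c := by
  refine (Ideal.Quotient.lift_mk _ _ _).trans ?_
  simp

theorem hom_ext {f g : JetAlgebra φ →+* R} (h : ∀ a n, f (sym φ a n) = g (sym φ a n)) :
    f = g := by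
  ext x
  induction x using induction_on with
  | const c => have := sym_const φ c 0; rw [if_pos rfl] at this; rw [← this]; exact h _ _

  | sym a n => exact h a n
  | add x y hx hy => rw [map_add, map_add, hx, hy]
  | mul x y hx hy => rw [map_mul, map_mul, hx, hy]

/-- Functoriality of the jet algebra: `a(n) ↦ (ψ a)(n)`. -/
def map {φ' : k →+* C} (ψ : B →+* C) (h : ψ.comp φ = φ') : JetAlgebra φ →+* JetAlgebra φ' :=
  lift (algebraMap k _) (fun a n ↦ sym φ' (ψ a) n)
    (fun c n ↦ by rw [← sym_const, ← h]; rfl) (fun a b n ↦ by rw [map_add, sym_add])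
    (fun a b n ↦ by rw [map_mul, sym_mul])

@[simp]
theorem map_sym {φ' : k →+* C} (ψ : B →+* C) (h : ψ.comp φ = φ') (a : B) (n : ℕ) :
    map ψ h (sym φ a n) = sym φ' (ψ a) n := lift_sym ..

theorem map_der {φ' : k →+* C} (ψ : B →+* C) (h : ψ.comp φ = φ') (x : JetAlgebra φ) :
    map ψ h (der φ x) = der φ' (map ψ h x) := by
  induction x using induction_on with
  | const c => simp [map, lift_algebraMap]
  | sym a n => rw [der_sym, map_nsmul, map_sym, map_sym, der_sym]
  | add x y hx hy => simp only [map_add, hx, hy]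
  | mul x y hx hy => simp only [Derivation.leibniz, smul_eq_mul, map_add, map_mul, hx, hy]

/-- Elements of `J B` that die in `J B_f` are killed by a power of `f`. -/
theorem exists_pow_mul_eq_zero {φ' : k →+* C} (ψ : B →+* C) (h : ψ.comp φ = φ') (f : B)
    (hf : letI := ψ.toAlgebra; IsLocalization.Away f C) (x : JetAlgebra φ)
    (hx : map ψ h x = 0) : ∃ n : ℕ, sym φ f 0 ^ n * x = 0 := by
  let _ := ψ.toAlgebra
  let S := Localization.Away (sym φ f 0)
  let σ : B →+* PowerSeries S :=
    { toFun := fun a ↦ PowerSeries.mk fun n ↦ algebraMap _ S (sym φ a n)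
      map_one' := by
        ext n
        rw [← map_one φ, PowerSeries.coeff_mk, sym_const, PowerSeries.coeff_one]
        split_ifs <;> simp
      map_zero' := by
        ext n
        rw [← map_zero φ, PowerSeries.coeff_mk, sym_const]
        simp
      map_add' := fun a b ↦ by ext n; simp [sym_add]
      map_mul' := fun a b ↦ by
        ext n; simp [sym_mul, PowerSeries.coeff_mul, map_sum] }
  have hu : IsUnit (σ f) := by
    rw [PowerSeries.isUnit_iff_constantCoeff, ← PowerSeries.coeff_zero_eq_constantCoeff_apply]
    simp only [σ, RingHom.coe_mk, MonoidHom.coe_mk, OneHom.coe_mk, PowerSeries.coeff_mk]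
    exact IsLocalization.Away.algebraMap_isUnit (S := S) (sym φ f 0)
  let τ : C →+* PowerSeries S := IsLocalization.Away.lift f hu
  have hτ : ∀ a, τ (ψ a) = σ a := fun a ↦ IsLocalization.Away.lift_eq f hu a
  let ρ : JetAlgebra φ' →+* S := lift ((algebraMap _ S).comp (algebraMap k (JetAlgebra φ)))
    (fun c n ↦ PowerSeries.coeff n (τ c))
    (fun c n ↦ by
      subst h
      rw [RingHom.comp_apply, hτ]
      simp only [σ, RingHom.coe_mk, MonoidHom.coe_mk, OneHom.coe_mk, PowerSeries.coeff_mk,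
        sym_const]
      split_ifs <;> simp)
    (fun a b n ↦ by simp) (fun a b n ↦ by rw [map_mul, PowerSeries.coeff_mul])
  have hρ : ρ.comp (map ψ h) = algebraMap _ S := by
    refine hom_ext fun a n ↦ ?_
    rw [RingHom.comp_apply, map_sym, lift_sym, hτ]
    simp [σ]
  have : algebraMap _ S x = algebraMap _ S 0 := by
    rw [← hρ, RingHom.comp_apply, hx, map_zero, map_zero]
  obtain ⟨⟨_, n, rfl⟩, hn⟩ := (IsLocalization.eq_iff_exists (Submonoid.powers (sym φ f 0)) S).mp this
  exact ⟨n, by simpa using hn⟩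

end JetAlgebra

end Jets

open AlgebraicGeometry CategoryTheory TopologicalSpace

namespace JetAlgebra

variable {k B C : Type*} [CommRing k] [CommRing B] [CommRing C]

/-- The homomorphism `a ↦ a(0)`. -/
def of (φ : k →+* B) : B →+* JetAlgebra φ where
  toFun a := sym φ a 0
  map_one' := by rw [← map_one φ, sym_const, if_pos rfl, map_one]
  map_zero' := by rw [← map_zero φ, sym_const, if_pos rfl, map_zero]
  map_add' a b := sym_add φ a b 0
  map_mul' a b := by simp [sym_mul]

@[simp]
theorem map_of {φ : k →+* B} {φ' : k →+* C} (ψ : B →+* C) (h : ψ.comp φ = φ') (a : B) :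
    map ψ h (of φ a) = of φ' (ψ a) := map_sym ..

end JetAlgebra

section LogPairs

variable {k : Type u} [Field k]

/-- Restriction of functions. -/
abbrev res {X : Scheme.{u}} {U V : X.Opens} (h : V ≤ U) : Γ(X, U) →+* Γ(X, V) :=
  (X.presheaf.map (homOfLE h).op).hom

theorem res_res {X : Scheme.{u}} {U V W : X.Opens} (h : V ≤ U) (h' : W ≤ V) (a : Γ(X, U)) :
    res h' (res h a) = res (h'.trans h) a := by
  change (X.presheaf.map _ ≫ X.presheaf.map _).hom a = _
  rw [← X.presheaf.map_comp]
  rfl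

/-- The constant functions on an open subset of a `k`-scheme. -/
def consts (X : Over (Spec (.of k))) (U : X.left.Opens) : k →+* Γ(X.left, U) :=
  (res le_top).comp (X.hom.appTop.hom.comp (Scheme.ΓSpecIso (.of k)).inv.hom)

theorem res_comp_consts (X : Over (Spec (.of k))) {U V : X.left.Opens} (h : V ≤ U) :
    (res h).comp (consts X U) = consts X V :=
  RingHom.ext fun _ ↦ res_res ..

/-- The irreducible components of a closed subset. -/
def components {X : Type*} [TopologicalSpace X] (D : Closeds X) : Set (Closeds X) :=
  {Z | Maximal (fun W : Closeds X ↦ IsIrreducible (W : Set X) ∧ W ≤ D) Z}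

/-- `X` is smooth over `k` and `D` is a simple normal crossings divisor near `p`: there are an affine
open neighbourhood `U` of `p` and étale coordinates `φ : k[x_j] → 𝒪(U)` such that only finitely
many irreducible components `Z` of `D` meet `U`, and the ideals of these are generated by distinct
coordinates. For `X` locally of finite type this is the usual notion. The set of coordinates may be
infinite, so that jet spaces, which are locally products of a smooth variety and an
infinite-dimensional affine space, are allowed. -/
def HasLogChart (X : Over (Spec (.of k))) (D : Closeds X.left) (p : X.left) : Prop :=
  ∃ (U : X.left.affineOpens) (J : Type u) (φ : MvPolynomial J k →+* Γ(X.left, U))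
    (σ : {Z ∈ components D | ((Z : Set X.left) ∩ U).Nonempty} → J),
    p ∈ U.1 ∧ φ.comp MvPolynomial.C = consts X U ∧ φ.Etale ∧
    {Z ∈ components D | ((Z : Set X.left) ∩ U).Nonempty}.Finite ∧ Function.Injective σ ∧
    ∀ Z, (Scheme.IdealSheafData.vanishingIdeal Z.1).ideal U =
      Ideal.span {φ (MvPolynomial.X (σ Z))}

variable (k) in
/-- A log pair over `k`: a smooth scheme `X` (possibly of infinite type) together with a (reduced)
simple normal crossings divisor `D`. -/
structure LogPair where
  /-- the underlying scheme over `k` -/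
  X : Over (Spec (.of k))
  /-- the divisor -/
  D : Closeds X.left
  hasLogChart : ∀ p, HasLogChart X D p

theorem exists_component {X : Type*} [TopologicalSpace X] (D : Closeds X) {x : X} (hx : x ∈ D) :
    ∃ Z ∈ components D, x ∈ Z := by
  suffices ∃ m, {x} ⊆ m ∧ Maximal (· ∈ {t : Set X | IsIrreducible t ∧ t ⊆ D}) m by
    obtain ⟨m, hm, hmax⟩ := this
    have hcl : IsClosed m := by
      refine closure_eq_iff_isClosed.mp (Set.Subset.antisymm (hmax.2 ⟨hmax.1.1.closure,
        closure_minimal hmax.1.2 D.isClosed⟩ subset_closure) subset_closure)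
    exact ⟨⟨m, hcl⟩, ⟨⟨hmax.1.1, hmax.1.2⟩, fun W hW h ↦ hmax.2 hW h⟩, hm rfl⟩
  refine zorn_subset_nonempty
    {t : Set X | IsIrreducible t ∧ t ⊆ D} (fun c hc hcc hne ↦ ?_) {x}
    ⟨isIrreducible_singleton, by simpa using hx⟩
  · refine ⟨⋃₀ c, ⟨⟨?_, ?_⟩, Set.sUnion_subset fun t ht ↦ (hc ht).2⟩,
      fun t ht ↦ Set.subset_sUnion_of_mem ht⟩
    · obtain ⟨t, ht⟩ := hne
      exact (hc ht).1.1.mono (Set.subset_sUnion_of_mem ht)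
    · rintro u v hu hv ⟨y, hy, hyu⟩ ⟨z, hz, hzv⟩
      obtain ⟨p, hpc, hyp⟩ := Set.mem_sUnion.1 hy
      obtain ⟨q, hqc, hzq⟩ := Set.mem_sUnion.1 hz
      rcases hcc.total hpc hqc with hpq | hqp
      · obtain ⟨w, hw, hw'⟩ := (hc hqc).1.2 u v hu hv ⟨y, hpq hyp, hyu⟩ ⟨z, hzq, hzv⟩
        exact ⟨w, ⟨q, hqc, hw⟩, hw'⟩
      · obtain ⟨w, hw, hw'⟩ := (hc hpc).1.2 u v hu hv ⟨y, hyp, hyu⟩ ⟨z, hqp hzq, hzv⟩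
        exact ⟨w, ⟨p, hpc, hw⟩, hw'⟩

namespace LogPair

variable (P : LogPair k)

/-- The functions on `U` vanishing on the closed subset `Z`. -/
abbrev idealOf {X : Scheme.{u}} (Z : Closeds X) (U : X.AffineZariskiSite) : Ideal Γ(X, U.toOpens) :=
  (Scheme.IdealSheafData.vanishingIdeal Z).ideal ⟨U.toOpens, U.2⟩

/-- `U ∖ D`. -/
abbrev away (U : P.X.left.Opens) : P.X.left.Opens := U ⊓ P.D.compl

theorem mem_iff_of_ideal_eq {X : Scheme.{u}} (Z : Closeds X) (U : X.affineOpens) (γ : Γ(X, U))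
    (h : (Scheme.IdealSheafData.vanishingIdeal Z).ideal U = Ideal.span {γ}) {x : X} (hx : x ∈ U.1) :
    x ∈ Z ↔ x ∉ X.basicOpen γ := by
  have h1 : x ∈ (Scheme.IdealSheafData.vanishingIdeal Z).support ↔ x ∈ Z := by
    rw [← SetLike.mem_coe, Scheme.IdealSheafData.coe_support_vanishingIdeal]; rfl
  rw [← h1, Scheme.IdealSheafData.mem_support_iff_of_mem hx, h, Scheme.zeroLocus_span]
  simp

theorem isCompact_away (U : P.X.left.AffineZariskiSite) :
    IsCompact ((P.away U.toOpens : P.X.left.Opens) : Set P.X.left) := by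
  suffices ∃ K, IsCompact K ∧ (U.toOpens : Set P.X.left) ∩ (P.away U.toOpens : Set P.X.left) ⊆ K ∧
      K ⊆ (P.away U.toOpens : Set P.X.left) by
    obtain ⟨K, hK, h1, h2⟩ := this
    rwa [Set.Subset.antisymm h2 (fun x hx ↦ h1 ⟨hx.1, hx⟩)] at hK
  refine U.2.isCompact.induction_on
    (p := fun s ↦ ∃ K, IsCompact K ∧ s ∩ (P.away U.toOpens : Set P.X.left) ⊆ K ∧
      K ⊆ (P.away U.toOpens : Set P.X.left))
    ⟨∅, isCompact_empty, by simp, by simp⟩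
    (fun s t hst ⟨K, hK, h1, h2⟩ ↦ ⟨K, hK, (Set.inter_subset_inter_left _ hst).trans h1, h2⟩)
    (fun s t ⟨K, hK, h1, h2⟩ ⟨K', hK', h1', h2'⟩ ↦ ⟨K ∪ K', hK.union hK', by
      rw [Set.union_inter_distrib_right]; exact Set.union_subset_union h1 h1',
      Set.union_subset h2 h2'⟩)
    (fun x hx ↦ ?_)
  · obtain ⟨V, J, φ, σ, hxV, -, -, hfin, -, hσ⟩ := P.hasLogChart x
    have := hfin.fintype
    obtain ⟨g, g', hgg', hxg⟩ := exists_basicOpen_le_affine_inter U.2 V.2 x ⟨hx, hxV⟩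
    let h : Γ(P.X.left, V) := ∏ Z, φ (MvPolynomial.X (σ Z))
    have key : ∀ y ∈ V.1, y ∈ P.D ↔ y ∉ P.X.left.basicOpen h := by
      intro y hy
      have h1 : y ∈ P.X.left.basicOpen h ↔
          ∀ Z, y ∈ P.X.left.basicOpen (φ (MvPolynomial.X (σ Z))) := by
        simp only [Scheme.mem_basicOpen _ _ _ hy, h, map_prod, IsUnit.prod_univ_iff]
      rw [h1, not_forall]
      constructor
      · intro hyD
        obtain ⟨Z, hZ, hyZ⟩ := exists_component P.D hyD
        exact ⟨⟨Z, hZ, y, hyZ, hy⟩, (mem_iff_of_ideal_eq Z V _ (hσ ⟨Z, hZ, y, hyZ, hy⟩) hy).mp hyZ⟩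
      · rintro ⟨Z, hZ⟩
        exact Z.2.1.1.2 ((mem_iff_of_ideal_eq Z.1 V _ (hσ Z) hy).mpr hZ)
    refine ⟨P.X.left.basicOpen g, mem_nhdsWithin_of_mem_nhds
      ((P.X.left.basicOpen g).isOpen.mem_nhds hxg), P.X.left.basicOpen (g' * h),
      (V.2.basicOpen _).isCompact, ?_, ?_⟩
    · rintro y ⟨hy, hy'⟩
      rw [hgg'] at hy
      rw [Scheme.basicOpen_mul]
      exact ⟨hy, not_not.mp fun hn ↦ hy'.2 ((key y (P.X.left.basicOpen_le _ hy)).mpr hn)⟩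
    · rintro y hy
      rw [Scheme.basicOpen_mul] at hy
      have hyg : y ∈ P.X.left.basicOpen g := hgg' ▸ hy.1
      exact ⟨P.X.left.basicOpen_le _ hyg, fun hD ↦
        (key y (P.X.left.basicOpen_le _ hy.1)).mp hD hy.2⟩

theorem isLocalization_of_eq {X : Scheme.{u}} {U V : X.Opens} (hU : IsCompact (U : Set X))
    (hU' : IsQuasiSeparated (U : Set X)) (f : Γ(X, U)) (h : V ≤ U) (hV : V = X.basicOpen f) :
    letI := (res h).toAlgebra; IsLocalization.Away f Γ(X, V) := by
  subst hV
  exact isLocalization_basicOpen_of_qcqs hU hU' f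

theorem away_le {U V : P.X.left.Opens} (h : V ≤ U) : P.away V ≤ P.away U :=
  inf_le_inf_right _ h

theorem isLocalization_away (U : P.X.left.AffineZariskiSite) (f : Γ(P.X.left, U.toOpens)) :
    letI := (res (P.away_le (P.X.left.basicOpen_le f))).toAlgebra
    IsLocalization.Away (res (inf_le_left : P.away U.toOpens ≤ U.toOpens) f)
      Γ(P.X.left, P.away (P.X.left.basicOpen f)) := by
  refine isLocalization_of_eq (P.isCompact_away U) (U.2.isQuasiSeparated.of_subset inf_le_left) _
    (P.away_le (P.X.left.basicOpen_le f)) ?_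
  rw [Scheme.basicOpen_res]
  exact le_antisymm (le_inf (P.away_le (P.X.left.basicOpen_le f)) inf_le_left)
    (le_inf inf_le_right (inf_le_left.trans inf_le_right))

theorem fg_idealOf (Z : Closeds P.X.left) (hZ : Z ∈ components P.D)
    (U : P.X.left.AffineZariskiSite) : (idealOf Z U).FG := by
  let t : Set Γ(P.X.left, U.toOpens) := {g | ((idealOf Z U).map
    (algebraMap _ (Localization.Away g))).FG}
  refine Ideal.fg_of_localizationSpan t ?_ fun g ↦ g.2
  rw [← U.2.self_le_iSup_basicOpen_iff]
  intro x hx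
  obtain ⟨V, J, φ, σ, hxV, -, -, -, -, hσ⟩ := P.hasLogChart x
  obtain ⟨g, g', hgg', hxg⟩ := exists_basicOpen_le_affine_inter U.2 V.2 x ⟨hx, hxV⟩
  refine Opens.mem_iSup.mpr ⟨⟨g, ?_⟩, hxg⟩
  have hV : ((Scheme.IdealSheafData.vanishingIdeal Z).ideal V).FG := by
    by_cases hZV : ((Z : Set P.X.left) ∩ V).Nonempty
    · rw [hσ ⟨Z, hZ, hZV⟩]
      exact ⟨{_}, by rw [Finset.coe_singleton]⟩
    · have : V.2.fromSpec ⁻¹' (Z : Set P.X.left) = ∅ := by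
        refine Set.eq_empty_of_forall_notMem fun y hy ↦ hZV ⟨_, hy, ?_⟩
        rw [← V.2.range_fromSpec]
        exact ⟨y, rfl⟩
      have h : (Scheme.IdealSheafData.vanishingIdeal Z).ideal V = ⊤ :=
        (congrArg PrimeSpectrum.vanishingIdeal this).trans PrimeSpectrum.vanishingIdeal_empty
      rw [h]
      exact ⟨{1}, by simp⟩
  let W : P.X.left.affineOpens := P.X.left.affineBasicOpen (U := ⟨U.toOpens, U.2⟩) g
  have hWU : W ≤ ⟨U.toOpens, U.2⟩ := P.X.left.basicOpen_le g
  have hWV : W ≤ V := (congrArg (· ≤ V.1) hgg').mpr (P.X.left.basicOpen_le g')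
  have hW : ((Scheme.IdealSheafData.vanishingIdeal Z).ideal W).FG := by
    rw [← Scheme.IdealSheafData.map_ideal _ hWV]
    exact hV.map _
  rw [← Scheme.IdealSheafData.map_ideal _ hWU] at hW
  let _ := (res hWU).toAlgebra
  have : IsLocalization.Away g Γ(P.X.left, W) := U.2.isLocalization_basicOpen g
  let e := IsLocalization.algEquiv (Submonoid.powers g) Γ(P.X.left, W) (Localization.Away g)
  have he : algebraMap Γ(P.X.left, U.toOpens) (Localization.Away g) =
      e.toRingEquiv.toRingHom.comp (res hWU) := by
    ext a
    exact (e.commutes a).symm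
  change ((idealOf Z U).map _).FG
  rw [he, ← Ideal.map_map]
  exact hW.map _

/-- The jet algebra of `U ∖ D`, that is, the sections over `U` of the push-forward to `X` of the
structure sheaf of the jet space of `X ∖ D`. -/
abbrev awayJets (U : P.X.left.Opens) : Type u := JetAlgebra (consts P.X (P.away U))

/-- The restriction of jets. -/
def resJets {U V : P.X.left.Opens} (h : V ≤ U) : P.awayJets U →+* P.awayJets V :=
  JetAlgebra.map (res (P.away_le h)) (res_comp_consts _ _)

/-- The functions on `U`, as functions on the jets of `U ∖ D`. -/
def fn (U : P.X.left.Opens) : Γ(P.X.left, U) →+* P.awayJets U :=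
  (JetAlgebra.of _).comp (res inf_le_left)

/-- The generators of the algebra of log jets: the functions on `U`, and the functions `y ∂x`, where
`x` is a section over `U` of `𝒪(-Z)` and `y` a section of `𝒪(Z)`, for `Z` a component of `D`.
If `Z` has an equation `γ` on `U`, then `x = a γ` and `y = b / γ` with `a` and `b` functions on `U`,
and `y ∂x = b ∂a + a b (∂γ / γ)`; so, up to functions on `U` and their derivatives, these are the
multiples of the logarithmic derivative `∂γ / γ`. -/
def logJetGenerators (U : P.X.left.AffineZariskiSite) : Set (P.awayJets U.toOpens) :=
  {s | ∃ a, s = P.fn U.toOpens a} ∪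
  {s | ∃ Z ∈ components P.D, ∃ x ∈ idealOf Z U, ∃ y : Γ(P.X.left, P.away U.toOpens),
    (∀ t ∈ idealOf Z U, ∃ a : Γ(P.X.left, U.toOpens), y * res inf_le_left t = res inf_le_left a) ∧
    s = JetAlgebra.of _ y * JetAlgebra.der _ (P.fn U.toOpens x)}

/-- The algebra of log jets over the affine open subset `U`: the smallest subring of the jet algebra
of `U ∖ D` that is closed under `∂` and contains the generators. It is compatible with localization
in `U`, so it is the algebra of sections over `U` of the sheaf of algebras generated locally, in
coordinates `γ^i` in which `D` is `γ^1 ⋯ γ^r = 0`, under `∂` by the functions on `X` and the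
`∂γ^i / γ^i`, `i ≤ r`. -/
def logJetAlgebra (U : P.X.left.AffineZariskiSite) : Subring (P.awayJets U.toOpens) :=
  sInf {S | P.logJetGenerators U ⊆ S ∧ ∀ s ∈ S, JetAlgebra.der _ s ∈ S}

theorem generators_subset (U : P.X.left.AffineZariskiSite) :
    P.logJetGenerators U ⊆ P.logJetAlgebra U :=
  fun _ hs ↦ Subring.mem_sInf.mpr fun _ hS ↦ hS.1 hs

theorem fn_mem (U : P.X.left.AffineZariskiSite) (a) : P.fn U.toOpens a ∈ P.logJetAlgebra U :=
  P.generators_subset U (.inl ⟨a, rfl⟩)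

theorem der_mem (U : P.X.left.AffineZariskiSite) {s} (hs : s ∈ P.logJetAlgebra U) :
    JetAlgebra.der _ s ∈ P.logJetAlgebra U :=
  Subring.mem_sInf.mpr fun S hS ↦ hS.2 _ (Subring.mem_sInf.mp hs S hS)

theorem logJetAlgebra_le {U : P.X.left.AffineZariskiSite} {S : Subring (P.awayJets U.toOpens)}
    (h1 : P.logJetGenerators U ⊆ S) (h2 : ∀ s ∈ S, JetAlgebra.der _ s ∈ S) :
    P.logJetAlgebra U ≤ S := sInf_le ⟨h1, h2⟩

theorem resJets_fn {U V : P.X.left.Opens} (h : V ≤ U) (a : Γ(P.X.left, U)) :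
    P.resJets h (P.fn U a) = P.fn V (res h a) := by
  refine (JetAlgebra.map_of _ _ _).trans ?_
  change JetAlgebra.of _ _ = JetAlgebra.of _ _
  rw [res_res, res_res]

theorem resJets_of {U V : P.X.left.Opens} (h : V ≤ U) (a : Γ(P.X.left, P.away U)) :
    P.resJets h (JetAlgebra.of _ a) = JetAlgebra.of _ (res (P.away_le h) a) :=
  JetAlgebra.map_of _ _ _

theorem resJets_der {U V : P.X.left.Opens} (h : V ≤ U) (s : P.awayJets U) :
    P.resJets h (JetAlgebra.der _ s) = JetAlgebra.der _ (P.resJets h s) :=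
  JetAlgebra.map_der _ _ _

theorem resJets_sym {U V : P.X.left.Opens} (h : V ≤ U) (a : Γ(P.X.left, P.away U)) (n : ℕ) :
    P.resJets h (JetAlgebra.sym _ a n) = JetAlgebra.sym _ (res (P.away_le h) a) n :=
  JetAlgebra.map_sym _ _ _ _

theorem resJets_resJets {U V W : P.X.left.Opens} (h : V ≤ U) (h' : W ≤ V) (s : P.awayJets U) :
    P.resJets h' (P.resJets h s) = P.resJets (h'.trans h) s := by
  refine RingHom.congr_fun (f := (P.resJets h').comp (P.resJets h))
    (JetAlgebra.hom_ext fun a n ↦ ?_) s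
  rw [RingHom.comp_apply, resJets_sym, resJets_sym, res_res, resJets_sym]

theorem resJets_refl {U : P.X.left.Opens} (s : P.awayJets U) : P.resJets le_rfl s = s := by
  refine RingHom.congr_fun (f := P.resJets le_rfl) (g := .id _)
    (JetAlgebra.hom_ext fun a n ↦ ?_) s
  rw [resJets_sym]
  change JetAlgebra.sym _ ((P.X.left.presheaf.map (𝟙 _)).hom a) n = _
  rw [P.X.left.presheaf.map_id]
  rfl

theorem exists_mem_ideal_lift (Z : Closeds P.X.left)
    (U : P.X.left.AffineZariskiSite) (f : Γ(P.X.left, U.toOpens))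
    {x' : Γ(P.X.left, P.X.left.basicOpen f)}
    (hx' : x' ∈ idealOf Z (U.basicOpen f)) : ∃ (n : ℕ), ∃ x ∈ idealOf Z U,
      res (P.X.left.basicOpen_le f) x = res (P.X.left.basicOpen_le f) f ^ n * x' := by
  let W : P.X.left.affineOpens := P.X.left.affineBasicOpen (U := ⟨U.toOpens, U.2⟩) f
  have hWU : W ≤ ⟨U.toOpens, U.2⟩ := P.X.left.basicOpen_le f
  change x' ∈ (Scheme.IdealSheafData.vanishingIdeal Z).ideal W at hx'
  rw [← Scheme.IdealSheafData.map_ideal _ hWU] at hx'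
  let _ := (res hWU).toAlgebra
  have : IsLocalization.Away f Γ(P.X.left, W) := U.2.isLocalization_basicOpen f
  obtain ⟨⟨x, ⟨_, n, rfl⟩⟩, h⟩ :=
    (IsLocalization.mem_map_algebraMap_iff (Submonoid.powers f) Γ(P.X.left, W)).mp hx'
  refine ⟨n, x, x.2, ?_⟩
  rw [mul_comm, ← map_pow]
  exact h.symm

theorem exists_fn_lift (U : P.X.left.AffineZariskiSite) (f : Γ(P.X.left, U.toOpens))
    (a' : Γ(P.X.left, P.X.left.basicOpen f)) : ∃ (n : ℕ) (a : Γ(P.X.left, U.toOpens)),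
      res (P.X.left.basicOpen_le f) a = res (P.X.left.basicOpen_le f) f ^ n * a' := by
  let _ := (res (P.X.left.basicOpen_le f)).toAlgebra
  have : IsLocalization.Away f Γ(P.X.left, P.X.left.basicOpen f) :=
    U.2.isLocalization_basicOpen f
  obtain ⟨n, a, h⟩ := IsLocalization.Away.surj f a'
  refine ⟨n, a, ?_⟩
  rw [mul_comm]
  exact h.symm

theorem exists_generator_lift (Z : Closeds P.X.left) (hZ : Z ∈ components P.D)
    (U : P.X.left.AffineZariskiSite) (f : Γ(P.X.left, U.toOpens))
    (y' : Γ(P.X.left, P.away (P.X.left.basicOpen f)))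
    (hy' : ∀ t ∈ idealOf Z (U.basicOpen f), ∃ a : Γ(P.X.left, P.X.left.basicOpen f),
      y' * res inf_le_left t = res inf_le_left a) :
    ∃ (n : ℕ) (y : Γ(P.X.left, P.away U.toOpens)),
      (∀ t ∈ idealOf Z U, ∃ a : Γ(P.X.left, U.toOpens), y * res inf_le_left t = res inf_le_left a) ∧
      res (P.away_le (P.X.left.basicOpen_le f)) y =
        res (inf_le_left.trans (P.X.left.basicOpen_le f)) f ^ n * y' := by
  let ρ : Γ(P.X.left, P.away U.toOpens) →+* Γ(P.X.left, P.away (P.X.left.basicOpen f)) :=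
    res (P.away_le (P.X.left.basicOpen_le f))
  let ι : Γ(P.X.left, U.toOpens) →+* Γ(P.X.left, P.away U.toOpens) := res inf_le_left
  let ι' : Γ(P.X.left, P.X.left.basicOpen f) →+* Γ(P.X.left, P.away (P.X.left.basicOpen f)) :=
    res inf_le_left
  let r : Γ(P.X.left, U.toOpens) →+* Γ(P.X.left, P.X.left.basicOpen f) := res (P.X.left.basicOpen_le f)
  have hρι : ∀ a, ρ (ι a) = ι' (r a) := fun a ↦ (res_res ..).trans (res_res ..).symm
  have hf : res (inf_le_left.trans (P.X.left.basicOpen_le f)) f = ρ (ι f) := (res_res ..).symm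
  have hr : ∀ t ∈ idealOf Z U, r t ∈ idealOf Z (U.basicOpen f) := fun t ht ↦
    Scheme.IdealSheafData.ideal_le_comap_ideal (Scheme.IdealSheafData.vanishingIdeal Z)
      (U := ⟨_, (U.basicOpen f).2⟩) (V := ⟨U.toOpens, U.2⟩) (P.X.left.basicOpen_le f) ht
  rw [hf]
  let _ := ρ.toAlgebra
  have : IsLocalization.Away (ι f) Γ(P.X.left, P.away (P.X.left.basicOpen f)) :=
    P.isLocalization_away U f
  obtain ⟨m, y₀, hy₀⟩ := IsLocalization.Away.surj (ι f) y'
  replace hy₀ : y' * ρ (ι f) ^ m = ρ y₀ := hy₀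
  have key : ∀ t ∈ idealOf Z U, ∃ N, ∃ a, ι f ^ N * y₀ * ι t = ι a := by
    intro t ht
    obtain ⟨a', ha'⟩ := hy' (r t) (hr t ht)
    replace ha' : y' * ι' (r t) = ι' a' := ha'
    obtain ⟨p, a, ha⟩ := P.exists_fn_lift U f a'
    replace ha : r a = r f ^ p * a' := ha
    have h1 : ρ (y₀ * ι f ^ p * ι t) = ρ (ι (f ^ m * a)) := by
      rw [hρι (f ^ m * a)]
      simp only [map_mul, map_pow, ha, ← ha', ← hy₀, hρι]
      ring
    obtain ⟨⟨_, q, rfl⟩, h2⟩ := (IsLocalization.eq_iff_exists (Submonoid.powers (ι f))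
      Γ(P.X.left, P.away (P.X.left.basicOpen f))).mp h1
    refine ⟨p + q, f ^ q * (f ^ m * a), ?_⟩
    replace h2 : ι f ^ q * (y₀ * ι f ^ p * ι t) = ι f ^ q * ι (f ^ m * a) := h2
    rw [map_mul, map_pow, ← h2]
    ring
  obtain ⟨S, hS⟩ := P.fg_idealOf Z hZ U
  choose! N hN using key
  let M := S.sup N
  have key' : ∀ t ∈ idealOf Z U, ∃ a, ι f ^ M * y₀ * ι t = ι a := by
    intro t ht
    rw [← hS] at ht
    induction ht using Submodule.span_induction with
    | mem t ht =>
      have ht' : t ∈ idealOf Z U := hS ▸ Submodule.subset_span ht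
      obtain ⟨a, ha⟩ := hN t ht'
      obtain ⟨d, hd⟩ := Nat.exists_eq_add_of_le (Finset.le_sup (f := N) ht)
      refine ⟨f ^ d * a, ?_⟩
      rw [show M = N t + d from hd, map_mul, ← ha, map_pow]
      ring
    | zero => exact ⟨0, by simp⟩
    | add s t _ _ hs ht =>
      obtain ⟨a, ha⟩ := hs
      obtain ⟨b, hb⟩ := ht
      exact ⟨a + b, by rw [map_add, mul_add, ha, hb, map_add]⟩
    | smul c t _ ht =>
      obtain ⟨a, ha⟩ := ht
      exact ⟨c * a, by rw [smul_eq_mul, map_mul, map_mul, ← ha]; ring⟩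
  refine ⟨M + m, ι f ^ M * y₀, key', ?_⟩
  change ρ _ = _
  rw [map_mul, map_pow, ← hy₀]
  ring

theorem resJets_mem {U V : P.X.left.AffineZariskiSite} (h : V.toOpens ≤ U.toOpens) {s : P.awayJets U.toOpens}
    (hs : s ∈ P.logJetAlgebra U) : P.resJets h s ∈ P.logJetAlgebra V := by
  suffices P.logJetAlgebra U ≤ (P.logJetAlgebra V).comap (P.resJets h) from this hs
  refine P.logJetAlgebra_le ?_ fun s hs ↦ ?_
  · rintro _ (⟨a, rfl⟩ | ⟨Z, hZ, x, hx, y, hy, rfl⟩)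
    · refine Subring.mem_comap.mpr ?_
      rw [resJets_fn]
      exact P.fn_mem _ _
    · refine Subring.mem_comap.mpr (P.generators_subset V (.inr ⟨Z, hZ, res h x, ?_,
        res (P.away_le h) y, ?_, ?_⟩))
      · exact Scheme.IdealSheafData.ideal_le_comap_ideal (Scheme.IdealSheafData.vanishingIdeal Z)
          (U := ⟨V.toOpens, V.2⟩) (V := ⟨U.toOpens, U.2⟩) h hx
      · intro t ht
        have hm := Scheme.IdealSheafData.map_ideal (Scheme.IdealSheafData.vanishingIdeal Z)
          (U := ⟨V.toOpens, V.2⟩) (V := ⟨U.toOpens, U.2⟩) h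
        change t ∈ (Scheme.IdealSheafData.vanishingIdeal Z).ideal ⟨V.toOpens, V.2⟩ at ht
        rw [← hm] at ht
        induction ht using Submodule.span_induction with
        | mem t ht =>
          obtain ⟨t, ht, rfl⟩ := ht
          obtain ⟨a, ha⟩ := hy t ht
          refine ⟨res h a, ?_⟩
          have := congrArg (res (P.away_le h)) ha
          rw [map_mul, res_res, res_res] at this
          rw [res_res]
          refine Eq.trans ?_ this
          congr 1
          exact res_res ..
        | zero => exact ⟨0, by simp⟩
        | add s t _ _ hs ht =>
          obtain ⟨a, ha⟩ := hs
          obtain ⟨b, hb⟩ := ht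
          exact ⟨a + b, by rw [map_add, mul_add, ha, hb, map_add]⟩
        | smul c t _ ht =>
          obtain ⟨a, ha⟩ := ht
          exact ⟨c * a, by rw [smul_eq_mul, map_mul, map_mul, ← ha]; ring⟩
      · rw [map_mul, resJets_of, resJets_der, resJets_fn]
  · refine Subring.mem_comap.mpr ?_
    rw [resJets_der]
    exact P.der_mem V hs

theorem exists_logJet_lift (U : P.X.left.AffineZariskiSite) (f : Γ(P.X.left, U.toOpens))
    {s : P.awayJets (P.X.left.basicOpen f)} (hs : s ∈ P.logJetAlgebra (U.basicOpen f)) :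
    ∃ (n : ℕ), ∃ l ∈ P.logJetAlgebra U, P.resJets (P.X.left.basicOpen_le f) l =
      P.resJets (P.X.left.basicOpen_le f) (P.fn U.toOpens f) ^ n * s := by
  let m : P.awayJets U.toOpens →+* P.awayJets (P.X.left.basicOpen f) :=
    P.resJets (P.X.left.basicOpen_le f)
  let F := m (P.fn U.toOpens f)
  let M := (P.logJetAlgebra U).map m
  let δ := JetAlgebra.der (consts P.X (P.away (P.X.left.basicOpen f)))
  have hF : ∀ n, F ^ n ∈ M := fun n ↦ pow_mem (Subring.mem_map.mpr ⟨_, P.fn_mem U f, rfl⟩) n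
  have hδ : ∀ x ∈ M, δ x ∈ M := by
    rintro _ ⟨x, hx, rfl⟩
    exact Subring.mem_map.mpr ⟨_, P.der_mem U hx, P.resJets_der _ _⟩
  let T : Subring (P.awayJets (P.X.left.basicOpen f)) :=
    { carrier := {s | ∃ n, F ^ n * s ∈ M}
      mul_mem' := by
        rintro x y ⟨n, hn⟩ ⟨p, hp⟩
        refine ⟨n + p, ?_⟩
        rw [show F ^ (n + p) * (x * y) = (F ^ n * x) * (F ^ p * y) by ring]
        exact mul_mem hn hp
      one_mem' := ⟨0, by simp⟩
      add_mem' := by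
        rintro x y ⟨n, hn⟩ ⟨p, hp⟩
        refine ⟨n + p, ?_⟩
        rw [show F ^ (n + p) * (x + y) = F ^ p * (F ^ n * x) + F ^ n * (F ^ p * y) by ring]
        exact add_mem (mul_mem (hF _) hn) (mul_mem (hF _) hp)
      zero_mem' := ⟨0, by simp⟩
      neg_mem' := by
        rintro x ⟨n, hn⟩
        exact ⟨n, by rw [mul_neg]; exact neg_mem hn⟩ }
  have hMT : ∀ x ∈ M, x ∈ T := fun x hx ↦ ⟨0, by simpa using hx⟩
  have hFT : ∀ n x, F ^ n * x ∈ T → x ∈ T := by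
    rintro n x ⟨p, hp⟩
    exact ⟨p + n, by rwa [pow_add, mul_assoc]⟩
  have hfn : ∀ a, P.fn _ a ∈ T := by
    intro a'
    obtain ⟨n, a, ha⟩ := P.exists_fn_lift U f a'
    refine ⟨n, Subring.mem_map.mpr ⟨P.fn U.toOpens a, P.fn_mem U a, ?_⟩⟩
    simp only [m, F, resJets_fn, ha, map_mul, map_pow]
  suffices P.logJetAlgebra (U.basicOpen f) ≤ T by
    obtain ⟨n, hn⟩ := this hs
    obtain ⟨l, hl, h⟩ := Subring.mem_map.mp hn
    exact ⟨n, l, hl, h⟩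
  refine P.logJetAlgebra_le (U := U.basicOpen f) ?_ fun s' hs ↦ ?_
  · rintro s hs
    have hs : (∃ a : Γ(P.X.left, P.X.left.basicOpen f), s = P.fn _ a) ∨
      ∃ Z ∈ components P.D, ∃ x' : Γ(P.X.left, P.X.left.basicOpen f),
        x' ∈ idealOf Z (U.basicOpen f) ∧
        ∃ y' : Γ(P.X.left, P.away (P.X.left.basicOpen f)),
        (∀ t ∈ idealOf Z (U.basicOpen f), ∃ a : Γ(P.X.left, P.X.left.basicOpen f),
          y' * res inf_le_left t = res inf_le_left a) ∧
        s = JetAlgebra.of _ y' * JetAlgebra.der _ (P.fn (P.X.left.basicOpen f) x') := hs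
    rcases hs with ⟨a, rfl⟩ | ⟨Z, hZ, x', hx', y', hy', rfl⟩
    · exact hfn a
    · obtain ⟨p, x, hx, hxx'⟩ := P.exists_mem_ideal_lift Z U f hx'
      obtain ⟨q, y, hy, hyy'⟩ := P.exists_generator_lift Z hZ U f y' hy'
      obtain ⟨a, ha⟩ := hy' x' hx'
      have hF' : F = P.fn _ (res (P.X.left.basicOpen_le f) f) := P.resJets_fn _ _
      let Y' := JetAlgebra.of (consts P.X (P.away (P.X.left.basicOpen f))) y'
      let X' := P.fn (P.X.left.basicOpen f) x'
      have h1 : m (JetAlgebra.of _ y) = F ^ q * Y' := by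
        simp only [m, resJets_of]
        rw [hyy', map_mul, map_pow, ← res_res (P.X.left.basicOpen_le f) inf_le_left, hF']
        rfl
      have h2 : m (P.fn U.toOpens x) = F ^ p * X' := by
        simp only [m, resJets_fn]
        rw [hxx', map_mul, map_pow, hF']
      have h3 : Y' * X' = P.fn _ a := by
        change JetAlgebra.of _ _ * JetAlgebra.of _ _ = JetAlgebra.of _ _
        rw [← map_mul]
        exact congrArg _ ha
      have h4 : F ^ (q + p) * (Y' * δ X') =
          m (JetAlgebra.of _ y * JetAlgebra.der _ (P.fn U.toOpens x)) -
            F ^ q * δ (F ^ p) * P.fn _ a := by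
        rw [map_mul, h1]
        have : m (JetAlgebra.der _ (P.fn U.toOpens x)) = δ (F ^ p * X') := by
          rw [← h2]
          exact P.resJets_der _ _
        rw [this, Derivation.leibniz, ← h3]
        simp only [smul_eq_mul]
        ring
      refine hFT (q + p) _ ?_
      change F ^ (q + p) * (Y' * δ X') ∈ T
      rw [h4]
      refine sub_mem (hMT _ (Subring.mem_map.mpr ⟨_, P.generators_subset U
        (.inr ⟨Z, hZ, x, hx, y, hy, rfl⟩), rfl⟩)) (mul_mem (hMT _ (mul_mem (hF _) (hδ _ (hF _))))
          (hfn a))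
  · let s : P.awayJets (P.X.left.basicOpen f) := s'
    obtain ⟨n, hn⟩ : ∃ n, F ^ n * s ∈ M := hs
    refine hFT (n + n) _ (hMT _ ?_)
    have : F ^ (n + n) * δ s = F ^ n * δ (F ^ n * s) - δ (F ^ n) * (F ^ n * s) := by
      rw [Derivation.leibniz]
      simp only [smul_eq_mul]
      ring
    change F ^ (n + n) * δ s ∈ M
    rw [this]
    exact sub_mem (mul_mem (hF _) (hδ _ hn)) (mul_mem (hδ _ (hF _)) hn)

/-- The presheaf of algebras of log jets on the affine open subsets of `X`. -/
def logJetPresheaf : P.X.left.AffineZariskiSiteᵒᵖ ⥤ CommRingCat.{u} where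
  obj U := .of (P.logJetAlgebra U.unop)
  map {U V} i := CommRingCat.ofHom <|
    (P.resJets (Scheme.AffineZariskiSite.toOpens_mono i.unop.le)).restrict _ _
      fun _ hs ↦ P.resJets_mem _ hs
  map_id U := by
    exact CommRingCat.hom_ext (RingHom.ext fun s ↦ Subtype.ext (P.resJets_refl s.1))
  map_comp i j := by
    exact CommRingCat.hom_ext (RingHom.ext fun s ↦ Subtype.ext (P.resJets_resJets
      (Scheme.AffineZariskiSite.toOpens_mono i.unop.le)
      (Scheme.AffineZariskiSite.toOpens_mono j.unop.le) s.1).symm)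

/-- The structure map from the functions on `X`. -/
def logJetPresheafMap : (Scheme.AffineZariskiSite.toOpensFunctor P.X.left).op ⋙ P.X.left.presheaf ⟶
    P.logJetPresheaf where
  app U := CommRingCat.ofHom ((P.fn U.unop.1).codRestrict _ (P.fn_mem U.unop))
  naturality U V i := by
    ext a
    exact Subtype.ext (P.resJets_fn (Scheme.AffineZariskiSite.toOpens_mono i.unop.le) a).symm

theorem coequifibered_logJetPresheafMap : P.logJetPresheafMap.Coequifibered := by
  refine Scheme.AffineZariskiSite.coequifibered_iff_forall_isLocalizationAway.mpr fun U f ↦ ?_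
  let _ := (P.logJetPresheaf.map (homOfLE (U.basicOpen_le f)).op).hom.toAlgebra
  have hα : ∀ l : P.logJetAlgebra U, (algebraMap (P.logJetPresheaf.obj (.op U))
      (P.logJetPresheaf.obj (.op (U.basicOpen f))) l).1 =
        P.resJets (P.X.left.basicOpen_le f) l.1 := fun _ ↦ rfl
  have hF : (algebraMap (P.logJetPresheaf.obj (.op U)) (P.logJetPresheaf.obj (.op (U.basicOpen f)))
      (P.logJetPresheafMap.app (.op U) f)).1 =
        P.resJets (P.X.left.basicOpen_le f) (P.fn U.toOpens f) := rfl
  refine (isLocalization_iff _ _).mpr ⟨?_, ?_, ?_⟩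
  · rintro ⟨_, n, rfl⟩
    have h : algebraMap (P.logJetPresheaf.obj (.op U)) (P.logJetPresheaf.obj (.op (U.basicOpen f)))
        (P.logJetPresheafMap.app (.op U) f) =
          (P.logJetPresheafMap.app (.op (U.basicOpen f))).hom (res (P.X.left.basicOpen_le f) f) :=
      Subtype.ext (P.resJets_fn (P.X.left.basicOpen_le f) f)
    rw [map_pow, h]
    exact ((RingedSpace.isUnit_res_basicOpen _ f).map _).pow n
  · intro s
    obtain ⟨n, l, hl, h⟩ := P.exists_logJet_lift U f s.2
    refine ⟨⟨⟨l, hl⟩, ⟨_, n, rfl⟩⟩, Subtype.ext ?_⟩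
    rw [map_pow]
    refine Eq.trans ?_ h.symm
    exact mul_comm _ _
  · intro x y hxy
    have h : P.resJets (P.X.left.basicOpen_le f) (x.1 - y.1) = 0 := by
      rw [map_sub, sub_eq_zero]
      exact congrArg Subtype.val hxy
    obtain ⟨n, hn⟩ := JetAlgebra.exists_pow_mul_eq_zero _ _ _ (P.isLocalization_away U f) _ h
    refine ⟨⟨_, n, rfl⟩, Subtype.ext ?_⟩
    rw [mul_sub, sub_eq_zero] at hn
    exact hn

/-- The data to glue the spectra of the algebras of log jets. -/
def logJetGluingData : (Scheme.AffineZariskiSite.directedCover P.X.left).RelativeGluingData :=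
  Scheme.AffineZariskiSite.relativeGluingData P.coequifibered_logJetPresheafMap

/-- The log jet space: the relative spectrum over `X` of the algebras of log jets. -/
def logJet : Over (Spec (.of k)) := Over.mk (P.logJetGluingData.toBase ≫ P.X.hom)

/-- The projection from the log jet space to `X`. -/
def logJetProj : P.logJet ⟶ P.X := Over.homMk P.logJetGluingData.toBase

/-- The pull-back of `D` to the log jet space: the log jets with centre in `D`. -/
def logJetDivisor : Closeds P.logJet.left := P.D.preimage P.logJetProj.left.continuous

/-- The chart `Spec 𝓛(U) → J` of the log jet space over an affine open subset `U`, where `𝓛(U)` is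
the algebra of log jets over `U`. -/
def logJetChart (U : P.X.left.AffineZariskiSite) :
    Spec (.of (P.logJetAlgebra U)) ⟶ P.logJet.left := P.logJetGluingData.cover.f U

theorem top_le_preimage_logJetChart (U : P.X.left.AffineZariskiSite) :
    ⊤ ≤ P.logJetChart U ⁻¹ᵁ P.logJetProj.left ⁻¹ᵁ U.toOpens := by
  rintro x -
  have h : P.logJetChart U ≫ P.logJetProj.left = P.logJetGluingData.natTrans.app U ≫ U.toOpens.ι :=
    P.logJetGluingData.ι_toBase U
  change (P.logJetChart U ≫ P.logJetProj.left) x ∈ U.toOpens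
  rw [h]
  exact (P.logJetGluingData.natTrans.app U x).2

/-- The identification of the functions on the preimage of `U` in the log jet space with the algebra
of log jets over `U`. -/
def logJetSections (U : P.X.left.AffineZariskiSite) :
    Γ(P.logJet.left, P.logJetProj.left ⁻¹ᵁ U.toOpens) →+* P.logJetAlgebra U :=
  ((P.logJetChart U).appLE _ ⊤ (P.top_le_preimage_logJetChart U) ≫
    (Scheme.ΓSpecIso (.of (P.logJetAlgebra U))).hom).hom

/-- A morphism of log pairs `(X, D_X) → (Y, D_Y)` is a morphism `f : X → Y` over `k` with
`f⁻¹(D_Y) ⊆ D_X`, that is, one that pulls functions invertible off `D_Y` back to functions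
invertible off `D_X`. -/
@[ext]
structure Hom (P Q : LogPair k) where
  /-- the morphism of schemes over `k` -/
  hom : P.X ⟶ Q.X
  mem_of_mem : ∀ x, hom.left x ∈ Q.D → x ∈ P.D

instance : Category (LogPair k) where
  Hom := Hom
  id P := ⟨𝟙 _, fun _ h ↦ h⟩
  comp f g := ⟨f.hom ≫ g.hom, fun x h ↦ f.mem_of_mem x (g.mem_of_mem _ h)⟩

end LogPair

/-- A vector field on a `k`-scheme: a `k`-linear derivation of the structure sheaf. -/
structure VectorField (X : Over (Spec (.of k))) where
  /-- the derivation on the functions on `U` -/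
  der (U : X.left.Opens) : Γ(X.left, U) →+ Γ(X.left, U)
  leibniz : ∀ U a b, der U (a * b) = a * der U b + b * der U a
  consts : ∀ U c, der U (consts X U c) = 0
  res : ∀ {U V : X.left.Opens} (h : V ≤ U) a, res h (der U a) = der V (res h a)

/-- A vector field is tangent to the closed subset `D` if it preserves the ideal sheaf of `D`. -/
def VectorField.IsTangent {X : Over (Spec (.of k))} (δ : VectorField X) (D : Closeds X.left) :
    Prop :=
  ∀ U : X.left.affineOpens, ∀ s ∈ (Scheme.IdealSheafData.vanishingIdeal D).ideal U,
    δ.der U.1 s ∈ (Scheme.IdealSheafData.vanishingIdeal D).ideal U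

variable (k) in
/-- A log commutative vertex scheme: a log pair with a vector field tangent to the divisor. -/
structure LCVS where
  /-- the underlying log pair -/
  pair : LogPair k
  /-- the vector field -/
  field : VectorField pair.X
  isTangent : field.IsTangent pair.D

namespace LCVS

/-- A morphism of log commutative vertex schemes: a morphism of log pairs compatible with the vector
fields. -/
@[ext]
structure Hom (Y Z : LCVS k) where
  /-- the morphism of log pairs -/
  hom : Y.pair ⟶ Z.pair
  map_der : ∀ (U : Z.pair.X.left.Opens) (s : Γ(Z.pair.X.left, U)),
    (hom.hom.left.app U).hom (Z.field.der U s) = Y.field.der _ ((hom.hom.left.app U).hom s)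

instance : Category (LCVS k) where
  Hom := Hom
  id Y := ⟨𝟙 _, fun U s ↦ rfl⟩
  comp f g := ⟨f.hom ≫ g.hom, fun U s ↦ by
    change (g.hom.hom.left.app U ≫ f.hom.hom.left.app _).hom _ = _
    simp only [CommRingCat.hom_comp, RingHom.comp_apply, g.map_der, f.map_der]
    rfl⟩

variable (k) in
/-- The forgetful functor `(Y, D, ∂) ↦ (Y, D)`. -/
def forget : LCVS k ⥤ LogPair k where
  obj Y := Y.pair
  map f := f.hom

end LCVS

end LogPairs

end LogJets

end

open AlgebraicGeometry CategoryTheory LogJets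

/-!
Étale coordinates `x_j` on an affine open `U`, with the components of `D` among them, turn the
algebra of log jets over `U` into a polynomial ring over `𝒪(U)` in variables `z_{j,n}`, where
`z_{j,n}` is the `n`-th derivative of `∂x_j / x_j` for the components and of `∂x_j` for the other
coordinates. These elements generate because an étale extension has no relative differentials. They
are independent because the polynomial ring has a derivation of the same shape, and in
characteristic `0` Taylor expansion along it gives a left inverse over `U ∖ D`. Hence the log jets
are locally an affine space over `X`: étale coordinates persist, the pull-back of `D` is reduced,
and its components are the preimages of those of `D`.

For the universal property, a morphism from `(Y, D_Y, ∂_Y)` sends the jets of `𝒪(U ∖ D)` to `𝒪(V ∖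
D_Y)`, for `V` the preimage of `U`, by Taylor expansion. Locally, the pull-back of an equation `γ`
of a component is a unit off `D_Y`, hence divides a product of equations of components of `D_Y`.
Each of these divides its derivative since `∂_Y` is tangent to `D_Y`, so `γ` does too, and the log
jets land in `𝒪(V)`.
-/

namespace LogJets

open TopologicalSpace

noncomputable section

section Derivations

variable {A B R S : Type*} [CommRing A] [CommRing B] [CommRing R] [CommRing S]

theorem exists_derivation_extension (A : Type*) {B M : Type*} [CommRing A] [CommRing B]
    [Algebra R A] [Algebra R B] [Algebra A B] [IsScalarTower R A B] [Algebra.FormallyEtale A B]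
    [AddCommGroup M] [Module R M] [Module A M] [Module B M] [IsScalarTower R A M]
    [IsScalarTower R B M] [IsScalarTower A B M] (D : Derivation R A M) :
    ∃ D' : Derivation R B M, ∀ a, D' (algebraMap A B a) = D a := by
  have hΩ := KaehlerDifferential.isBaseChange_of_formallyEtale R A B
  refine ⟨(hΩ.lift D.liftKaehlerDifferential).compDer (KaehlerDifferential.D R B), fun a ↦ ?_⟩
  change hΩ.lift D.liftKaehlerDifferential (KaehlerDifferential.D R B (algebraMap A B a)) = D a
  rw [← KaehlerDifferential.map_D R R A B]
  exact (hΩ.lift_eq _ _).trans (D.liftKaehlerDifferential_comp_D a)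

/-- A derivation `d : B → R`, where `R` is a `B`-module through the ring homomorphism `g`. The
module structure is not an instance, so that several homomorphisms can be used at once; linearity
over constants is stated separately where it is needed. -/
def IsDerivationAlong (g : B →+* R) (d : B →+ R) : Prop :=
  ∀ a b, d (a * b) = g a * d b + g b * d a

namespace IsDerivationAlong

theorem comp {g : B →+* R} {d : B →+ R} (hd : IsDerivationAlong g d) (ψ : A →+* B) :
    IsDerivationAlong (g.comp ψ) (d.comp (ψ : A →+ B)) := fun a b ↦ by
  simpa using hd (ψ a) (ψ b)

theorem postcomp {g : B →+* R} {d : B →+ R} (hd : IsDerivationAlong g d) (χ : R →+* S) :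
    IsDerivationAlong (χ.comp g) ((χ : R →+ S).comp d) := fun a b ↦ by
  simp [hd a b]

theorem sub {g : B →+* R} {d d' : B →+ R} (hd : IsDerivationAlong g d)
    (hd' : IsDerivationAlong g d') : IsDerivationAlong g (d - d') := fun a b ↦ by
  simp only [AddMonoidHom.sub_apply, hd a b, hd' a b]
  ring

theorem eq_zero_of_formallyUnramified {ψ : A →+* B} (hψ : ψ.FormallyUnramified) {g : B →+* R}
    {d : B →+ R} (hd : IsDerivationAlong g d) (h : ∀ a, d (ψ a) = 0) : d = 0 := by
  let _ := ψ.toAlgebra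
  let _ := g.toAlgebra
  let _ := (g.comp ψ).toAlgebra
  have : IsScalarTower A B R := .of_algebraMap_eq fun _ ↦ rfl
  have : Algebra.FormallyUnramified A B := hψ
  let D : Derivation A B R := Derivation.mk'
    { toFun := d
      map_add' := map_add d
      map_smul' := fun a b ↦ by
        rw [Algebra.smul_def, hd, RingHom.algebraMap_toAlgebra, h, mul_zero, add_zero]
        rfl } hd
  have hD : D = 0 := by
    rw [← D.liftKaehlerDifferential_comp, Subsingleton.elim D.liftKaehlerDifferential 0]
    rfl
  ext b
  exact DFunLike.congr_fun hD b

theorem ext_of_formallyUnramified {ψ : A →+* B} (hψ : ψ.FormallyUnramified) {g : B →+* R}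
    {d d' : B →+ R} (hd : IsDerivationAlong g d) (hd' : IsDerivationAlong g d')
    (h : ∀ a, d (ψ a) = d' (ψ a)) : d = d' :=
  sub_eq_zero.mp <| (hd.sub hd').eq_zero_of_formallyUnramified hψ fun a ↦ sub_eq_zero.mpr (h a)

theorem exists_extension {ψ : A →+* B} (hψ : ψ.Etale) {g : B →+* R} {d : A →+ R}
    (hd : IsDerivationAlong (g.comp ψ) d) :
    ∃ d' : B →+ R, IsDerivationAlong g d' ∧ ∀ a, d' (ψ a) = d a := by
  let _ := ψ.toAlgebra
  let _ := g.toAlgebra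
  let _ := (g.comp ψ).toAlgebra
  have : IsScalarTower A B R := .of_algebraMap_eq fun _ ↦ rfl
  have : Algebra.Etale A B := hψ
  obtain ⟨D, hD⟩ := exists_derivation_extension A (B := B)
    (Derivation.mk' d.toIntLinearMap hd : Derivation ℤ A R)
  exact ⟨D.toLinearMap.toAddMonoidHom, D.leibniz, hD⟩

end IsDerivationAlong

theorem dvd_derivation_of_mul_eq_prod {d : R →+ R} (hd : IsDerivationAlong (.id R) d)
    (s : Multiset R) (hs : ∀ p ∈ s, Prime p ∧ p ∈ nonZeroDivisors R ∧ p ∣ d p)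
    {a b : R} (h : a * b = s.prod) : a ∣ d a := by
  induction s using Multiset.induction_on generalizing a b with
  | empty => exact (IsUnit.of_mul_eq_one _ (h.trans Multiset.prod_zero)).dvd
  | cons p s ih =>
    obtain ⟨hp, hp0, hpd⟩ := hs p (Multiset.mem_cons_self p s)
    replace ih := @ih fun q hq ↦ hs q (Multiset.mem_cons_of_mem hq)
    rw [Multiset.prod_cons] at h
    rcases hp.dvd_or_dvd ⟨_, h⟩ with ⟨a', rfl⟩ | ⟨b', rfl⟩
    · have ha' : a' ∣ d a' :=
        ih ((mul_cancel_left_mem_nonZeroDivisors hp0).mp ((mul_assoc p a' b).symm.trans h))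
      rw [hd]
      exact dvd_add (mul_dvd_mul_left p ha') (mul_comm p a' ▸ mul_dvd_mul_left a' hpd)
    · exact ih ((mul_cancel_left_mem_nonZeroDivisors hp0).mp ((mul_left_comm p a b').trans h))

end Derivations

namespace JetAlgebra

variable {k B R : Type*} [Field k] [CommRing B] [CommRing R]

theorem of_comp {φ : k →+* B} : (of φ).comp φ = algebraMap k (JetAlgebra φ) :=
  RingHom.ext fun c ↦ (sym_const φ c 0).trans (if_pos rfl)

theorem isDerivationAlong_der {φ : k →+* B} :
    IsDerivationAlong (.id _) (der φ : JetAlgebra φ →+ JetAlgebra φ) := (der φ).leibniz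

theorem of_mul_der_of_mul {φ : k →+* B} {g v : B}
    (hgv : g * v = 1) (y a : B) :
    of φ y * der φ (of φ (g * a)) = of φ (y * g) * der φ (of φ a) +
      of φ (a * (y * g)) * (of φ v * der φ (of φ g)) := by
  have hder : der φ (of φ g) = of φ g * (of φ v * der φ (of φ g)) := by
    rw [← mul_assoc, ← map_mul, hgv, map_one, one_mul]
  rw [map_mul, Derivation.leibniz, smul_eq_mul, smul_eq_mul]
  nth_rewrite 1 [hder]
  simp only [map_mul]
  ring

/-- The divided powers `(n!)⁻¹ dⁿ` of a derivation `d` of a `k`-algebra `g : k → R`. Dividing by one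
integer at a time makes the recursion for `d` hold without linearity of `d` over `k`. -/
def divPow (g : k →+* R) (d : R →+ R) : ℕ → R → R
  | 0, a => a
  | n + 1, a => g ((n + 1 : ℕ) : k)⁻¹ * d (divPow g d n a)

theorem divPow_add {g : k →+* R} {d : R →+ R} (n : ℕ) (a b : R) :
    divPow g d n (a + b) = divPow g d n a + divPow g d n b := by
  induction n with
  | zero => rfl
  | succ n ih => simp only [divPow, ih, map_add, mul_add]

theorem divPow_const {g : k →+* R} {d : R →+ R} (hc : ∀ c, d (g c) = 0) (c : k) (n : ℕ) :
    divPow g d n (g c) = if n = 0 then g c else 0 := by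
  induction n with
  | zero => rfl
  | succ n ih =>
    rw [divPow, ih, if_neg n.succ_ne_zero]
    split_ifs <;> simp [hc]

variable [CharZero k]

theorem nsmul_succ_injective (g : k →+* R) (n : ℕ) :
    Function.Injective fun a : R ↦ (n + 1) • a := by
  refine Function.LeftInverse.injective (g := fun a ↦ g ((n + 1 : ℕ) : k)⁻¹ * a) fun a ↦ ?_
  dsimp only
  rw [nsmul_eq_mul, ← map_natCast g, ← mul_assoc, ← map_mul,
    inv_mul_cancel₀ (Nat.cast_ne_zero.mpr n.succ_ne_zero), map_one, one_mul]

theorem succ_nsmul_divPow (g : k →+* R) (d : R →+ R) (n : ℕ) (a : R) :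
    (n + 1) • divPow g d (n + 1) a = d (divPow g d n a) := by
  rw [divPow, nsmul_eq_mul, ← mul_assoc, ← map_natCast g, ← map_mul,
    mul_inv_cancel₀ (Nat.cast_ne_zero.mpr n.succ_ne_zero), map_one, one_mul]

theorem divPow_mul {g : k →+* R} {d : R →+ R} (hd : IsDerivationAlong (.id R) d) (n : ℕ)
    (a b : R) : divPow g d n (a * b) =
      ∑ p ∈ Finset.HasAntidiagonal.antidiagonal n, divPow g d p.1 a * divPow g d p.2 b := by
  induction n with
  | zero => simp [divPow]
  | succ n ih =>
    refine nsmul_succ_injective g n ?_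
    dsimp only
    rw [succ_nsmul_divPow, ih, ← sum_antidiagonal_der (divPow g d · a) (divPow g d · b), map_sum]
    refine Finset.sum_congr rfl fun p _ ↦ ?_
    rw [hd, succ_nsmul_divPow, succ_nsmul_divPow]
    rfl

section Taylor

variable {φ : k →+* B} {g : k →+* R} (ψ : B →+* R) (hψ : ψ.comp φ = g) {d : R →+ R}
  (hd : IsDerivationAlong (.id R) d) (hc : ∀ c, d (g c) = 0)

/-- Taylor expansion `b(n) ↦ (n!)⁻¹ dⁿ (ψ b)`: the extension of a homomorphism `ψ` from `B` to an
algebra with a derivation `d` that turns `∂` into `d`. -/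
def taylor : JetAlgebra φ →+* R :=
  lift g (fun a n ↦ divPow g d n (ψ a))
    (fun c n ↦ by rw [← divPow_const hc, ← hψ]; rfl)
    (fun a b n ↦ by rw [map_add, divPow_add])
    (fun a b n ↦ by rw [map_mul, divPow_mul hd])

theorem taylor_of (a : B) : taylor ψ hψ hd hc (of φ a) = ψ a := lift_sym ..

theorem taylor_der (x : JetAlgebra φ) :
    taylor ψ hψ hd hc (der φ x) = d (taylor ψ hψ hd hc x) := by
  induction x using induction_on with
  | const c => rw [Derivation.map_algebraMap, map_zero, taylor, lift_algebraMap, hc]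
  | sym a n => rw [der_sym, map_nsmul, taylor, lift_sym, lift_sym, succ_nsmul_divPow]
  | add x y hx hy => simp only [map_add, hx, hy]
  | mul x y hx hy =>
    simp only [Derivation.leibniz, smul_eq_mul, map_add, map_mul, hx, hy, hd _ _, RingHom.id_apply]

end Taylor

theorem hom_ext_of_der {φ : k →+* B} {d : R →+ R} {F G : JetAlgebra φ →+* R}
    (hF : ∀ x, F (der φ x) = d (F x)) (hG : ∀ x, G (der φ x) = d (G x))
    (h : ∀ a, F (of φ a) = G (of φ a)) : F = G := by
  refine hom_ext fun a n ↦ ?_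
  induction n with
  | zero => exact h a
  | succ n ih =>
    refine nsmul_succ_injective (F.comp (algebraMap k _)) n ?_
    dsimp only
    rw [← map_nsmul, ← der_sym, ← map_nsmul, ← der_sym, hF, hG, ih]

end JetAlgebra

section Coordinates

variable {k A C J σ R : Type*} [Field k] [CommRing A] [CommRing C] [CommRing R]

theorem etale_comp {B : Type*} [CommRing B] {f : A →+* B} {g : B →+* C} (hf : f.Etale)
    (hg : g.Etale) : (g.comp f).Etale := by
  algebraize [f, g, g.comp f]
  exact Algebra.Etale.comp A B C

theorem etale_of_isLocalizationAway {f : A →+* C} (a : A)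
    (h : letI := f.toAlgebra; IsLocalization.Away a C) : f.Etale :=
  let _ := f.toAlgebra
  have := h
  Algebra.Etale.of_isLocalizationAway a

theorem etale_mvPolynomial_map {B : Type*} [CommRing B] {φ : B →+* A} (hφ : φ.Etale)
    (σ : Type*) : (MvPolynomial.map (σ := σ) φ).Etale := by
  algebraize [φ]
  let _ : Algebra (MvPolynomial σ B) (MvPolynomial σ A) := MvPolynomial.algebraMvPolynomial
  exact RingHom.etale_algebraMap.mpr (Algebra.Etale.of_equiv
    (Algebra.IsPushout.equiv B (MvPolynomial σ B) A (MvPolynomial σ A)))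

/-- The étale coordinates on the product of a scheme with the affine space with coordinates `σ`. -/
def polyChart (φ : MvPolynomial J k →+* A) (σ : Type*) :
    MvPolynomial (σ ⊕ J) k →+* MvPolynomial σ A :=
  (MvPolynomial.map φ).comp (MvPolynomial.sumRingEquiv k σ J).toRingHom

theorem polyChart_etale {φ : MvPolynomial J k →+* A} (hφ : φ.Etale) (σ : Type*) :
    (polyChart φ σ).Etale :=
  etale_comp (.of_bijective (MvPolynomial.sumRingEquiv k σ J).bijective)
    (etale_mvPolynomial_map hφ σ)

theorem polyChart_C (φ : MvPolynomial J k →+* A) (c : k) :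
    polyChart φ σ (.C c) = .C (φ (.C c)) := by simp [polyChart]

theorem polyChart_inl (φ : MvPolynomial J k →+* A) (s : σ) :
    polyChart φ σ (.X (.inl s)) = .X s := by simp [polyChart]

theorem polyChart_inr (φ : MvPolynomial J k →+* A) (j : J) :
    polyChart φ σ (.X (.inr j)) = .C (φ (.X j)) := by simp [polyChart]

theorem exists_isDerivationAlong_mvPolynomial (g : MvPolynomial σ k →+* R) (r : σ → R) :
    ∃ d : MvPolynomial σ k →+ R, IsDerivationAlong g d ∧ (∀ c, d (.C c) = 0) ∧
      ∀ s, d (.X s) = r s := by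
  let _ := (g.comp MvPolynomial.C).toAlgebra
  let _ := g.toAlgebra
  have : IsScalarTower k (MvPolynomial σ k) R := .of_algebraMap_eq fun _ ↦ rfl
  let D : Derivation k (MvPolynomial σ k) R := MvPolynomial.mkDerivation k r
  exact ⟨D.toLinearMap.toAddMonoidHom, D.leibniz, D.map_algebraMap,
    MvPolynomial.mkDerivation_X k r⟩

namespace IsDerivationAlong

theorem ext_mvPolynomial {g : MvPolynomial σ k →+* R} {d d' : MvPolynomial σ k →+ R}
    (hd : IsDerivationAlong g d) (hd' : IsDerivationAlong g d')
    (hC : ∀ c, d (.C c) = d' (.C c)) (hX : ∀ s, d (.X s) = d' (.X s)) : d = d' := by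
  refine DFunLike.ext _ _ fun p ↦ ?_
  induction p using MvPolynomial.induction_on with
  | C c => exact hC c
  | add p q hp hq => rw [map_add, map_add, hp, hq]
  | mul_X p i hp => rw [hd, hd', hp, hX]

theorem ext_of_etale {φ : MvPolynomial σ k →+* A} (hφ : φ.Etale) {g : A →+* R} {d d' : A →+ R}
    (hd : IsDerivationAlong g d) (hd' : IsDerivationAlong g d')
    (hC : ∀ c, d (φ (.C c)) = d' (φ (.C c))) (hX : ∀ s, d (φ (.X s)) = d' (φ (.X s))) : d = d' :=
  hd.ext_of_formallyUnramified hφ.formallyUnramified hd' fun p ↦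
    DFunLike.congr_fun ((hd.comp φ).ext_mvPolynomial (hd'.comp φ) hC hX) p

end IsDerivationAlong

/-- The derivation of `A[z_{j,n}]` that makes `z_{j,n}` the `n`-th derivative of `dx_j / e_j`, for
étale coordinates `x_j` on `A`. A logarithmic coordinate has `e_j = x_j`, an ordinary one
`e_j = 1`. -/
structure IsLogDerivation (φ : MvPolynomial J k →+* A) (e : J → A)
    (D : MvPolynomial (J × ℕ) A →+ MvPolynomial (J × ℕ) A) : Prop where
  isDerivationAlong : IsDerivationAlong (.id _) D
  map_const (c : k) : D (.C (φ (.C c))) = 0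
  map_coord (j : J) : D (.C (φ (.X j))) = .C (e j) * .X (j, 0)
  map_X (j : J) (n : ℕ) : D (.X (j, n)) = .X (j, n + 1)

theorem exists_isLogDerivation {φ : MvPolynomial J k →+* A} (hφ : φ.Etale) (e : J → A) :
    ∃ D, IsLogDerivation φ e D := by
  obtain ⟨d, hd, hC, hX⟩ := exists_isDerivationAlong_mvPolynomial
    ((RingHom.id _).comp (polyChart φ (J × ℕ)))
    (Sum.elim (fun p ↦ .X (p.1, p.2 + 1)) (fun j ↦ .C (e j) * .X (j, 0)))
  obtain ⟨D, hD, h⟩ := IsDerivationAlong.exists_extension (polyChart_etale hφ (J × ℕ)) hd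
  refine ⟨D, hD, fun c ↦ ?_, fun j ↦ ?_, fun j n ↦ ?_⟩
  · rw [← polyChart_C, h, hC]
  · rw [← polyChart_inr, h, hX, Sum.elim_inr]
  · rw [← polyChart_inl φ, h, hX, Sum.elim_inl]

section LogCoord

variable {φC : k →+* C} {ι : A →+* C} {φ : MvPolynomial J k →+* A} {e : J → A}
  {ζ : J → JetAlgebra φC}

/-- `ζ_j` is the logarithmic differential `∂x_j / e_j` in the jets of `C`, for coordinates `x_j` on
`A` and `ι : A → C`. -/
def IsLogDifferential (ι : A →+* C) (φ : MvPolynomial J k →+* A) (e : J → A)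
    (ζ : J → JetAlgebra φC) : Prop :=
  ∀ j, JetAlgebra.of φC (ι (e j)) * ζ j = JetAlgebra.der φC (JetAlgebra.of φC (ι (φ (.X j))))

/-- The homomorphism from `A[z_{j,n}]` to the jets of `C` that sends `z_{j,n}` to `∂ⁿ ζ_j`. -/
def logCoord (ι : A →+* C) (ζ : J → JetAlgebra φC) :
    MvPolynomial (J × ℕ) A →+* JetAlgebra φC :=
  MvPolynomial.eval₂Hom ((JetAlgebra.of φC).comp ι) fun p ↦ (JetAlgebra.der φC)^[p.2] (ζ p.1)

theorem logCoord_C (ι : A →+* C) (ζ : J → JetAlgebra φC) (a : A) :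
    logCoord ι ζ (.C a) = JetAlgebra.of φC (ι a) := by simp [logCoord]

theorem logCoord_X (ι : A →+* C) (ζ : J → JetAlgebra φC) (j : J) (n : ℕ) :
    logCoord ι ζ (.X (j, n)) = (JetAlgebra.der φC)^[n] (ζ j) := by simp [logCoord]

theorem logCoord_derivation (hφ : φ.Etale) (hφC : ι.comp (φ.comp MvPolynomial.C) = φC)
    (hζ : IsLogDifferential ι φ e ζ) {D : MvPolynomial (J × ℕ) A →+ MvPolynomial (J × ℕ) A}
    (hD : IsLogDerivation φ e D) (p : MvPolynomial (J × ℕ) A) :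
    logCoord ι ζ (D p) = JetAlgebra.der φC (logCoord ι ζ p) := by
  refine DFunLike.congr_fun (IsDerivationAlong.ext_of_etale (polyChart_etale hφ (J × ℕ))
    (hD.isDerivationAlong.postcomp (logCoord ι ζ))
    (JetAlgebra.isDerivationAlong_der.comp (logCoord ι ζ)) (fun c ↦ ?_) fun s ↦ ?_) p
  · change logCoord ι ζ (D _) = JetAlgebra.der φC (logCoord ι ζ _)
    rw [polyChart_C, hD.map_const, map_zero, logCoord_C,
      show ι (φ (.C c)) = φC c from RingHom.congr_fun hφC c, ← RingHom.comp_apply,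
      JetAlgebra.of_comp, Derivation.map_algebraMap]
  · change logCoord ι ζ (D _) = JetAlgebra.der φC (logCoord ι ζ _)
    rcases s with ⟨j, n⟩ | j
    · rw [polyChart_inl, hD.map_X, logCoord_X, logCoord_X, Function.iterate_succ_apply']
    · rw [polyChart_inr, hD.map_coord, map_mul, logCoord_C, logCoord_X, logCoord_C]
      exact hζ j

theorem comp_logCoord_eq_map (he : ∀ j, IsUnit (ι (e j))) (hζ : IsLogDifferential ι φ e ζ)
    {D : MvPolynomial (J × ℕ) C →+ MvPolynomial (J × ℕ) C}
    (hD : IsLogDerivation (ι.comp φ) (ι ∘ e) D) {Ψ : JetAlgebra φC →+* MvPolynomial (J × ℕ) C}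
    (hΨ : ∀ x, Ψ (JetAlgebra.der φC x) = D (Ψ x)) (hΨC : ∀ a, Ψ (JetAlgebra.of φC a) = .C a) :
    Ψ.comp (logCoord ι ζ) = MvPolynomial.map ι := by
  have hΨζ (j : J) (n : ℕ) : Ψ ((JetAlgebra.der φC)^[n] (ζ j)) = .X (j, n) := by
    induction n with
    | zero =>
      have h := congrArg Ψ (hζ j)
      rw [map_mul, hΨ, hΨC, hΨC] at h
      exact ((he j).map MvPolynomial.C).mul_left_cancel (h.trans (hD.map_coord j))
    | succ n ih => rw [Function.iterate_succ_apply', hΨ, ih, hD.map_X]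
  refine MvPolynomial.ringHom_ext (fun a ↦ ?_) fun p ↦ ?_
  · rw [RingHom.comp_apply, logCoord_C, hΨC, MvPolynomial.map_C]
  · rw [RingHom.comp_apply, logCoord_X, hΨζ, MvPolynomial.map_X]

theorem logCoord_injective [CharZero k] (hφ : φ.Etale) (hι : ι.Etale)
    (hι_inj : Function.Injective ι) (hφC : ι.comp (φ.comp MvPolynomial.C) = φC)
    (he : ∀ j, IsUnit (ι (e j))) (hζ : IsLogDifferential ι φ e ζ) :
    Function.Injective (logCoord ι ζ) := by
  obtain ⟨D, hD⟩ := exists_isLogDerivation (etale_comp hφ hι) (ι ∘ e)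
  have hconst (c : k) : D ((MvPolynomial.C.comp φC) c) = 0 := by
    rw [← hφC]
    exact hD.map_const c
  let Ψ : JetAlgebra φC →+* MvPolynomial (J × ℕ) C :=
    JetAlgebra.taylor MvPolynomial.C rfl hD.isDerivationAlong hconst
  refine Function.Injective.of_comp (f := Ψ) ?_
  rw [← RingHom.coe_comp, comp_logCoord_eq_map he hζ hD (fun _ ↦ JetAlgebra.taylor_der ..)
    fun _ ↦ JetAlgebra.taylor_of ..]
  exact MvPolynomial.map_injective ι hι_inj

end LogCoord

end Coordinates

section Sections

variable {X : Scheme.{u}}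

theorem res_refl {W : X.Opens} (s : Γ(X, W)) : res le_rfl s = s := by
  change (X.presheaf.map (𝟙 _)).hom s = s
  rw [X.presheaf.map_id]
  rfl

theorem eq_of_locally_eq {W : X.Opens} (s t : Γ(X, W))
    (h : ∀ x ∈ W, ∃ (V : X.Opens) (hV : V ≤ W), x ∈ V ∧ res hV s = res hV t) : s = t := by
  choose V hV hx h using h
  exact X.sheaf.eq_of_locally_eq' (fun x : W ↦ V x.1 x.2) W (fun x ↦ homOfLE (hV x.1 x.2))
    (fun x hxW ↦ Opens.mem_iSup.mpr ⟨⟨x, hxW⟩, hx x hxW⟩) s t fun x ↦ h x.1 x.2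

theorem mem_range_res_of_locally (O : X.Opens)
    (hO : ∀ W : X.Opens, Function.Injective (res (inf_le_left : W ⊓ O ≤ W)))
    {W : X.Opens} (s : Γ(X, W ⊓ O))
    (h : ∀ x ∈ W, ∃ (V : X.Opens) (hV : V ≤ W), x ∈ V ∧
      ∃ t : Γ(X, V), res inf_le_left t = res (inf_le_inf_right O hV) s) :
    ∃ t : Γ(X, W), res inf_le_left t = s := by
  choose V hV hx t ht using h
  have ht_res (x) (hxW : x ∈ W) {N : X.Opens} (hN : N ≤ V x hxW) :
      res inf_le_left (res hN (t x hxW)) = res (inf_le_inf_right O (hN.trans (hV x hxW))) s := by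
    rw [← res_res (inf_le_inf_right O (hV x hxW)) (inf_le_inf_right O hN), ← ht, res_res, res_res]
  obtain ⟨r, hr, -⟩ := X.sheaf.existsUnique_gluing' (fun x : W ↦ V x.1 x.2) W
    (fun x ↦ homOfLE (hV x.1 x.2)) (fun x hxW ↦ Opens.mem_iSup.mpr ⟨⟨x, hxW⟩, hx x hxW⟩)
    (fun x ↦ t x.1 x.2) fun x y ↦ hO _ <|
      (ht_res x.1 x.2 inf_le_left).trans (ht_res y.1 y.2 inf_le_right).symm
  refine ⟨r, eq_of_locally_eq _ _ ?_⟩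
  rintro x ⟨hxW : x ∈ W, hxO⟩
  refine ⟨V x hxW ⊓ O, inf_le_inf_right O (hV x hxW), ⟨hx x hxW, hxO⟩, ?_⟩
  have hr_res : res (hV x hxW) r = t x hxW := hr ⟨x, hxW⟩
  rw [← ht, ← hr_res]
  exact (res_res ..).trans (res_res ..).symm

theorem mem_vanishingIdeal_iff {Z : Closeds X} {U : X.affineOpens} {s : Γ(X, U)} :
    s ∈ (Scheme.IdealSheafData.vanishingIdeal Z).ideal U ↔ ∀ x ∈ Z, x ∉ X.basicOpen s := by
  have hs (y : PrimeSpectrum Γ(X, U)) : U.2.fromSpec y ∈ X.basicOpen s ↔ s ∉ y.asIdeal := by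
    change y ∈ U.2.fromSpec ⁻¹ᵁ X.basicOpen s ↔ _
    rw [U.2.fromSpec_preimage_basicOpen]
    rfl
  rw [Scheme.IdealSheafData.vanishingIdeal_ideal, PrimeSpectrum.mem_vanishingIdeal]
  constructor
  · intro h x hxZ hxs
    obtain ⟨y, rfl⟩ := U.2.range_fromSpec.ge (X.basicOpen_le s hxs)
    exact (hs y).mp hxs (h y hxZ)
  · exact fun h y hy ↦ not_not.mp ((hs y).not.mp (h _ hy))

theorem isPrime_vanishingIdeal {Z : Closeds X} (hZ : IsIrreducible (Z : Set X))
    {U : X.affineOpens} (hZU : ((Z : Set X) ∩ U.1).Nonempty) :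
    ((Scheme.IdealSheafData.vanishingIdeal Z).ideal U).IsPrime := by
  have := U.2.isOpenImmersion_fromSpec
  rw [Scheme.IdealSheafData.vanishingIdeal_ideal,
    ← PrimeSpectrum.isIrreducible_iff_vanishingIdeal_isPrime]
  refine ⟨?_, hZ.2.preimage U.2.fromSpec.isOpenEmbedding⟩
  obtain ⟨x, hxZ, hxU⟩ := hZU
  obtain ⟨y, rfl⟩ := U.2.range_fromSpec.ge hxU
  exact ⟨y, hxZ⟩

end Sections

section Charts

variable {k : Type u} [Field k] {X : Over (Spec (.of k))} {D : Closeds X.left}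

/-- The irreducible components of `D` that meet `U`. -/
abbrev meetingComponents (D : Closeds X.left) (U : X.left.Opens) : Set (Closeds X.left) :=
  {Z ∈ components D | ((Z : Set X.left) ∩ U).Nonempty}

/-- The data of `HasLogChart` as a structure: étale coordinates `φ` on an affine open subset `U`,
among which `σ` selects equations of the components of `D` that meet `U`. -/
structure LogChart (X : Over (Spec (.of k))) (D : Closeds X.left) (U : X.left.affineOpens) where
  J : Type u
  φ : MvPolynomial J k →+* Γ(X.left, U)
  σ : meetingComponents D U.1 → J
  φ_comp : φ.comp MvPolynomial.C = consts X U
  etale : φ.Etale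
  finite : (meetingComponents D U.1).Finite
  σ_injective : Function.Injective σ
  ideal_eq (Z : meetingComponents D U.1) :
    (Scheme.IdealSheafData.vanishingIdeal Z.1).ideal U = Ideal.span {φ (MvPolynomial.X (σ Z))}

theorem LogChart.hasLogChart {U : X.left.affineOpens} (c : LogChart X D U) {p : X.left}
    (hp : p ∈ U.1) : HasLogChart X D p :=
  ⟨U, c.J, c.φ, c.σ, hp, c.φ_comp, c.etale, c.finite, c.σ_injective, c.ideal_eq⟩

theorem HasLogChart.exists_logChart_le {p : X.left} (h : HasLogChart X D p) (W : X.left.Opens)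
    (hp : p ∈ W) : ∃ U : X.left.affineOpens, p ∈ U.1 ∧ U.1 ≤ W ∧ Nonempty (LogChart X D U) := by
  obtain ⟨U, J, φ, σ, hpU, hφ_comp, hφ, hfin, hσ, hideal⟩ := h
  obtain ⟨g, hgW, hpg⟩ := U.2.exists_basicOpen_le ⟨p, hp⟩ hpU
  let V : X.left.affineOpens := X.left.affineBasicOpen g
  have hVU : V ≤ U := X.left.basicOpen_le g
  have hsub : meetingComponents D V.1 ⊆ meetingComponents D U.1 := fun Z hZ ↦
    ⟨hZ.1, hZ.2.mono (Set.inter_subset_inter_right _ hVU)⟩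
  refine ⟨V, hpg, hgW, ⟨⟨J, (res hVU).comp φ, σ ∘ Set.inclusion hsub, ?_, ?_, hfin.subset hsub,
    hσ.comp (Set.inclusion_injective hsub), fun Z ↦ ?_⟩⟩⟩
  · rw [RingHom.comp_assoc, hφ_comp]
    exact res_comp_consts X hVU
  · exact etale_comp hφ (etale_of_isLocalizationAway g (U.2.isLocalization_basicOpen g))
  · rw [← Scheme.IdealSheafData.map_ideal _ hVU, hideal ⟨Z.1, hsub Z.2⟩, Ideal.map_span,
      Set.image_singleton]
    rfl

namespace LogChart

variable {U : X.left.affineOpens} (c : LogChart X D U)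

/-- The equation of a component of `D`. -/
def eqn (Z : meetingComponents D U.1) : Γ(X.left, U) := c.φ (.X (c.σ Z))

theorem mem_ideal_iff (Z : meetingComponents D U.1) {s : Γ(X.left, U)} :
    s ∈ (Scheme.IdealSheafData.vanishingIdeal Z.1).ideal U ↔ c.eqn Z ∣ s := by
  rw [c.ideal_eq, Ideal.mem_span_singleton]
  rfl

theorem mem_iff (Z : meetingComponents D U.1) {x : X.left} (hx : x ∈ U.1) :
    x ∈ Z.1 ↔ x ∉ X.left.basicOpen (c.eqn Z) :=
  LogPair.mem_iff_of_ideal_eq Z.1 U _ (c.ideal_eq Z) hx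

theorem eqn_mem_nonZeroDivisors (Z : meetingComponents D U.1) :
    c.eqn Z ∈ nonZeroDivisors Γ(X.left, U) := by
  let _ := c.φ.toAlgebra
  have : Algebra.Etale (MvPolynomial c.J k) Γ(X.left, U) := c.etale
  have hX : (MvPolynomial.X (c.σ Z) : MvPolynomial c.J k) ∈ nonZeroDivisors _ :=
    mem_nonZeroDivisors_of_ne_zero (MvPolynomial.X_ne_zero _)
  have hreg : IsSMulRegular Γ(X.left, U) (MvPolynomial.X (c.σ Z) : MvPolynomial c.J k) :=
    Module.Flat.isSMulRegular_of_nonZeroDivisors hX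
  rw [mem_nonZeroDivisors_iff_right]
  refine fun x hx ↦ hreg ?_
  change c.φ _ * x = c.φ _ * 0
  rw [mul_zero, mul_comm]
  exact hx

theorem prime_eqn (Z : meetingComponents D U.1) : Prime (c.eqn Z) := by
  have hprime := isPrime_vanishingIdeal Z.2.1.1.1 Z.2.2
  have : Nontrivial Γ(X.left, U) :=
    nontrivial_of_ne 0 1 fun h ↦ hprime.ne_top ((Ideal.eq_top_iff_one _).mpr (h ▸ zero_mem _))
  rw [c.ideal_eq] at hprime
  exact (Ideal.span_singleton_prime (nonZeroDivisors.ne_zero (c.eqn_mem_nonZeroDivisors Z))).mp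
    hprime

theorem eq_of_eqn_dvd_eqn {Z Z' : meetingComponents D U.1} (h : c.eqn Z ∣ c.eqn Z') : Z = Z' := by
  rw [← mem_ideal_iff, mem_vanishingIdeal_iff] at h
  have hsub : (Z.1 : Set X.left) ∩ U.1 ⊆ Z'.1 := fun x hx ↦
    (c.mem_iff Z' hx.2).mpr (h x hx.1)
  have hle : Z.1 ≤ Z'.1 :=
    (subset_closure_inter_of_isPreirreducible_of_isOpen Z.2.1.1.1.2 U.1.isOpen Z.2.2).trans
      (closure_minimal hsub Z'.1.isClosed)
  exact Subtype.ext (le_antisymm hle (Z.2.1.2 Z'.2.1.1 hle))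

/-- The equation of `D`. -/
def prodEqn : Γ(X.left, U) :=
  letI := c.finite.fintype
  ∏ Z, c.eqn Z

theorem prodEqn_mem_nonZeroDivisors : c.prodEqn ∈ nonZeroDivisors Γ(X.left, U) :=
  letI := c.finite.fintype
  prod_mem fun Z _ ↦ c.eqn_mem_nonZeroDivisors Z

theorem mem_iff_notMem_basicOpen {x : X.left} (hx : x ∈ U.1) :
    x ∈ D ↔ x ∉ X.left.basicOpen c.prodEqn := by
  let _ := c.finite.fintype
  have hprod : x ∈ X.left.basicOpen c.prodEqn ↔ ∀ Z, x ∈ X.left.basicOpen (c.eqn Z) := by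
    simp only [Scheme.mem_basicOpen _ _ _ hx, prodEqn, map_prod, IsUnit.prod_univ_iff]
  rw [hprod, not_forall]
  constructor
  · intro hxD
    obtain ⟨Z, hZ, hxZ⟩ := exists_component D hxD
    exact ⟨⟨Z, hZ, x, hxZ, hx⟩, (c.mem_iff _ hx).mp hxZ⟩
  · rintro ⟨Z, hZ⟩
    exact Z.2.1.1.2 ((c.mem_iff Z hx).mpr hZ)

theorem inf_compl_eq_basicOpen : U.1 ⊓ D.compl = X.left.basicOpen c.prodEqn := by
  ext x
  constructor
  · rintro ⟨hx, hxD⟩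
    exact not_not.mp ((c.mem_iff_notMem_basicOpen hx).not.mp hxD)
  · intro hx
    have hxU := X.left.basicOpen_le _ hx
    exact ⟨hxU, fun hxD ↦ (c.mem_iff_notMem_basicOpen hxU).mp hxD hx⟩

theorem isLocalization : letI := (res (inf_le_left : U.1 ⊓ D.compl ≤ U.1)).toAlgebra
    IsLocalization.Away c.prodEqn Γ(X.left, U.1 ⊓ D.compl) :=
  LogPair.isLocalization_of_eq U.2.isCompact U.2.isQuasiSeparated _ _ c.inf_compl_eq_basicOpen

include c in
theorem res_injective : Function.Injective (res (inf_le_left : U.1 ⊓ D.compl ≤ U.1)) := by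
  let _ := (res (inf_le_left : U.1 ⊓ D.compl ≤ U.1)).toAlgebra
  have := c.isLocalization
  exact IsLocalization.injective _ (Submonoid.powers_le.mpr c.prodEqn_mem_nonZeroDivisors)

theorem isUnit_res_eqn (Z : meetingComponents D U.1) :
    IsUnit (res (inf_le_left : U.1 ⊓ D.compl ≤ U.1) (c.eqn Z)) := by
  let _ := c.finite.fintype
  let _ := (res (inf_le_left : U.1 ⊓ D.compl ≤ U.1)).toAlgebra
  have := c.isLocalization
  have h : IsUnit (res (inf_le_left : U.1 ⊓ D.compl ≤ U.1) c.prodEqn) :=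
    IsLocalization.Away.algebraMap_isUnit (S := Γ(X.left, U.1 ⊓ D.compl)) c.prodEqn
  rw [prodEqn, map_prod, IsUnit.prod_univ_iff] at h
  exact h Z

theorem eqn_dvd_der {δ : VectorField X} (hδ : δ.IsTangent D) (Z : meetingComponents D U.1) :
    c.eqn Z ∣ δ.der U.1 (c.eqn Z) := by
  classical
  let _ := c.finite.fintype
  have hmem : c.prodEqn ∈ (Scheme.IdealSheafData.vanishingIdeal D).ideal U :=
    mem_vanishingIdeal_iff.mpr fun x hx hx' ↦
      (c.mem_iff_notMem_basicOpen (X.left.basicOpen_le _ hx')).mp hx hx'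
  have hdvd : c.eqn Z ∣ δ.der U.1 c.prodEqn := (c.mem_ideal_iff Z).mp
    (Scheme.IdealSheafData.vanishingIdeal_antimono Z.2.1.1.2 U (hδ U _ hmem))
  have hprod : c.prodEqn = c.eqn Z * ∏ Z' ∈ Finset.univ.erase Z, c.eqn Z' :=
    (Finset.mul_prod_erase _ _ (Finset.mem_univ Z)).symm
  rw [hprod, δ.leibniz, dvd_add_right (dvd_mul_right _ _)] at hdvd
  refine ((c.prime_eqn Z).dvd_or_dvd hdvd).resolve_left fun h ↦ ?_
  obtain ⟨Z', hZ', hdvd'⟩ := (c.prime_eqn Z).exists_mem_finset_dvd h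
  exact Finset.ne_of_mem_erase hZ' (c.eq_of_eqn_dvd_eqn hdvd').symm

include c in
theorem dvd_der_of_isUnit {δ : VectorField X} (hδ : δ.IsTangent D) {a : Γ(X.left, U)}
    (ha : IsUnit (res (inf_le_left : U.1 ⊓ D.compl ≤ U.1) a)) : a ∣ δ.der U.1 a := by
  let _ := c.finite.fintype
  let _ := (res (inf_le_left : U.1 ⊓ D.compl ≤ U.1)).toAlgebra
  have := c.isLocalization
  obtain ⟨n, hn⟩ : ∃ n, a ∣ c.prodEqn ^ n :=
    (IsLocalization.Away.algebraMap_isUnit_iff c.prodEqn).mp ha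
  obtain ⟨b, hb⟩ := hn
  refine dvd_derivation_of_mul_eq_prod (d := δ.der U.1) (δ.leibniz U.1)
    (n • Finset.univ.val.map c.eqn) (fun p hp ↦ ?_)
    (hb.symm.trans (Multiset.prod_nsmul _ _).symm)
  obtain ⟨Z, -, rfl⟩ := Multiset.mem_map.mp (Multiset.mem_of_mem_nsmul hp)
  exact ⟨c.prime_eqn Z, c.eqn_mem_nonZeroDivisors Z, c.eqn_dvd_der hδ Z⟩

end LogChart

namespace LogPair

variable (P : LogPair k)

theorem exists_logChart {p : P.X.left} (W : P.X.left.Opens) (hp : p ∈ W) :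
    ∃ U : P.X.left.affineOpens, p ∈ U.1 ∧ U.1 ≤ W ∧ Nonempty (LogChart P.X P.D U) :=
  (P.hasLogChart p).exists_logChart_le W hp

theorem res_away_injective (W : P.X.left.Opens) :
    Function.Injective (res (inf_le_left : P.away W ≤ W)) := by
  intro s t h
  refine eq_of_locally_eq _ _ fun x hx ↦ ?_
  obtain ⟨U, hxU, hU, ⟨c⟩⟩ := P.exists_logChart W hx
  refine ⟨U.1, hU, hxU, c.res_injective ?_⟩
  have hU_away := congrArg (res (P.away_le hU)) h
  rwa [res_res, res_res] at hU_away ⊢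

end LogPair

end Charts

section SpecSections

variable {X : Scheme.{u}}

theorem isIso_appLE_top {Y : Scheme.{u}} (f : Y ⟶ X) [IsOpenImmersion f] {W : X.Opens}
    (hW : W = f.opensRange) (h : ⊤ ≤ f ⁻¹ᵁ W) : IsIso (f.appLE W ⊤ h) := by
  obtain rfl : W = f ''ᵁ ⊤ := hW.trans f.image_top_eq_opensRange.symm
  rw [← Scheme.Hom.appIso_hom']
  infer_instance

theorem appLE_SpecMap_comp_ΓSpecIso {R S : CommRingCat.{u}} (m : R ⟶ S) (g : Spec R ⟶ X)
    (W : X.Opens) (h : ⊤ ≤ (Spec.map m ≫ g) ⁻¹ᵁ W) (h' : ⊤ ≤ g ⁻¹ᵁ W) :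
    (Spec.map m ≫ g).appLE W ⊤ h ≫ (Scheme.ΓSpecIso S).hom =
      g.appLE W ⊤ h' ≫ (Scheme.ΓSpecIso R).hom ≫ m := by
  rw [← Scheme.ΓSpecIso_naturality, ← Scheme.Hom.appLE_comp_appLE _ _ _ _ _ h' le_top,
    Category.assoc]
  congr 2

theorem appLE_SpecMap_comp_fromSpec_ΓSpecIso {U : X.Opens} (hU : IsAffineOpen U)
    {S : CommRingCat.{u}} (m : Γ(X, U) ⟶ S) (h : ⊤ ≤ (Spec.map m ≫ hU.fromSpec) ⁻¹ᵁ U) :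
    (Spec.map m ≫ hU.fromSpec).appLE U ⊤ h ≫ (Scheme.ΓSpecIso S).hom = m := by
  rw [appLE_SpecMap_comp_ΓSpecIso m _ _ h (by rw [hU.fromSpec_preimage_self]), Scheme.Hom.appLE,
    hU.fromSpec_app_self, Category.assoc, Category.assoc, ← Functor.map_comp_assoc,
    show (eqToHom hU.fromSpec_preimage_self).op ≫ (homOfLE _).op = 𝟙 _ from rfl]
  simp

end SpecSections

namespace LogPair

variable {k : Type u} [Field k] (P : LogPair k)

/-- The preimage of an affine open subset in the log jet space. -/
abbrev above (U : P.X.left.AffineZariskiSite) : P.logJet.left.Opens :=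
  P.logJetProj.left ⁻¹ᵁ U.toOpens

instance : (P.logJetGluingData.functor ⋙ Scheme.forget).IsLocallyDirected :=
  Scheme.Cover.RelativeGluingData.instIsLocallyDirectedI₀CompFunctorForgetOfIsThin ..

instance (U : P.X.left.AffineZariskiSite) : IsOpenImmersion (P.logJetChart U) :=
  P.logJetGluingData.cover.map_prop U

theorem above_eq_opensRange (U : P.X.left.AffineZariskiSite) :
    P.above U = (P.logJetChart U).opensRange :=
  (congrArg (P.logJetProj.left ⁻¹ᵁ ·) (Scheme.Opens.opensRange_ι U.toOpens).symm).trans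
    (P.logJetGluingData.toBase_preimage_eq_opensRange_ι U)

theorem isAffineOpen_above (U : P.X.left.AffineZariskiSite) : IsAffineOpen (P.above U) := by
  rw [above_eq_opensRange]
  exact isAffineOpen_opensRange _

theorem above_mono {U V : P.X.left.AffineZariskiSite} (h : V ≤ U) : P.above V ≤ P.above U :=
  P.logJetProj.left.preimage_mono (Scheme.AffineZariskiSite.toOpens_mono h)

/-- The functions on `U`, as log jets. -/
def fnHom (U : P.X.left.AffineZariskiSite) : Γ(P.X.left, U.toOpens) →+* P.logJetAlgebra U :=
  (P.fn U.toOpens).codRestrict _ (P.fn_mem U)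

/-- The restriction of log jets to a smaller affine open subset. -/
def resHom {U V : P.X.left.AffineZariskiSite} (h : V ≤ U) :
    P.logJetAlgebra U →+* P.logJetAlgebra V :=
  (P.resJets (Scheme.AffineZariskiSite.toOpens_mono h)).restrict _ _ fun _ ↦ P.resJets_mem _

theorem map_logJetChart {U V : P.X.left.AffineZariskiSite} (h : V ≤ U) :
    Spec.map (CommRingCat.ofHom (P.resHom h)) ≫ P.logJetChart U = P.logJetChart V :=
  Limits.colimit.w P.logJetGluingData.functor (homOfLE h)

theorem logJetChart_proj (U : P.X.left.AffineZariskiSite) :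
    P.logJetChart U ≫ P.logJetProj.left =
      Spec.map (CommRingCat.ofHom (P.fnHom U)) ≫ IsAffineOpen.fromSpec U.2 :=
  (P.logJetGluingData.ι_toBase U).trans (Category.assoc _ _ _)

theorem logJetSections_bijective (U : P.X.left.AffineZariskiSite) :
    Function.Bijective (P.logJetSections U) := by
  have := isIso_appLE_top (P.logJetChart U) (P.above_eq_opensRange U)
    (P.top_le_preimage_logJetChart U)
  have : IsIso ((P.logJetChart U).appLE _ ⊤ (P.top_le_preimage_logJetChart U) ≫
    (Scheme.ΓSpecIso (.of (P.logJetAlgebra U))).hom) := IsIso.comp_isIso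
  exact ConcreteCategory.bijective_of_isIso ((P.logJetChart U).appLE _ ⊤
    (P.top_le_preimage_logJetChart U) ≫ (Scheme.ΓSpecIso (.of (P.logJetAlgebra U))).hom)

theorem logJetSections_res {U V : P.X.left.AffineZariskiSite} (h : V ≤ U)
    (s : Γ(P.logJet.left, P.above U)) :
    P.logJetSections V (res (P.above_mono h) s) = P.resHom h (P.logJetSections U s) := by
  suffices P.logJet.left.presheaf.map (homOfLE (P.above_mono h)).op ≫
      (P.logJetChart V).appLE _ ⊤ (P.top_le_preimage_logJetChart V) ≫
        (Scheme.ΓSpecIso (.of (P.logJetAlgebra V))).hom =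
      (P.logJetChart U).appLE _ ⊤ (P.top_le_preimage_logJetChart U) ≫
        (Scheme.ΓSpecIso (.of (P.logJetAlgebra U))).hom ≫ CommRingCat.ofHom (P.resHom h) from
    RingHom.congr_fun (congrArg CommRingCat.Hom.hom this) s
  rw [← appLE_SpecMap_comp_ΓSpecIso _ _ _ (by
    rw [P.map_logJetChart h]
    exact (P.top_le_preimage_logJetChart V).trans
      ((P.logJetChart V).preimage_mono (P.above_mono h))), Scheme.Hom.map_appLE_assoc]
  simp only [P.map_logJetChart h]

theorem logJetSections_proj (U : P.X.left.AffineZariskiSite) (a : Γ(P.X.left, U.toOpens)) :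
    P.logJetSections U ((P.logJetProj.left.app U.toOpens).hom a) = P.fnHom U a := by
  suffices P.logJetProj.left.app U.toOpens ≫
      (P.logJetChart U).appLE _ ⊤ (P.top_le_preimage_logJetChart U) ≫
        (Scheme.ΓSpecIso (.of (P.logJetAlgebra U))).hom = CommRingCat.ofHom (P.fnHom U) from
    RingHom.congr_fun (congrArg CommRingCat.Hom.hom this) a
  rw [← Scheme.Hom.appLE_eq_app, Scheme.Hom.appLE_comp_appLE_assoc]
  simp only [P.logJetChart_proj U]
  exact appLE_SpecMap_comp_fromSpec_ΓSpecIso _ _ _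

end LogPair

section Gluing

variable {X : Scheme.{u}} {B : Set X.Opens}

theorem eq_of_isBasis (hB : Opens.IsBasis B) {O : X.Opens} (s t : Γ(X, O))
    (h : ∀ V ∈ B, ∀ hVO : V ≤ O, res hVO s = res hVO t) : s = t :=
  eq_of_locally_eq s t fun _ hx ↦
    have ⟨V, hV, hxV, hVO⟩ := Opens.isBasis_iff_nbhd.mp hB hx
    ⟨V, hVO, hxV, h V hV hVO⟩

theorem exists_res_eq_of_isBasis (hB : Opens.IsBasis B) (O : X.Opens)
    (s : ∀ V ∈ B, V ≤ O → Γ(X, V))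
    (hs : ∀ V hV hVO V' hV' (h : V' ≤ V), res h (s V hV hVO) = s V' hV' (h.trans hVO)) :
    ∃ t : Γ(X, O), ∀ V hV hVO, res hVO t = s V hV hVO := by
  obtain ⟨t, ht, -⟩ := X.sheaf.existsUnique_gluing'
    (fun V : {V // V ∈ B ∧ V ≤ O} ↦ V.1) O (fun V ↦ homOfLE V.2.2)
    (fun x hx ↦ by
      obtain ⟨V, hV, hxV, hVO⟩ := Opens.isBasis_iff_nbhd.mp hB hx
      exact Opens.mem_iSup.mpr ⟨⟨V, hV, hVO⟩, hxV⟩)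
    (fun V ↦ s V.1 V.2.1 V.2.2) fun V V' ↦ eq_of_isBasis hB _ _ fun V'' hV'' h ↦ by
      change res h (res inf_le_left _) = res h (res inf_le_right _)
      rw [res_res, res_res, hs _ _ _ V'' hV'', hs _ _ _ V'' hV'']
  exact ⟨t, fun V hV hVO ↦ ht ⟨V, hV, hVO⟩⟩

theorem isBasis_isAffineOpen_le_cover {ι : Type*} (W : ι → X.Opens) (hW : ∀ x, ∃ i, x ∈ W i) :
    Opens.IsBasis {V : X.Opens | IsAffineOpen V ∧ ∃ i, V ≤ W i} := by
  refine Opens.isBasis_iff_nbhd.mpr fun {O x} hx ↦ ?_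
  obtain ⟨i, hi⟩ := hW x
  obtain ⟨V, hV, hxV, hVle⟩ := Opens.isBasis_iff_nbhd.mp X.isBasis_affineOpens
    (show x ∈ O ⊓ W i from ⟨hx, hi⟩)
  exact ⟨V, ⟨hV, i, hVle.trans inf_le_right⟩, hxV, hVle.trans inf_le_left⟩

end Gluing

section Restriction

variable {X : Scheme.{u}} {U V V' : X.Opens}

theorem etale_res (hU : IsAffineOpen U) (hV : IsAffineOpen V) (h : V ≤ U) : (res h).Etale := by
  have hid := HasRingHomProperty.appLE (P := @AlgebraicGeometry.Etale) (𝟙 X) inferInstance ⟨U, hU⟩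
    ⟨V, hV⟩ h
  rwa [show (𝟙 X : X ⟶ X).appLE U V h = X.presheaf.map (homOfLE h).op from Category.id_comp _]
    at hid

/-- The endomorphism `d'` of the functions on `V` restricts the endomorphism `d` of the functions on
`U`. -/
def IsRestriction (h : V ≤ U) (d : Γ(X, U) →+ Γ(X, U)) (d' : Γ(X, V) →+ Γ(X, V)) : Prop :=
  ∀ a, res h (d a) = d' (res h a)

namespace IsRestriction

variable {d : Γ(X, U) →+ Γ(X, U)} {d₁ : Γ(X, V) →+ Γ(X, V)} {d₂ : Γ(X, V') →+ Γ(X, V')}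

theorem trans {h : V ≤ U} {h' : V' ≤ V} (hd₁ : IsRestriction h d d₁)
    (hd₂ : IsRestriction h' d₁ d₂) : IsRestriction (h'.trans h) d d₂ := fun a ↦ by
  rw [← res_res h h', hd₁, hd₂, res_res]

theorem of_trans {h : V ≤ U} {h' : V' ≤ V} (hU : IsAffineOpen U) (hV : IsAffineOpen V)
    (hd₁ : IsDerivationAlong (.id _) d₁) (hd₂ : IsDerivationAlong (.id _) d₂)
    (h₁ : IsRestriction h d d₁) (h₂ : IsRestriction (h'.trans h) d d₂) :
    IsRestriction h' d₁ d₂ :=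
  DFunLike.congr_fun <| IsDerivationAlong.ext_of_formallyUnramified
    (etale_res hU hV h).formallyUnramified (hd₁.postcomp (res h')) (hd₂.comp (res h')) fun a ↦ by
      change res h' (d₁ (res h a)) = d₂ (res h' (res h a))
      rw [← h₁, res_res, res_res, h₂]

end IsRestriction

theorem exists_isRestriction (hU : IsAffineOpen U) (hV : IsAffineOpen V) (h : V ≤ U)
    {d : Γ(X, U) →+ Γ(X, U)} (hd : IsDerivationAlong (.id _) d) :
    ∃ d' : Γ(X, V) →+ Γ(X, V), IsDerivationAlong (.id _) d' ∧ IsRestriction h d d' := by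
  obtain ⟨d', hd', h'⟩ := IsDerivationAlong.exists_extension (g := .id _)
    (d := (res h : Γ(X, U) →+ Γ(X, V)).comp d) (etale_res hU hV h) (hd.postcomp (res h))
  exact ⟨d', hd', fun a ↦ (h' a).symm⟩

theorem isRestriction_of_cover {ι : Type*} {W : ι → X.Opens} (hW : ∀ i, IsAffineOpen (W i))
    {d : ∀ i, Γ(X, W i) →+ Γ(X, W i)} (hd : ∀ i, IsDerivationAlong (.id _) (d i))
    (hn : ∀ i j, ∀ x ∈ W i, x ∈ W j → ∃ (l : ι) (hi : W l ≤ W i) (hj : W l ≤ W j), x ∈ W l ∧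
      IsRestriction hi (d i) (d l) ∧ IsRestriction hj (d j) (d l))
    (hV : IsAffineOpen V) {i j : ι} (hi : V ≤ W i) (hj : V ≤ W j) {d' : Γ(X, V) →+ Γ(X, V)}
    (hd' : IsDerivationAlong (.id _) d') (h : IsRestriction hi (d i) d') :
    IsRestriction hj (d j) d' := fun a ↦ by
  refine eq_of_locally_eq _ _ fun x hx ↦ ?_
  obtain ⟨l, hli, hlj, hxl, hdi, hdj⟩ := hn i j x (hi hx) (hj hx)
  obtain ⟨N, hN, hxN, hNle⟩ := Opens.isBasis_iff_nbhd.mp X.isBasis_affineOpens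
    (show x ∈ V ⊓ W l from ⟨hx, hxl⟩)
  have hNV : N ≤ V := hNle.trans inf_le_left
  obtain ⟨dN, hdN, hlN⟩ := exists_isRestriction (hW l) hN (hNle.trans inf_le_right) (hd l)
  have hVN : IsRestriction hNV d' dN := .of_trans (hW i) hV hd' hdN h (hdi.trans hlN)
  refine ⟨N, hNV, hxN, ?_⟩
  rw [hVN, res_res, res_res]
  exact hdj.trans hlN a

end Restriction

section VectorFields

variable {k : Type u} [Field k] {X Y : Over (Spec (.of k))}

theorem VectorField.isDerivationAlong (δ : VectorField X) (U : X.left.Opens) :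
    IsDerivationAlong (.id _) (δ.der U) := δ.leibniz U

theorem exists_vectorField_of_isBasis {B : Set X.left.Opens} (hB : Opens.IsBasis B)
    (d : ∀ V ∈ B, Γ(X.left, V) →+ Γ(X.left, V)) (hd : ∀ V hV, IsDerivationAlong (.id _) (d V hV))
    (hc : ∀ V hV c, d V hV (consts X V c) = 0)
    (hn : ∀ V hV V' hV' (h : V' ≤ V), IsRestriction h (d V hV) (d V' hV')) :
    ∃ δ : VectorField X, ∀ V hV, δ.der V = d V hV := by
  have ext {O : X.left.Opens} {s t : Γ(X.left, O)}
      (h : ∀ V ∈ B, ∀ hVO : V ≤ O, res hVO s = res hVO t) : s = t := eq_of_isBasis hB s t h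
  choose D hD using fun (O : X.left.Opens) (s : Γ(X.left, O)) ↦
    exists_res_eq_of_isBasis hB O (fun V hV hVO ↦ d V hV (res hVO s))
      fun V hV hVO V' hV' h ↦ by rw [hn V hV V' hV' h, res_res]
  let δ : VectorField X :=
    { der := fun U ↦ AddMonoidHom.mk' (D U) fun a b ↦ ext fun W hW hWV ↦ by
        simp only [hD _ _ _ hW, map_add]
      leibniz := fun U a b ↦ ext fun W hW hWV ↦ by
        simp only [AddMonoidHom.mk'_apply, hD _ _ _ hW, map_mul, hd W hW _ _, map_add,
          RingHom.id_apply]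
      consts := fun U c ↦ ext fun W hW hWV ↦ by
        rw [AddMonoidHom.mk'_apply, hD _ _ _ hW, map_zero, ← RingHom.comp_apply, res_comp_consts,
          hc]
      res := fun h a ↦ ext fun W hW hWV ↦ by
        simp only [AddMonoidHom.mk'_apply, hD _ _ _ hW, res_res] }
  refine ⟨δ, fun V hV ↦ AddMonoidHom.ext fun a ↦ ?_⟩
  have hV_self := hD V a V hV le_rfl
  rwa [res_refl, res_refl] at hV_self

theorem exists_vectorField_of_affineCover {ι : Type*} (W : ι → X.left.Opens)
    (hW : ∀ i, IsAffineOpen (W i)) (hcov : ∀ x, ∃ i, x ∈ W i)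
    (d : ∀ i, Γ(X.left, W i) →+ Γ(X.left, W i)) (hd : ∀ i, IsDerivationAlong (.id _) (d i))
    (hc : ∀ i c, d i (consts X (W i) c) = 0)
    (hn : ∀ i j, ∀ x ∈ W i, x ∈ W j → ∃ (l : ι) (hi : W l ≤ W i) (hj : W l ≤ W j), x ∈ W l ∧
      IsRestriction hi (d i) (d l) ∧ IsRestriction hj (d j) (d l)) :
    ∃ δ : VectorField X, ∀ i, δ.der (W i) = d i := by
  let B : Set X.left.Opens := {V | IsAffineOpen V ∧ ∃ i, V ≤ W i}
  choose dB hdB hdB_res using fun (V : X.left.Opens) (hV : V ∈ B) ↦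
    exists_isRestriction (hW hV.2.choose) hV.1 hV.2.choose_spec (hd hV.2.choose)
  have hres (V : X.left.Opens) (hV : V ∈ B) (j : ι) (hj : V ≤ W j) :
      IsRestriction hj (d j) (dB V hV) :=
    isRestriction_of_cover hW hd hn hV.1 hV.2.choose_spec hj (hdB V hV) (hdB_res V hV)
  obtain ⟨δ, hδ⟩ := exists_vectorField_of_isBasis (isBasis_isAffineOpen_le_cover W hcov) dB hdB
    (fun V hV c ↦ by
      rw [← res_comp_consts X hV.2.choose_spec, RingHom.comp_apply, ← hdB_res V hV, hc, map_zero])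
    fun V hV V' hV' h ↦ .of_trans (hW _) hV.1 (hdB V hV) (hdB V' hV') (hdB_res V hV)
      (hres V' hV' _ _)
  refine ⟨δ, fun i ↦ AddMonoidHom.ext fun a ↦ ?_⟩
  have hWi := hres (W i) ⟨hW i, i, le_rfl⟩ i le_rfl a
  rw [res_refl, res_refl] at hWi
  rw [hδ (W i) ⟨hW i, i, le_rfl⟩, hWi]

theorem res_app {X Y : Scheme.{u}} (f : Y ⟶ X) {U V : X.Opens} (h : V ≤ U) (a : Γ(X, U)) :
    res (f.preimage_mono h) ((f.app U).hom a) = (f.app V).hom (res h a) :=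
  (RingHom.congr_fun (congrArg CommRingCat.Hom.hom (f.naturality (homOfLE h).op)) a).symm

theorem app_der_of_affineCover (δ : VectorField X) (δ' : VectorField Y) (f : Y.left ⟶ X.left)
    {ι : Type*} (W : ι → X.left.Opens) (hW : ∀ i, IsAffineOpen (W i)) (hcov : ∀ x, ∃ i, x ∈ W i)
    (h : ∀ i s, (f.app (W i)).hom (δ.der _ s) = δ'.der _ ((f.app (W i)).hom s))
    (U : X.left.Opens) (s : Γ(X.left, U)) :
    (f.app U).hom (δ.der U s) = δ'.der _ ((f.app U).hom s) := by
  refine eq_of_locally_eq _ _ fun y hy ↦ ?_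
  obtain ⟨V, ⟨hV, i, hVi⟩, hyV, hVU⟩ :=
    Opens.isBasis_iff_nbhd.mp (isBasis_isAffineOpen_le_cover W hcov) (show f y ∈ U from hy)
  refine ⟨f ⁻¹ᵁ V, f.preimage_mono hVU, hyV, ?_⟩
  rw [δ'.res, res_app, res_app, δ.res]
  refine DFunLike.congr_fun (IsDerivationAlong.ext_of_formallyUnramified
    (etale_res (hW i) hV hVi).formallyUnramified ((δ.isDerivationAlong V).postcomp (f.app V).hom)
    ((δ'.isDerivationAlong (f ⁻¹ᵁ V)).comp (f.app V).hom) fun a ↦ ?_) (res hVU s)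
  change (f.app V).hom (δ.der V (res hVi a)) = δ'.der _ ((f.app V).hom (res hVi a))
  rw [← δ.res, ← res_app, ← res_app, h, δ'.res]

end VectorFields

section PolynomialExtension

variable {A B : Type u} [CommRing A] [CommRing B]

/-- `B` is, via `ψ`, a polynomial algebra over `A`, in a possibly infinite set of variables. -/
def IsPolynomialExtension (ψ : A →+* B) : Prop :=
  ∃ (σ : Type u) (G : MvPolynomial σ A ≃+* B), ∀ a, G (.C a) = ψ a

theorem isRadical_map_C {σ : Type*} {I : Ideal A} (hI : I.IsRadical) :
    (I.map (MvPolynomial.C : A →+* MvPolynomial σ A)).IsRadical := by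
  rw [Ideal.isRadical_iff_quotient_reduced] at hI ⊢
  exact isReduced_of_injective _ (MvPolynomial.quotientEquivQuotientMvPolynomial I).symm.injective

theorem isPrime_map_C {σ : Type*} (p : Ideal A) [p.IsPrime] :
    (p.map (MvPolynomial.C : A →+* MvPolynomial σ A)).IsPrime :=
  (Ideal.Quotient.isDomain_iff_prime _).mp <|
    (MvPolynomial.quotientEquivQuotientMvPolynomial p).symm.injective.isDomain
      (MvPolynomial.quotientEquivQuotientMvPolynomial p).symm.toRingHom

namespace IsPolynomialExtension

variable {ψ : A →+* B}

theorem comp_ringEquiv {C : Type u} [CommRing C] {ψ' : A →+* C} (h : IsPolynomialExtension ψ)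
    (e : C ≃+* B) (he : ∀ a, e (ψ' a) = ψ a) : IsPolynomialExtension ψ' := by
  obtain ⟨σ, G, hG⟩ := h
  refine ⟨σ, G.trans e.symm, fun a ↦ ?_⟩
  rw [RingEquiv.trans_apply, hG, ← he, e.symm_apply_apply]

theorem exists_map_eq_comap (h : IsPolynomialExtension ψ) (I : Ideal A) :
    ∃ (σ : Type u) (G : B ≃+* MvPolynomial σ A), (∀ a, G (ψ a) = .C a) ∧
      I.map ψ = (I.map MvPolynomial.C).comap (G : B →+* MvPolynomial σ A) := by
  obtain ⟨σ, G, hG⟩ := h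
  obtain rfl : (G : MvPolynomial σ A →+* B).comp MvPolynomial.C = ψ := RingHom.ext hG
  refine ⟨σ, G.symm, fun a ↦ G.symm_apply_apply _, ?_⟩
  rw [← Ideal.map_map]
  exact Ideal.map_comap_of_equiv G

theorem isRadical_map (h : IsPolynomialExtension ψ) {I : Ideal A} (hI : I.IsRadical) :
    (I.map ψ).IsRadical := by
  obtain ⟨σ, G, -, hIG⟩ := h.exists_map_eq_comap I
  rw [hIG]
  exact (isRadical_map_C hI).comap _

theorem isPrime_map (h : IsPolynomialExtension ψ) (p : Ideal A) [p.IsPrime] :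
    (p.map ψ).IsPrime := by
  obtain ⟨σ, G, -, hpG⟩ := h.exists_map_eq_comap p
  have := isPrime_map_C (σ := σ) p
  rw [hpG]
  exact this.comap _

theorem comap_map (h : IsPolynomialExtension ψ) (I : Ideal A) : (I.map ψ).comap ψ = I := by
  obtain ⟨σ, G, hG, hIG⟩ := h.exists_map_eq_comap I
  ext a
  rw [hIG, Ideal.mem_comap, Ideal.mem_comap, RingEquiv.coe_toRingHom, hG,
    MvPolynomial.mem_map_C_iff]
  refine ⟨fun ha ↦ by simpa using ha 0, fun ha m ↦ ?_⟩
  classical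
  rw [MvPolynomial.coeff_C]
  split_ifs
  exacts [ha, zero_mem I]

end IsPolynomialExtension

end PolynomialExtension

section AffinePreimage

variable {X Y : Scheme.{u}} (f : Y ⟶ X) {U : X.affineOpens} (hA : IsAffineOpen (f ⁻¹ᵁ U.1))

theorem apply_fromSpec (z : Spec Γ(Y, f ⁻¹ᵁ U.1)) :
    f (hA.fromSpec z) = U.2.fromSpec (Spec.map (f.app U.1) z) := by
  have h := IsAffineOpen.SpecMap_appLE_fromSpec f U.2 hA le_rfl
  rw [Scheme.Hom.appLE_eq_app] at h
  simpa only [Scheme.Hom.comp_apply] using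
    (congrArg (fun g : Spec Γ(Y, f ⁻¹ᵁ U.1) ⟶ X ↦ g z) h).symm

theorem fromSpec_preimage_preimage (Z : Set X) :
    hA.fromSpec ⁻¹' (f ⁻¹' Z) =
      PrimeSpectrum.comap (f.app U.1).hom ⁻¹' (U.2.fromSpec ⁻¹' Z) :=
  Set.ext fun z ↦ iff_of_eq (congrArg (· ∈ Z) (apply_fromSpec f hA z))

theorem fromSpec_preimage_eq_zeroLocus (Z : Closeds X) :
    U.2.fromSpec ⁻¹' (Z : Set X) =
      PrimeSpectrum.zeroLocus ((Scheme.IdealSheafData.vanishingIdeal Z).ideal U) := by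
  rw [Scheme.IdealSheafData.vanishingIdeal_ideal,
    PrimeSpectrum.zeroLocus_vanishingIdeal_eq_closure]
  exact (Z.isClosed.preimage U.2.fromSpec.continuous).closure_eq.symm

theorem isRadical_vanishingIdeal (Z : Closeds X) (U : X.affineOpens) :
    ((Scheme.IdealSheafData.vanishingIdeal Z).ideal U).IsRadical := by
  rw [Scheme.IdealSheafData.vanishingIdeal_ideal]
  exact PrimeSpectrum.isRadical_vanishingIdeal _

theorem vanishingIdeal_preimage (hf : IsPolynomialExtension (f.app U.1).hom) (Z : Closeds X) :
    (Scheme.IdealSheafData.vanishingIdeal (Z.preimage f.continuous)).ideal ⟨f ⁻¹ᵁ U.1, hA⟩ =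
      ((Scheme.IdealSheafData.vanishingIdeal Z).ideal U).map (f.app U.1).hom := by
  have hpre : hA.fromSpec ⁻¹' (f ⁻¹' (Z : Set X)) = PrimeSpectrum.zeroLocus
      (((Scheme.IdealSheafData.vanishingIdeal Z).ideal U).map (f.app U.1).hom) := by
    refine (fromSpec_preimage_preimage f hA Z).trans
      ((congrArg _ (fromSpec_preimage_eq_zeroLocus Z)).trans ?_)
    rw [PrimeSpectrum.preimage_comap_zeroLocus, Ideal.map, PrimeSpectrum.zeroLocus_span]
  rw [Scheme.IdealSheafData.vanishingIdeal_ideal]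
  refine (congrArg PrimeSpectrum.vanishingIdeal hpre).trans ?_
  rw [PrimeSpectrum.vanishingIdeal_zeroLocus_eq_radical,
    (hf.isRadical_map (isRadical_vanishingIdeal Z U)).radical]

theorem exists_generic_of_isPolynomialExtension (hA : IsAffineOpen (f ⁻¹ᵁ U.1))
    (hf : IsPolynomialExtension (f.app U.1).hom) {x : X} (hx : x ∈ U.1) :
    ∃ η, f η = x ∧ ∀ y, f y ∈ U.1 → x ⤳ f y → η ⤳ y := by
  have hU : IsAffineOpen U.1 := U.2
  rw [← SetLike.mem_coe, ← hU.range_fromSpec] at hx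
  obtain ⟨p, rfl⟩ := hx
  have : (PrimeSpectrum.asIdeal p).IsPrime := PrimeSpectrum.isPrime p
  let q : Spec Γ(Y, f ⁻¹ᵁ U.1) := (⟨_, hf.isPrime_map (PrimeSpectrum.asIdeal p)⟩ : PrimeSpectrum _)
  have hqp : Spec.map (f.app U.1) q = p := PrimeSpectrum.ext (hf.comap_map _)
  refine ⟨hA.fromSpec q, by rw [apply_fromSpec, hqp], fun y hy hxy ↦ ?_⟩
  obtain ⟨z, rfl⟩ : y ∈ Set.range hA.fromSpec := by rw [hA.range_fromSpec]; exact hy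
  refine Specializes.map ?_ hA.fromSpec.continuous
  rw [apply_fromSpec, hU.fromSpec.isOpenEmbedding.isInducing.specializes_iff] at hxy
  exact (PrimeSpectrum.le_iff_specializes q z).mp
    (Ideal.map_le_iff_le_comap.mpr ((PrimeSpectrum.le_iff_specializes _ _).mpr hxy))

end AffinePreimage

section Components

variable {X Y : Type*} [TopologicalSpace X] [TopologicalSpace Y] {f : Y → X}

theorem isIrreducible_preimage [QuasiSober X] (hf : Continuous f)
    (hgen : ∀ x, ∃ η, f η = x ∧ ∀ y, x ⤳ f y → η ⤳ y) {Z : Closeds X}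
    (hZ : IsIrreducible (Z : Set X)) : IsIrreducible (f ⁻¹' Z) := by
  obtain ⟨x, hx⟩ := QuasiSober.sober hZ Z.isClosed
  obtain ⟨η, rfl, hη⟩ := hgen x
  have hclosure : f ⁻¹' Z = closure {η} :=
    Set.Subset.antisymm (fun y hy ↦ (hη y (hx.specializes hy)).mem_closure)
      (closure_minimal (Set.singleton_subset_iff.mpr hx.mem) (Z.isClosed.preimage hf))
  rw [hclosure]
  exact isIrreducible_singleton.closure

theorem exists_component_le_preimage [QuasiSober X] (hf : Continuous f) {D : Closeds X}
    {W : Closeds Y} (hW : IsIrreducible (W : Set Y)) (hWD : W ≤ D.preimage hf) :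
    ∃ Z ∈ components D, W ≤ Z.preimage hf := by
  obtain ⟨x, hx⟩ := QuasiSober.sober (hW.image f hf.continuousOn).closure isClosed_closure
  have himage : f '' W ⊆ D := Set.image_subset_iff.mpr hWD
  have hxD : x ∈ D := closure_minimal himage D.isClosed hx.mem
  obtain ⟨Z, hZ, hxZ⟩ := exists_component D hxD
  refine ⟨Z, hZ, fun y hy ↦ ?_⟩
  have hle : closure {x} ⊆ (Z : Set X) :=
    closure_minimal (Set.singleton_subset_iff.mpr hxZ) Z.isClosed
  rw [hx.def] at hle
  exact hle (subset_closure ⟨y, hy, rfl⟩)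

theorem mem_components_preimage_iff [QuasiSober X] (hf : Continuous f)
    (hgen : ∀ x, ∃ η, f η = x ∧ ∀ y, x ⤳ f y → η ⤳ y) (D : Closeds X) (W : Closeds Y) :
    W ∈ components (D.preimage hf) ↔ ∃ Z ∈ components D, W = Z.preimage hf := by
  have hf_surj : Function.Surjective f := fun x ↦ (hgen x).imp fun _ h ↦ h.1
  constructor
  · intro hW
    obtain ⟨Z, hZ, hle⟩ := exists_component_le_preimage hf hW.1.1 hW.1.2
    exact ⟨Z, hZ, le_antisymm hle
      (hW.2 ⟨isIrreducible_preimage hf hgen hZ.1.1, fun _ hy ↦ hZ.1.2 hy⟩ hle)⟩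
  · rintro ⟨Z, hZ, rfl⟩
    refine ⟨⟨isIrreducible_preimage hf hgen hZ.1.1, fun _ hy ↦ hZ.1.2 hy⟩, fun W hW hle ↦ ?_⟩
    obtain ⟨Z', hZ', hle'⟩ := exists_component_le_preimage hf hW.1 hW.2
    have hZZ' : Z ≤ Z' := hf_surj.preimage_subset_preimage_iff.mp (hle.trans hle')
    exact fun y hy ↦ hZ.2 hZ'.1 hZZ' (hle' hy)

end Components

variable {k : Type u} [Field k]

theorem exists_mem_toOpens {X : Scheme.{u}} (x : X) :
    ∃ U : X.AffineZariskiSite, x ∈ U.toOpens := by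
  obtain ⟨V, hV, hx, -⟩ := Opens.isBasis_iff_nbhd.mp X.isBasis_affineOpens (Opens.mem_top x)
  exact ⟨⟨V, hV⟩, hx⟩

theorem exists_le_of_mem_toOpens {X : Scheme.{u}} (U V : X.AffineZariskiSite) {x : X}
    (hU : x ∈ U.toOpens) (hV : x ∈ V.toOpens) :
    ∃ W : X.AffineZariskiSite, W ≤ U ∧ W ≤ V ∧ x ∈ W.toOpens := by
  obtain ⟨f, g, h, hx⟩ := exists_basicOpen_le_affine_inter U.2 V.2 x ⟨hU, hV⟩
  exact ⟨U.basicOpen f, U.basicOpen_le f, ⟨g, h.symm⟩, hx⟩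

theorem app_consts {X Y : Over (Spec (.of k))} (f : Y ⟶ X) (U : X.left.Opens) (c : k) :
    (f.left.app U).hom (consts X U c) = consts Y (f.left ⁻¹ᵁ U) c := by
  have htop : X.hom.appTop ≫ f.left.appTop = Y.hom.appTop := by
    rw [← Scheme.Hom.comp_appTop, Over.w f]
  refine (res_app f.left le_top _).symm.trans (congrArg (res (f.left.preimage_mono le_top)) ?_)
  exact RingHom.congr_fun (congrArg CommRingCat.Hom.hom htop) ((Scheme.ΓSpecIso (.of k)).inv.hom c)

namespace LogPair

variable (P : LogPair k)

/-- The derivation of the algebra of log jets. -/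
def logJetDer (U : P.X.left.AffineZariskiSite) : P.logJetAlgebra U →+ P.logJetAlgebra U where
  toFun s := ⟨JetAlgebra.der _ s.1, P.der_mem U s.2⟩
  map_zero' := Subtype.ext (map_zero _)
  map_add' _ _ := Subtype.ext (map_add _ _ _)

theorem isDerivationAlong_logJetDer (U : P.X.left.AffineZariskiSite) :
    IsDerivationAlong (.id _) (P.logJetDer U) := fun _ _ ↦
  Subtype.ext ((JetAlgebra.der _).leibniz _ _)

theorem logJetDer_resHom {U V : P.X.left.AffineZariskiSite} (h : V ≤ U) (s : P.logJetAlgebra U) :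
    P.resHom h (P.logJetDer U s) = P.logJetDer V (P.resHom h s) :=
  Subtype.ext (P.resJets_der (Scheme.AffineZariskiSite.toOpens_mono h) s.1)

theorem logJetDer_fnHom_consts (U : P.X.left.AffineZariskiSite) (c : k) :
    P.logJetDer U (P.fnHom U (consts P.X U.toOpens c)) = 0 := by
  refine Subtype.ext ?_
  change JetAlgebra.der _ (JetAlgebra.of _ (res inf_le_left (consts P.X U.toOpens c))) = 0
  rw [← RingHom.comp_apply (res _), res_comp_consts, ← RingHom.comp_apply, JetAlgebra.of_comp,
    Derivation.map_algebraMap]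

/-- The isomorphism `logJetSections`. -/
def logJetSectionsEquiv (U : P.X.left.AffineZariskiSite) :
    Γ(P.logJet.left, P.above U) ≃+* P.logJetAlgebra U :=
  .ofBijective _ (P.logJetSections_bijective U)

/-- The derivation of the algebra of log jets, on the functions on the log jet space. -/
def sectionsDer (U : P.X.left.AffineZariskiSite) :
    Γ(P.logJet.left, P.above U) →+ Γ(P.logJet.left, P.above U) :=
  (P.logJetSectionsEquiv U).symm.toAddMonoidHom.comp
    ((P.logJetDer U).comp (P.logJetSectionsEquiv U).toAddMonoidHom)

theorem logJetSections_sectionsDer (U : P.X.left.AffineZariskiSite)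
    (s : Γ(P.logJet.left, P.above U)) :
    P.logJetSections U (P.sectionsDer U s) = P.logJetDer U (P.logJetSections U s) :=
  (P.logJetSectionsEquiv U).apply_symm_apply _

theorem isDerivationAlong_sectionsDer (U : P.X.left.AffineZariskiSite) :
    IsDerivationAlong (.id _) (P.sectionsDer U) := fun a b ↦ by
  apply (P.logJetSections_bijective U).injective
  simp only [logJetSections_sectionsDer, map_mul, P.isDerivationAlong_logJetDer U _ _, map_add,
    RingHom.id_apply]

theorem sectionsDer_consts (U : P.X.left.AffineZariskiSite) (c : k) :
    P.sectionsDer U (consts P.logJet (P.above U) c) = 0 := by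
  apply (P.logJetSections_bijective U).injective
  rw [logJetSections_sectionsDer, map_zero, ← app_consts P.logJetProj, logJetSections_proj,
    logJetDer_fnHom_consts]

theorem isRestriction_sectionsDer {U V : P.X.left.AffineZariskiSite} (h : V ≤ U) :
    IsRestriction (P.above_mono h) (P.sectionsDer U) (P.sectionsDer V) := fun a ↦ by
  apply (P.logJetSections_bijective V).injective
  rw [P.logJetSections_res h, logJetSections_sectionsDer, logJetSections_sectionsDer,
    P.logJetSections_res h, logJetDer_resHom]

theorem exists_mem_above (x : P.logJet.left) : ∃ U, x ∈ P.above U :=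
  exists_mem_toOpens (P.logJetProj.left x)

theorem exists_logJetField :
    ∃ δ : VectorField P.logJet, ∀ U, δ.der (P.above U) = P.sectionsDer U := by
  refine exists_vectorField_of_affineCover (X := P.logJet) P.above P.isAffineOpen_above
    P.exists_mem_above P.sectionsDer P.isDerivationAlong_sectionsDer P.sectionsDer_consts
    fun U V x hU hV ↦ ?_
  obtain ⟨W, hWU, hWV, hx⟩ := exists_le_of_mem_toOpens U V hU hV
  exact ⟨W, P.above_mono hWU, P.above_mono hWV, hx, P.isRestriction_sectionsDer hWU,
    P.isRestriction_sectionsDer hWV⟩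

/-- The vector field on the log jet space that restricts to the derivation of the algebra of log
jets over each affine open subset. -/
def logJetField : VectorField P.logJet := P.exists_logJetField.choose

theorem logJetSections_der (U : P.X.left.AffineZariskiSite) (s : Γ(P.logJet.left, P.above U)) :
    P.logJetSections U (P.logJetField.der (P.above U) s) =
      P.logJetDer U (P.logJetSections U s) := by
  rw [logJetField, P.exists_logJetField.choose_spec, logJetSections_sectionsDer]

end LogPair

namespace LogChart

variable {P : LogPair k} {U : P.X.left.affineOpens} (c : LogChart P.X P.D U)

/-- The domain of a chart, in the affine Zariski site. -/
abbrev site (U : P.X.left.affineOpens) : P.X.left.AffineZariskiSite := ⟨U.1, U.2⟩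

open Classical in
/-- The equation `x_j` if `x_j` is the equation of a component of the divisor, and `1` otherwise:
the differential of `x_j` with its logarithmic pole is `∂x_j / weight j`. -/
def weight (j : c.J) : Γ(P.X.left, U) := if j ∈ Set.range c.σ then c.φ (.X j) else 1

theorem weight_σ (Z : meetingComponents P.D U.1) : c.weight (c.σ Z) = c.eqn Z := by
  rw [weight, if_pos (Set.mem_range_self Z), eqn]

theorem isUnit_res_weight (j : c.J) :
    IsUnit (res (inf_le_left : P.away U.1 ≤ U.1) (c.weight j)) := by
  by_cases hj : j ∈ Set.range c.σ
  · obtain ⟨Z, rfl⟩ := hj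
    rw [weight_σ]
    exact c.isUnit_res_eqn Z
  · rw [weight, if_neg hj, map_one]
    exact isUnit_one

/-- The inverse of `weight j` off the divisor. -/
def invWeight (j : c.J) : Γ(P.X.left, P.away U.1) := ↑(c.isUnit_res_weight j).unit⁻¹

theorem res_weight_mul_invWeight (j : c.J) :
    res (inf_le_left : P.away U.1 ≤ U.1) (c.weight j) * c.invWeight j = 1 :=
  (c.isUnit_res_weight j).mul_val_inv

/-- The logarithmic differential `∂x_j / x_j` if `x_j` is the equation of a component of the
divisor, and the differential `∂x_j` otherwise. -/
def logDifferential (j : c.J) : P.awayJets U.1 :=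
  JetAlgebra.of _ (c.invWeight j) * JetAlgebra.der _ (P.fn U.1 (c.φ (.X j)))

theorem isLogDifferential_logDifferential :
    IsLogDifferential (res (inf_le_left : P.away U.1 ≤ U.1)) c.φ c.weight c.logDifferential :=
  fun j ↦ by
    rw [logDifferential, ← mul_assoc, ← map_mul, res_weight_mul_invWeight, map_one, one_mul]
    rfl

theorem fn_eqn_mul_logDifferential (Z : meetingComponents P.D U.1) :
    P.fn U.1 (c.eqn Z) * c.logDifferential (c.σ Z) = JetAlgebra.der _ (P.fn U.1 (c.eqn Z)) := by
  have h := c.isLogDifferential_logDifferential (c.σ Z)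
  rwa [weight_σ] at h

theorem logDifferential_mem (j : c.J) : c.logDifferential j ∈ P.logJetAlgebra (site U) := by
  have hinv := c.res_weight_mul_invWeight j
  by_cases hj : j ∈ Set.range c.σ
  · obtain ⟨Z, rfl⟩ := hj
    rw [weight_σ] at hinv
    refine P.generators_subset (site U) (.inr ⟨Z, Z.2.1, c.eqn Z,
      (c.mem_ideal_iff Z).mpr dvd_rfl, c.invWeight (c.σ Z), fun t ht ↦ ?_, rfl⟩)
    obtain ⟨a, rfl⟩ := (c.mem_ideal_iff Z).mp ht
    exact ⟨a, by rw [map_mul, ← mul_assoc, mul_comm (c.invWeight _), hinv, one_mul]⟩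
  · rw [weight, if_neg hj, map_one, one_mul] at hinv
    rw [logDifferential, hinv, map_one, one_mul]
    exact P.der_mem (site U) (P.fn_mem (site U) (c.φ (.X j)))

theorem logJetAlgebra_le {S : Subring (P.awayJets U.1)} (hfn : ∀ a, P.fn U.1 a ∈ S)
    (hder : ∀ s ∈ S, JetAlgebra.der _ s ∈ S)
    (hlog : ∀ Z : meetingComponents P.D U.1, c.logDifferential (c.σ Z) ∈ S) :
    P.logJetAlgebra (site U) ≤ S := by
  refine P.logJetAlgebra_le ?_ hder
  rintro _ (⟨a, rfl⟩ | ⟨Z, hZ, x, hx, y, hy, rfl⟩)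
  · exact hfn a
  by_cases hZU : ((Z : Set P.X.left) ∩ U.1).Nonempty
  · let Z' : meetingComponents P.D U.1 := ⟨Z, hZ, hZU⟩
    obtain ⟨a, rfl⟩ := (c.mem_ideal_iff Z').mp hx
    obtain ⟨b, hb⟩ := hy (c.eqn Z') ((c.mem_ideal_iff Z').mpr dvd_rfl)
    have hinv := c.res_weight_mul_invWeight (c.σ Z')
    rw [weight_σ] at hinv
    rw [LogPair.fn, RingHom.comp_apply, map_mul, JetAlgebra.of_mul_der_of_mul hinv, hb, ← map_mul]
    exact add_mem (mul_mem (hfn b) (hder _ (hfn a))) (mul_mem (hfn (a * b)) (hlog Z'))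
  · obtain ⟨b, hb⟩ := hy 1 (mem_vanishingIdeal_iff (U := U) |>.mpr fun z hz hz' ↦
      hZU ⟨z, hz, P.X.left.basicOpen_le _ hz'⟩)
    rw [map_one, mul_one] at hb
    rw [hb]
    exact mul_mem (hfn b) (hder _ (hfn x))

/-- The jet coordinates over a chart: `z_{j,n}` is sent to `∂ⁿ` of the logarithmic differential of
the `j`-th coordinate. -/
def jetCoord : MvPolynomial (c.J × ℕ) Γ(P.X.left, U) →+* P.awayJets U.1 :=
  logCoord (res inf_le_left) c.logDifferential

theorem jetCoord_C (a : Γ(P.X.left, U)) : c.jetCoord (.C a) = P.fn U.1 a := logCoord_C ..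

theorem res_comp_φ_comp_C : (res (inf_le_left : P.away U.1 ≤ U.1)).comp
    (c.φ.comp MvPolynomial.C) = consts P.X (P.away U.1) := by
  rw [c.φ_comp]
  exact res_comp_consts P.X _

theorem jetCoord_injective [CharZero k] : Function.Injective c.jetCoord :=
  logCoord_injective c.etale (etale_of_isLocalizationAway c.prodEqn c.isLocalization)
    c.res_injective c.res_comp_φ_comp_C c.isUnit_res_weight c.isLogDifferential_logDifferential

theorem jetCoord_mem (p : MvPolynomial (c.J × ℕ) Γ(P.X.left, U)) :
    c.jetCoord p ∈ P.logJetAlgebra (site U) := by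
  induction p using MvPolynomial.induction_on with
  | C a =>
    rw [jetCoord_C]
    exact P.fn_mem (site U) a
  | add p q hp hq =>
    rw [map_add]
    exact add_mem hp hq
  | mul_X p i hp =>
    rw [map_mul]
    refine mul_mem hp ?_
    have hder : Set.MapsTo (JetAlgebra.der _) (P.logJetAlgebra (site U) : Set (P.awayJets U.1))
        (P.logJetAlgebra (site U)) := fun _ ↦ P.der_mem (site U)
    rw [jetCoord, logCoord_X]
    exact hder.iterate i.2 (c.logDifferential_mem i.1)

theorem range_jetCoord : c.jetCoord.range = P.logJetAlgebra (site U) := by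
  refine le_antisymm ?_ (c.logJetAlgebra_le (fun a ↦ ⟨.C a, c.jetCoord_C a⟩) ?_
    fun Z ↦ ⟨.X (c.σ Z, 0), logCoord_X ..⟩)
  · rintro _ ⟨p, rfl⟩
    exact c.jetCoord_mem p
  · obtain ⟨D, hD⟩ := exists_isLogDerivation c.etale c.weight
    rintro _ ⟨p, rfl⟩
    exact ⟨D p, logCoord_derivation c.etale c.res_comp_φ_comp_C
      c.isLogDifferential_logDifferential hD p⟩

theorem isPolynomialExtension_fnHom [CharZero k] (c : LogChart P.X P.D U) :
    IsPolynomialExtension (P.fnHom (site U)) := by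
  refine ⟨c.J × ℕ, .ofBijective (c.jetCoord.codRestrict _ c.jetCoord_mem)
    ⟨fun x y h ↦ c.jetCoord_injective (congrArg Subtype.val h), ?_⟩,
    fun a ↦ Subtype.ext (c.jetCoord_C a)⟩
  rintro ⟨s, hs⟩
  obtain ⟨p, rfl⟩ := c.range_jetCoord.ge hs
  exact ⟨p, rfl⟩

theorem isPolynomialExtension_logJetProj_app [CharZero k] (c : LogChart P.X P.D U) :
    IsPolynomialExtension (P.logJetProj.left.app U.1).hom :=
  c.isPolynomialExtension_fnHom.comp_ringEquiv (P.logJetSectionsEquiv (site U))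
    (P.logJetSections_proj (site U))

end LogChart

theorem isTangent_of_locally_principal {X : Over (Spec (.of k))} {D : Closeds X.left}
    {δ : VectorField X} (h : ∀ x ∈ D, ∃ (U : X.left.affineOpens) (Z : Closeds X.left)
      (t : Γ(X.left, U)), x ∈ U.1 ∧ x ∈ Z ∧ Z ≤ D ∧
        (Scheme.IdealSheafData.vanishingIdeal Z).ideal U = Ideal.span {t} ∧ t ∣ δ.der U.1 t) :
    δ.IsTangent D := by
  intro V s hs
  refine mem_vanishingIdeal_iff.mpr fun x hxD hxs ↦ ?_
  have hxV : x ∈ V.1 := X.left.basicOpen_le _ hxs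
  obtain ⟨U, Z, t, hxU, hxZ, hZD, ht, htδ⟩ := h x hxD
  obtain ⟨W, hW, hxW, hWle⟩ := Opens.isBasis_iff_nbhd.mp X.left.isBasis_affineOpens
    (show x ∈ V.1 ⊓ U.1 from ⟨hxV, hxU⟩)
  let W' : X.left.affineOpens := ⟨W, hW⟩
  have hWV : W ≤ V.1 := hWle.trans inf_le_left
  have hWU : W ≤ U.1 := hWle.trans inf_le_right
  have hspan : (Scheme.IdealSheafData.vanishingIdeal Z).ideal W' = Ideal.span {res hWU t} := by
    rw [← Scheme.IdealSheafData.map_ideal _ (U := W') (V := U) hWU, ht, Ideal.map_span,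
      Set.image_singleton]
    rfl
  have hsW : res hWV s ∈ (Scheme.IdealSheafData.vanishingIdeal Z).ideal W' :=
    Scheme.IdealSheafData.vanishingIdeal_antimono hZD W'
      (Scheme.IdealSheafData.ideal_le_comap_ideal _ (U := W') (V := V) hWV hs)
  have hδsW : res hWV (δ.der V.1 s) ∈ (Scheme.IdealSheafData.vanishingIdeal Z).ideal W' := by
    rw [hspan, Ideal.mem_span_singleton] at hsW ⊢
    obtain ⟨a, ha⟩ := hsW
    rw [δ.res, ha, δ.leibniz, ← δ.res]
    exact dvd_add (dvd_mul_right _ _) (dvd_mul_of_dvd_right (map_dvd (res hWU) htδ) _)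
  refine mem_vanishingIdeal_iff.mp hδsW x hxZ ?_
  rw [Scheme.basicOpen_res]
  exact ⟨hxW, hxs⟩

instance (P : LogPair k) : IsAffineHom P.logJetProj.left :=
  ⟨fun U hU ↦ P.isAffineOpen_above ⟨U, hU⟩⟩

namespace LogChart

variable {P : LogPair k} {U : P.X.left.affineOpens}

/-- The preimage of the domain of a chart in the log jet space. -/
abbrev jetSite (U : P.X.left.affineOpens) : P.logJet.left.affineOpens :=
  ⟨P.logJetProj.left ⁻¹ᵁ U.1, P.isAffineOpen_above (site U)⟩

theorem vanishingIdeal_jetSite [CharZero k] (c : LogChart P.X P.D U) (Z : Closeds P.X.left) :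
    (Scheme.IdealSheafData.vanishingIdeal (Z.preimage P.logJetProj.left.continuous)).ideal
      (jetSite U) =
      ((Scheme.IdealSheafData.vanishingIdeal Z).ideal U).map (P.logJetProj.left.app U.1).hom :=
  vanishingIdeal_preimage P.logJetProj.left (P.isAffineOpen_above (site U))
    c.isPolynomialExtension_logJetProj_app Z

theorem app_eqn_dvd_der (c : LogChart P.X P.D U) (Z : meetingComponents P.D U.1) :
    (P.logJetProj.left.app U.1).hom (c.eqn Z) ∣
      P.logJetField.der _ ((P.logJetProj.left.app U.1).hom (c.eqn Z)) := by
  obtain ⟨w, hw⟩ := (P.logJetSections_bijective (site U)).surjective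
    ⟨_, c.logDifferential_mem (c.σ Z)⟩
  refine ⟨w, (P.logJetSections_bijective (site U)).injective ?_⟩
  rw [map_mul, hw, P.logJetSections_der (site U), P.logJetSections_proj (site U)]
  exact Subtype.ext (c.fn_eqn_mul_logDifferential Z).symm

end LogChart

namespace LogPair

variable (P : LogPair k)

open LogChart

theorem exists_logJet_generic [CharZero k] (x : P.X.left) :
    ∃ η, P.logJetProj.left η = x ∧ ∀ y, x ⤳ P.logJetProj.left y → η ⤳ y := by
  have generic_over_chart (U : P.X.left.affineOpens) (c : LogChart P.X P.D U) (hx : x ∈ U.1) :=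
    exists_generic_of_isPolynomialExtension P.logJetProj.left (P.isAffineOpen_above (site U))
      c.isPolynomialExtension_logJetProj_app hx
  obtain ⟨U, hxU, -, ⟨c⟩⟩ := P.exists_logChart ⊤ (p := x) trivial
  obtain ⟨η, hη, hη_spec⟩ := generic_over_chart U c hxU
  refine ⟨η, hη, fun y hy ↦ ?_⟩
  obtain ⟨U', hyU', -, ⟨c'⟩⟩ := P.exists_logChart ⊤ (p := P.logJetProj.left y) trivial
  obtain ⟨η', hη', hη'_spec⟩ := generic_over_chart U' c' (hy.mem_open U'.1.isOpen hyU')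
  exact (hη_spec η' (hη'.symm ▸ hxU) (by rw [hη'])).trans (hη'_spec y hyU' hy)

theorem mem_components_logJetDivisor [CharZero k] (W : Closeds P.logJet.left) :
    W ∈ components P.logJetDivisor ↔
      ∃ Z ∈ components P.D, W = Z.preimage P.logJetProj.left.continuous :=
  mem_components_preimage_iff P.logJetProj.left.continuous P.exists_logJet_generic P.D W

theorem nonempty_logChart_logJet [CharZero k] {U : P.X.left.affineOpens}
    (c : LogChart P.X P.D U) : Nonempty (LogChart P.logJet P.logJetDivisor (jetSite U)) := by
  obtain ⟨σ, G, hG⟩ := c.isPolynomialExtension_logJetProj_app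
  have exists_component_below (W : meetingComponents P.logJetDivisor (jetSite U).1) :
      ∃ Z : meetingComponents P.D U.1, W.1 = Z.1.preimage P.logJetProj.left.continuous := by
    obtain ⟨Z, hZ, hWZ⟩ := (P.mem_components_logJetDivisor W.1).mp W.2.1
    obtain ⟨x, hx, hxU⟩ := W.2.2
    rw [hWZ] at hx
    exact ⟨⟨Z, hZ, P.logJetProj.left x, hx, hxU⟩, hWZ⟩
  choose τ hτ using exists_component_below
  have hτ_inj : Function.Injective τ := fun W₁ W₂ h ↦ Subtype.ext (by rw [hτ, hτ, h])
  have := c.finite.to_subtype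
  refine ⟨⟨σ ⊕ c.J, G.toRingHom.comp (polyChart c.φ σ), fun W ↦ .inr (c.σ (τ W)), ?_, ?_,
    Set.finite_coe_iff.mp (Finite.of_injective τ hτ_inj),
    Sum.inr_injective.comp (c.σ_injective.comp hτ_inj), fun W ↦ ?_⟩⟩
  · ext a
    change G (polyChart c.φ σ (.C a)) = consts P.logJet (P.logJetProj.left ⁻¹ᵁ U.1) a
    rw [polyChart_C, hG, ← app_consts P.logJetProj, ← c.φ_comp, RingHom.comp_apply]
  · exact etale_comp (polyChart_etale c.etale σ) (RingHom.Etale.of_bijective G.bijective)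
  · rw [hτ, c.vanishingIdeal_jetSite, c.ideal_eq, Ideal.map_span, Set.image_singleton, ← hG,
      ← polyChart_inr]
    rfl

theorem hasLogChart_logJet [CharZero k] (p : P.logJet.left) :
    HasLogChart P.logJet P.logJetDivisor p := by
  obtain ⟨U, hU, -, ⟨c⟩⟩ := P.exists_logChart ⊤ (p := P.logJetProj.left p) trivial
  obtain ⟨c'⟩ := P.nonempty_logChart_logJet c
  exact c'.hasLogChart hU

theorem vanishingIdeal_logJetDivisor [CharZero k] :
    Scheme.IdealSheafData.vanishingIdeal P.logJetDivisor =
      (Scheme.IdealSheafData.vanishingIdeal P.D).comap P.logJetProj.left := by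
  refine le_antisymm ?_ ?_
  · refine Scheme.IdealSheafData.le_of_iSup_eq_top
      (fun i : {U : P.X.left.affineOpens // Nonempty (LogChart P.X P.D U)} ↦ jetSite i.1) ?_ ?_
    · refine top_le_iff.mp fun x _ ↦ ?_
      obtain ⟨U, hU, -, hc⟩ := P.exists_logChart ⊤ (p := P.logJetProj.left x) trivial
      exact Opens.mem_iSup.mpr ⟨⟨U, hc⟩, hU⟩
    · rintro ⟨U, ⟨c⟩⟩
      refine (c.vanishingIdeal_jetSite P.D).trans_le (Ideal.map_le_iff_le_comap.mpr ?_)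
      have h := (Scheme.IdealSheafData.le_map_comap (f := P.logJetProj.left)
        (J := Scheme.IdealSheafData.vanishingIdeal P.D)) U
      exact h.trans_eq (Scheme.IdealSheafData.ideal_map _ _ U (P.isAffineOpen_above (site U)))
  · rw [← Scheme.IdealSheafData.le_support_iff_le_vanishingIdeal,
      Scheme.IdealSheafData.support_comap]
    intro x hx
    change P.logJetProj.left x ∈ (Scheme.IdealSheafData.vanishingIdeal P.D).support
    rw [← SetLike.mem_coe, Scheme.IdealSheafData.coe_support_vanishingIdeal]
    exact hx

theorem logJetField_isTangent [CharZero k] : P.logJetField.IsTangent P.logJetDivisor := by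
  refine isTangent_of_locally_principal fun x hx ↦ ?_
  obtain ⟨U, hU, -, ⟨c⟩⟩ := P.exists_logChart ⊤ (p := P.logJetProj.left x) trivial
  obtain ⟨Z, hZ, hxZ⟩ := exists_component P.D (show P.logJetProj.left x ∈ P.D from hx)
  let Z' : meetingComponents P.D U.1 := ⟨Z, hZ, P.logJetProj.left x, hxZ, hU⟩
  refine ⟨jetSite U, Z.preimage P.logJetProj.left.continuous,
    (P.logJetProj.left.app U.1).hom (c.eqn Z'), hU, hxZ, fun y hy ↦ hZ.1.2 hy, ?_,
    c.app_eqn_dvd_der Z'⟩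
  rw [c.vanishingIdeal_jetSite, c.ideal_eq Z', Ideal.map_span, Set.image_singleton]
  rfl

end LogPair

section AffineGluing

variable {X Y Z : Scheme.{u}}

theorem hom_ext_of_opens {ι : Type*} (W : ι → Y.Opens) (hW : ∀ y, ∃ i, y ∈ W i) {g g' : Y ⟶ Z}
    (h : ∀ i, (W i).ι ≫ g = (W i).ι ≫ g') : g = g' :=
  Scheme.Cover.hom_ext (Y.openCoverOfIsOpenCover W
    (.mk (top_le_iff.mp fun y _ ↦ Opens.mem_iSup.mpr (hW y)))) _ _ h

theorem exists_glued_hom {ι : Type u} (W : ι → Y.Opens) (hW : ∀ y, ∃ i, y ∈ W i)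
    (g : ∀ i, (W i).toScheme ⟶ Z)
    (h : ∀ i j, ∀ y ∈ W i, y ∈ W j → ∃ (l : ι) (hi : W l ≤ W i) (hj : W l ≤ W j), y ∈ W l ∧
      Y.homOfLE hi ≫ g i = g l ∧ Y.homOfLE hj ≫ g j = g l) :
    ∃ G : Y ⟶ Z, ∀ i, (W i).ι ≫ G = g i := by
  have hcover : IsOpenCover W := .mk (top_le_iff.mp fun y _ ↦ Opens.mem_iSup.mpr (hW y))
  refine ⟨(Y.openCoverOfIsOpenCover W hcover).glueMorphisms g fun i j ↦ ?_,
    fun i ↦ (Y.openCoverOfIsOpenCover W hcover).ι_glueMorphisms g _ i⟩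
  let p : Limits.pullback (W i).ι (W j).ι ⟶ (W i).toScheme := Limits.pullback.fst _ _
  let q : Limits.pullback (W i).ι (W j).ι ⟶ (W j).toScheme := Limits.pullback.snd _ _
  let r := p ≫ (W i).ι
  have hr : r = q ≫ (W j).ι := Limits.pullback.condition
  change p ≫ g i = q ≫ g j
  refine hom_ext_of_opens
    (fun l : {l // ∃ (hi : W l ≤ W i) (hj : W l ≤ W j),
      Y.homOfLE hi ≫ g i = g l ∧ Y.homOfLE hj ≫ g j = g l} ↦ r ⁻¹ᵁ W l.1) (fun x ↦ ?_) ?_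
  · have hrj : r x ∈ W j := by
      rw [hr]
      exact (q x).2
    obtain ⟨l, hi, hj, hl, hgi, hgj⟩ := h i j (r x) (p x).2 hrj
    exact ⟨⟨l, hi, hj, hgi, hgj⟩, hl⟩
  · rintro ⟨l, hi, hj, hgi, hgj⟩
    have factor_p : (r ⁻¹ᵁ W l).ι ≫ p = (r ∣_ W l) ≫ Y.homOfLE hi := by
      rw [← cancel_mono (W i).ι, Category.assoc, Category.assoc, Scheme.homOfLE_ι,
        morphismRestrict_ι]
    have factor_q : (r ⁻¹ᵁ W l).ι ≫ q = (r ∣_ W l) ≫ Y.homOfLE hj := by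
      rw [← cancel_mono (W j).ι, Category.assoc, Category.assoc, Scheme.homOfLE_ι,
        morphismRestrict_ι, ← hr]
    calc (r ⁻¹ᵁ W l).ι ≫ p ≫ g i = (r ∣_ W l) ≫ Y.homOfLE hi ≫ g i := (reassoc_of% factor_p) (g i)
      _ = (r ∣_ W l) ≫ Y.homOfLE hj ≫ g j := by rw [hgi, hgj]
      _ = (r ⁻¹ᵁ W l).ι ≫ q ≫ g j := ((reassoc_of% factor_q) (g j)).symm

theorem toSpecΓ_SpecMap_appLE_fromSpec (g : Y ⟶ Z) {V : Z.Opens} (hV : IsAffineOpen V)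
    {W : Y.Opens} (h : W ≤ g ⁻¹ᵁ V) :
    W.toSpecΓ ≫ Spec.map (g.appLE V W h) ≫ hV.fromSpec = W.ι ≫ g := by
  rw [Scheme.Opens.toSpecΓ_SpecMap_appLE_assoc, hV.toSpecΓ_fromSpec, Scheme.Hom.resLE_comp_ι]

theorem toSpecΓ_SpecMap_injective {W : Y.Opens} {R : CommRingCat.{u}} {a b : R ⟶ Γ(Y, W)}
    (h : W.toSpecΓ ≫ Spec.map a = W.toSpecΓ ≫ Spec.map b) : a = b := by
  have happ := congrArg Scheme.Hom.appTop h
  rwa [Scheme.Hom.comp_appTop, Scheme.Hom.comp_appTop, Scheme.Opens.toSpecΓ_appTop,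
    Scheme.ΓSpecIso_naturality_assoc, Scheme.ΓSpecIso_naturality_assoc,
    Iso.cancel_iso_hom_left, Iso.cancel_iso_inv_right] at happ

theorem preimage_le_of_comp_eq {π : Z ⟶ X} {F : Y ⟶ X} {G : Y ⟶ Z} (h : G ≫ π = F)
    (U : X.Opens) : F ⁻¹ᵁ U ≤ G ⁻¹ᵁ π ⁻¹ᵁ U := by
  rw [← h]
  exact le_rfl

theorem appLE_app_of_comp_eq {π : Z ⟶ X} {F : Y ⟶ X} {G : Y ⟶ Z} (h : G ≫ π = F) (U : X.Opens)
    (a : Γ(X, U)) :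
    (G.appLE (π ⁻¹ᵁ U) (F ⁻¹ᵁ U) (preimage_le_of_comp_eq h U)).hom ((π.app U).hom a) =
      (F.app U).hom a := by
  have happ : π.app U ≫ G.appLE (π ⁻¹ᵁ U) (F ⁻¹ᵁ U) (preimage_le_of_comp_eq h U) = F.app U := by
    rw [← Scheme.Hom.appLE_eq_app, ← Scheme.Hom.appLE_eq_app, Scheme.Hom.appLE_comp_appLE]
    simp only [h]
  exact RingHom.congr_fun (congrArg CommRingCat.Hom.hom happ) a

variable (π : Z ⟶ X) [IsAffineHom π] (F : Y ⟶ X)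

theorem hom_ext_of_affine {G G' : Y ⟶ Z} (hG : G ≫ π = F) (hG' : G' ≫ π = F)
    (h : ∀ x, ∃ U : X.affineOpens, x ∈ U.1 ∧
      G.appLE (π ⁻¹ᵁ U.1) (F ⁻¹ᵁ U.1) (preimage_le_of_comp_eq hG U.1) =
        G'.appLE (π ⁻¹ᵁ U.1) (F ⁻¹ᵁ U.1) (preimage_le_of_comp_eq hG' U.1)) : G = G' := by
  choose U hU h using h
  refine hom_ext_of_opens (fun x : X ↦ F ⁻¹ᵁ (U x).1) (fun y ↦ ⟨F y, hU (F y)⟩) fun x ↦ ?_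
  have hA : IsAffineOpen (π ⁻¹ᵁ (U x).1) := (U x).2.preimage π
  rw [← toSpecΓ_SpecMap_appLE_fromSpec G hA (preimage_le_of_comp_eq hG _),
    ← toSpecΓ_SpecMap_appLE_fromSpec G' hA (preimage_le_of_comp_eq hG' _), h]

/-- The morphism over an affine open of `X` given by a homomorphism between algebras of functions;
these are the pieces from which a morphism to a scheme affine over `X` is glued. -/
def localHom (U : X.AffineZariskiSite) (l : Γ(Z, π ⁻¹ᵁ U.toOpens) →+* Γ(Y, F ⁻¹ᵁ U.toOpens)) :
    (F ⁻¹ᵁ U.toOpens).toScheme ⟶ Z :=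
  (F ⁻¹ᵁ U.toOpens).toSpecΓ ≫ Spec.map (CommRingCat.ofHom l) ≫ (U.2.preimage π).fromSpec

variable {π F}

theorem localHom_comp {U : X.AffineZariskiSite}
    {l : Γ(Z, π ⁻¹ᵁ U.toOpens) →+* Γ(Y, F ⁻¹ᵁ U.toOpens)}
    (hl : ∀ a, l ((π.app U.toOpens).hom a) = (F.app U.toOpens).hom a) :
    localHom π F U l ≫ π = (F ⁻¹ᵁ U.toOpens).ι ≫ F := by
  have happ : π.appLE U.toOpens (π ⁻¹ᵁ U.toOpens) le_rfl ≫ CommRingCat.ofHom l =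
      F.appLE U.toOpens (F ⁻¹ᵁ U.toOpens) le_rfl := by
    rw [Scheme.Hom.appLE_eq_app, Scheme.Hom.appLE_eq_app]
    exact CommRingCat.hom_ext (RingHom.ext hl)
  rw [localHom, Category.assoc, Category.assoc,
    ← IsAffineOpen.SpecMap_appLE_fromSpec π U.2 (U.2.preimage π) le_rfl, ← Spec.map_comp_assoc,
    happ]
  exact toSpecΓ_SpecMap_appLE_fromSpec F U.2 le_rfl

theorem homOfLE_localHom {U V : X.AffineZariskiSite} (h : V ≤ U)
    {l : Γ(Z, π ⁻¹ᵁ U.toOpens) →+* Γ(Y, F ⁻¹ᵁ U.toOpens)}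
    {l' : Γ(Z, π ⁻¹ᵁ V.toOpens) →+* Γ(Y, F ⁻¹ᵁ V.toOpens)}
    (hres : ∀ s, res (F.preimage_mono (Scheme.AffineZariskiSite.toOpens_mono h)) (l s) =
      l' (res (π.preimage_mono (Scheme.AffineZariskiSite.toOpens_mono h)) s)) :
    Y.homOfLE (F.preimage_mono (Scheme.AffineZariskiSite.toOpens_mono h)) ≫ localHom π F U l =
      localHom π F V l' := by
  have hcomm : CommRingCat.ofHom l ≫ Y.presheaf.map (homOfLE (F.preimage_mono
      (Scheme.AffineZariskiSite.toOpens_mono h))).op = Z.presheaf.map (homOfLE (π.preimage_mono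
        (Scheme.AffineZariskiSite.toOpens_mono h))).op ≫ CommRingCat.ofHom l' :=
    CommRingCat.hom_ext (RingHom.ext hres)
  rw [localHom, ← Scheme.Opens.toSpecΓ_SpecMap_presheaf_map_assoc, ← Spec.map_comp_assoc, hcomm,
    Spec.map_comp_assoc, (U.2.preimage π).map_fromSpec (V.2.preimage π), localHom]

theorem exists_hom_of_affine
    (l : ∀ U : X.AffineZariskiSite, Γ(Z, π ⁻¹ᵁ U.toOpens) →+* Γ(Y, F ⁻¹ᵁ U.toOpens))
    (hl : ∀ U a, l U ((π.app U.toOpens).hom a) = (F.app U.toOpens).hom a)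
    (hres : ∀ {U V : X.AffineZariskiSite} (h : V ≤ U) s,
      res (F.preimage_mono (Scheme.AffineZariskiSite.toOpens_mono h)) (l U s) =
        l V (res (π.preimage_mono (Scheme.AffineZariskiSite.toOpens_mono h)) s)) :
    ∃ G : Y ⟶ Z, ∃ h : G ≫ π = F, ∀ U : X.AffineZariskiSite,
      G.appLE (π ⁻¹ᵁ U.toOpens) (F ⁻¹ᵁ U.toOpens) (preimage_le_of_comp_eq h U.toOpens) =
        CommRingCat.ofHom (l U) := by
  have hcover (y : Y) : ∃ U : X.AffineZariskiSite, y ∈ F ⁻¹ᵁ U.toOpens := exists_mem_toOpens (F y)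
  obtain ⟨G, hG⟩ := exists_glued_hom (fun U : X.AffineZariskiSite ↦ F ⁻¹ᵁ U.toOpens) hcover
    (fun U ↦ localHom π F U (l U)) fun U V y hU hV ↦ by
      obtain ⟨W, hWU, hWV, hy⟩ := exists_le_of_mem_toOpens U V hU hV
      exact ⟨W, F.preimage_mono (Scheme.AffineZariskiSite.toOpens_mono hWU),
        F.preimage_mono (Scheme.AffineZariskiSite.toOpens_mono hWV), hy,
        homOfLE_localHom hWU (hres hWU), homOfLE_localHom hWV (hres hWV)⟩
  have hGF : G ≫ π = F := by
    refine hom_ext_of_opens (fun U : X.AffineZariskiSite ↦ F ⁻¹ᵁ U.toOpens) hcover fun U ↦ ?_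
    rw [← Category.assoc, hG, localHom_comp (hl U)]
  refine ⟨G, hGF, fun U ↦ toSpecΓ_SpecMap_injective ?_⟩
  rw [← cancel_mono (U.2.preimage π).fromSpec, Category.assoc, Category.assoc]
  exact (toSpecΓ_SpecMap_appLE_fromSpec G (U.2.preimage π) _).trans (hG U)

end AffineGluing

namespace LogPair.Hom

variable {Q P : LogPair k} (f : Hom Q P)

theorem away_le_preimage (U : P.X.left.Opens) :
    Q.away (f.hom.left ⁻¹ᵁ U) ≤ f.hom.left ⁻¹ᵁ P.away U :=
  fun y hy ↦ ⟨hy.1, fun h ↦ hy.2 (f.mem_of_mem y h)⟩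

/-- The pull-back of functions defined off the divisors. -/
def pullAway (U : P.X.left.Opens) :
    Γ(P.X.left, P.away U) →+* Γ(Q.X.left, Q.away (f.hom.left ⁻¹ᵁ U)) :=
  (f.hom.left.appLE _ _ (f.away_le_preimage U)).hom

theorem pullAway_res (U : P.X.left.Opens) (a : Γ(P.X.left, U)) :
    f.pullAway U (res inf_le_left a) = res inf_le_left ((f.hom.left.app U).hom a) := by
  have h : P.X.left.presheaf.map (homOfLE (inf_le_left : P.away U ≤ U)).op ≫
      f.hom.left.appLE _ _ (f.away_le_preimage U) = f.hom.left.app U ≫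
        Q.X.left.presheaf.map (homOfLE (inf_le_left : Q.away (f.hom.left ⁻¹ᵁ U) ≤ _)).op :=
    Scheme.Hom.map_appLE ..
  exact RingHom.congr_fun (congrArg CommRingCat.Hom.hom h) a

theorem res_pullAway {U V : P.X.left.Opens} (h : V ≤ U) (a : Γ(P.X.left, P.away U)) :
    res (Q.away_le (f.hom.left.preimage_mono h)) (f.pullAway U a) =
      f.pullAway V (res (P.away_le h) a) := by
  have h : f.hom.left.appLE _ _ (f.away_le_preimage U) ≫
      Q.X.left.presheaf.map (homOfLE (Q.away_le (f.hom.left.preimage_mono h))).op =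
      P.X.left.presheaf.map (homOfLE (P.away_le h)).op ≫
      f.hom.left.appLE _ _ (f.away_le_preimage V) := by
    rw [Scheme.Hom.appLE_map, Scheme.Hom.map_appLE]
  exact RingHom.congr_fun (congrArg CommRingCat.Hom.hom h) a

theorem pullAway_comp_consts (U : P.X.left.Opens) :
    (f.pullAway U).comp (consts P.X (P.away U)) =
      consts Q.X (Q.away (f.hom.left ⁻¹ᵁ U)) := by
  rw [← res_comp_consts P.X (inf_le_left : P.away U ≤ U),
    ← res_comp_consts Q.X (inf_le_left : Q.away (f.hom.left ⁻¹ᵁ U) ≤ _)]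
  ext c
  exact (f.pullAway_res U _).trans (congrArg _ (app_consts f.hom U c))

theorem isUnit_res_app_eqn {U : P.X.left.affineOpens} (c : LogChart P.X P.D U)
    (Z : meetingComponents P.D U.1) :
    IsUnit (res (inf_le_left : Q.away (f.hom.left ⁻¹ᵁ U.1) ≤ _)
      ((f.hom.left.app U.1).hom (c.eqn Z))) := by
  rw [← f.pullAway_res]
  exact (c.isUnit_res_eqn Z).map _

end LogPair.Hom

namespace LCVS

theorem dvd_der_of_isUnit_res (Y : LCVS k) {W : Y.pair.X.left.Opens} {a : Γ(Y.pair.X.left, W)}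
    (ha : IsUnit (res (inf_le_left : Y.pair.away W ≤ W) a)) : a ∣ Y.field.der W a := by
  obtain ⟨b, hb⟩ := ha.exists_right_inv
  obtain ⟨t, ht⟩ : ∃ t, res (inf_le_left : Y.pair.away W ≤ W) t =
      b * res inf_le_left (Y.field.der W a) := by
    refine mem_range_res_of_locally Y.pair.D.compl Y.pair.res_away_injective _ fun y hy ↦ ?_
    obtain ⟨V, hyV, hV, ⟨c⟩⟩ := Y.pair.exists_logChart W hy
    have res_comm (s) : res (inf_le_left : Y.pair.away V.1 ≤ V.1) (res hV s) =
        res (Y.pair.away_le hV) (res (inf_le_left : Y.pair.away W ≤ W) s) :=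
      (res_res ..).trans (res_res ..).symm
    have inv_V : res (inf_le_left : Y.pair.away V.1 ≤ V.1) (res hV a) *
        res (Y.pair.away_le hV) b = 1 := by
      rw [res_comm, ← map_mul, hb, map_one]
    obtain ⟨w, hw⟩ := c.dvd_der_of_isUnit Y.isTangent (a := res hV a) (.of_mul_eq_one _ inv_V)
    refine ⟨V.1, hV, hyV, w, ?_⟩
    change _ = res (Y.pair.away_le hV) _
    rw [map_mul, ← res_comm, Y.field.res, hw, map_mul, ← mul_assoc,
      mul_comm (res (Y.pair.away_le hV) b), inv_V, one_mul]
  refine ⟨t, Y.pair.res_away_injective W ?_⟩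
  rw [map_mul, ht, ← mul_assoc, hb, one_mul]

variable {Y : LCVS k} {P : LogPair k} (f : LogPair.Hom Y.pair P) [CharZero k]

/-- Evaluation of jets of functions off `D` along the trajectories of the vector field. -/
def jetEval (U : P.X.left.Opens) :
    P.awayJets U →+* Γ(Y.pair.X.left, Y.pair.away (f.hom.left ⁻¹ᵁ U)) :=
  JetAlgebra.taylor (f.pullAway U) (f.pullAway_comp_consts U) (Y.field.leibniz _)
    (Y.field.consts _)

theorem jetEval_of (U : P.X.left.Opens) (a) :
    jetEval f U (JetAlgebra.of _ a) = f.pullAway U a := JetAlgebra.taylor_of ..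

theorem jetEval_der (U : P.X.left.Opens) (s) :
    jetEval f U (JetAlgebra.der _ s) = Y.field.der _ (jetEval f U s) := JetAlgebra.taylor_der ..

theorem jetEval_fn (U : P.X.left.Opens) (a) :
    jetEval f U (P.fn U a) = res inf_le_left ((f.hom.left.app U).hom a) :=
  (jetEval_of f U _).trans (f.pullAway_res U a)

theorem res_jetEval {U V : P.X.left.Opens} (h : V ≤ U) (s : P.awayJets U) :
    res (Y.pair.away_le (f.hom.left.preimage_mono h)) (jetEval f U s) =
      jetEval f V (P.resJets h s) := by
  refine RingHom.congr_fun (f := (res (Y.pair.away_le (f.hom.left.preimage_mono h))).comp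
    (jetEval f U)) (g := (jetEval f V).comp (P.resJets h))
    (JetAlgebra.hom_ext_of_der (d := Y.field.der _)
      (fun x ↦ ?_) (fun x ↦ ?_) fun a ↦ ?_) s
  · rw [RingHom.comp_apply, jetEval_der, Y.field.res]
    rfl
  · rw [RingHom.comp_apply, LogPair.resJets_der, jetEval_der]
    rfl
  · rw [RingHom.comp_apply, RingHom.comp_apply, jetEval_of, LogPair.resJets_of, jetEval_of,
      f.res_pullAway h]

theorem jetEval_mem_range_of_logChart {U : P.X.left.affineOpens} (c : LogChart P.X P.D U)
    {s : P.awayJets U.1} (hs : s ∈ P.logJetAlgebra (LogChart.site U)) :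
    ∃ t, res inf_le_left t = jetEval f U.1 s := by
  suffices P.logJetAlgebra (LogChart.site U) ≤ (res (inf_le_left :
      Y.pair.away (f.hom.left ⁻¹ᵁ U.1) ≤ _)).range.comap (jetEval f U.1) from this hs
  refine c.logJetAlgebra_le (fun a ↦ ⟨_, (jetEval_fn f U.1 a).symm⟩) ?_ fun Z ↦ ?_
  · rintro s ⟨t, ht⟩
    refine ⟨Y.field.der _ t, ?_⟩
    rw [jetEval_der, ← ht, Y.field.res]
  · have hunit := f.isUnit_res_app_eqn c Z
    obtain ⟨t, ht⟩ := dvd_der_of_isUnit_res Y hunit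
    refine ⟨t, hunit.mul_left_cancel ?_⟩
    rw [← map_mul, ← ht, Y.field.res, ← jetEval_fn, ← jetEval_der,
      ← c.fn_eqn_mul_logDifferential, map_mul]

theorem jetEval_mem_range (U : P.X.left.AffineZariskiSite) {s : P.awayJets U.toOpens}
    (hs : s ∈ P.logJetAlgebra U) : ∃ t, res inf_le_left t = jetEval f U.toOpens s := by
  refine mem_range_res_of_locally Y.pair.D.compl Y.pair.res_away_injective _ fun y hy ↦ ?_
  obtain ⟨V, hyV, hV, ⟨c⟩⟩ := P.exists_logChart U.toOpens (p := f.hom.left y) hy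
  obtain ⟨t, ht⟩ :=
    jetEval_mem_range_of_logChart f c (P.resJets_mem (V := LogChart.site V) hV hs)
  exact ⟨_, f.hom.left.preimage_mono hV, hyV, t, ht.trans (res_jetEval f hV s).symm⟩

theorem exists_evalHom (U : P.X.left.AffineZariskiSite) :
    ∃ l : P.logJetAlgebra U →+* Γ(Y.pair.X.left, f.hom.left ⁻¹ᵁ U.toOpens),
      ∀ s, res inf_le_left (l s) = jetEval f U.toOpens s.1 := by
  let ρ : Γ(Y.pair.X.left, f.hom.left ⁻¹ᵁ U.toOpens) →+*
    Γ(Y.pair.X.left, Y.pair.away (f.hom.left ⁻¹ᵁ U.toOpens)) := res inf_le_left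
  let e : Γ(Y.pair.X.left, f.hom.left ⁻¹ᵁ U.toOpens) ≃+* ρ.range :=
    .ofBijective ρ.rangeRestrict ⟨fun a b h ↦ Y.pair.res_away_injective _ (congrArg Subtype.val h),
      ρ.rangeRestrict_surjective⟩
  refine ⟨e.symm.toRingHom.comp (((jetEval f U.toOpens).comp
    (P.logJetAlgebra U).subtype).codRestrict ρ.range fun s ↦ jetEval_mem_range f U s.2),
    fun s ↦ ?_⟩
  exact congrArg Subtype.val (e.apply_symm_apply _)

/-- Evaluation of log jets along the trajectories of the vector field. By tangency the values have
no poles along the divisor. -/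
def evalHom (U : P.X.left.AffineZariskiSite) :
    P.logJetAlgebra U →+* Γ(Y.pair.X.left, f.hom.left ⁻¹ᵁ U.toOpens) :=
  (exists_evalHom f U).choose

theorem res_evalHom (U : P.X.left.AffineZariskiSite) (s) :
    res inf_le_left (evalHom f U s) = jetEval f U.toOpens s.1 :=
  (exists_evalHom f U).choose_spec s

theorem evalHom_fnHom (U : P.X.left.AffineZariskiSite) (a) :
    evalHom f U (P.fnHom U a) = (f.hom.left.app U.toOpens).hom a :=
  Y.pair.res_away_injective _ ((res_evalHom ..).trans (jetEval_fn f U.toOpens a))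

theorem evalHom_der (U : P.X.left.AffineZariskiSite) (s) :
    evalHom f U (P.logJetDer U s) = Y.field.der _ (evalHom f U s) := by
  refine Y.pair.res_away_injective _ ?_
  rw [res_evalHom, Y.field.res, res_evalHom]
  exact jetEval_der f U.toOpens s.1

theorem res_evalHom_eq_evalHom_resHom {U V : P.X.left.AffineZariskiSite} (h : V ≤ U) (s) :
    res (f.hom.left.preimage_mono (Scheme.AffineZariskiSite.toOpens_mono h)) (evalHom f U s) =
      evalHom f V (P.resHom h s) := by
  refine Y.pair.res_away_injective _ ?_
  rw [res_evalHom, res_res]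
  refine Eq.trans ?_ (res_jetEval f (Scheme.AffineZariskiSite.toOpens_mono h) s.1)
  rw [← res_evalHom, res_res]

end LCVS

theorem LogChart.hom_ext {P : LogPair k} {U : P.X.left.affineOpens} (c : LogChart P.X P.D U)
    {R : Type*} [CommRing R] {d : R → R} {e e' : P.logJetAlgebra (site U) →+* R}
    (he : ∀ s, e (P.logJetDer (site U) s) = d (e s))
    (he' : ∀ s, e' (P.logJetDer (site U) s) = d (e' s))
    (hfn : ∀ a, e (P.fnHom (site U) a) = e' (P.fnHom (site U) a))
    (hreg : ∀ Z, IsLeftRegular (e (P.fnHom (site U) (c.eqn Z)))) : e = e' := by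
  have heq : P.logJetAlgebra (site U) ≤
      (e.eqLocus e').map (P.logJetAlgebra (site U)).subtype := by
    refine c.logJetAlgebra_le (fun a ↦ ⟨P.fnHom (site U) a, hfn a, rfl⟩) ?_ fun Z ↦
      ⟨⟨_, c.logDifferential_mem (c.σ Z)⟩, hreg Z ?_, rfl⟩
    · rintro _ ⟨s, hs, rfl⟩
      refine ⟨P.logJetDer (site U) s, ?_, rfl⟩
      change e _ = e' _
      rw [he, he', show e s = e' s from hs]
    · have hmul : P.fnHom (site U) (c.eqn Z) * ⟨_, c.logDifferential_mem (c.σ Z)⟩ =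
          P.logJetDer (site U) (P.fnHom (site U) (c.eqn Z)) :=
        Subtype.ext (c.fn_eqn_mul_logDifferential Z)
      change _ * e _ = _ * e' _
      rw [← map_mul, hfn, ← map_mul, hmul, he, he', hfn]
  ext s
  obtain ⟨t, ht, hts⟩ := heq s.2
  obtain rfl : t = s := Subtype.ext hts
  exact ht

theorem LogChart.sections_hom_ext {P : LogPair k} {U : P.X.left.affineOpens}
    (c : LogChart P.X P.D U) {R : Type*} [CommRing R] {d : R → R}
    {e e' : Γ(P.logJet.left, P.logJetProj.left ⁻¹ᵁ U.1) →+* R}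
    (he : ∀ s, e (P.logJetField.der _ s) = d (e s))
    (he' : ∀ s, e' (P.logJetField.der _ s) = d (e' s))
    (hproj : ∀ a, e ((P.logJetProj.left.app U.1).hom a) = e' ((P.logJetProj.left.app U.1).hom a))
    (hreg : ∀ Z, IsLeftRegular (e ((P.logJetProj.left.app U.1).hom (c.eqn Z)))) : e = e' := by
  let E := P.logJetSectionsEquiv (site U)
  have symm_der (s) : E.symm (P.logJetDer (site U) s) = P.logJetField.der _ (E.symm s) := by
    obtain ⟨s, rfl⟩ := E.surjective s
    rw [E.symm_apply_apply]
    exact E.symm_apply_eq.mpr (P.logJetSections_der (site U) s).symm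
  have symm_fn (a) : E.symm (P.fnHom (site U) a) = (P.logJetProj.left.app U.1).hom a :=
    E.symm_apply_eq.mpr (P.logJetSections_proj (site U) a).symm
  have hcomp : e.comp E.symm.toRingHom = e'.comp E.symm.toRingHom := by
    refine c.hom_ext (d := d) (fun s ↦ ?_) (fun s ↦ ?_) (fun a ↦ ?_) fun Z ↦ ?_
    · exact (congrArg e (symm_der s)).trans (he _)
    · exact (congrArg e' (symm_der s)).trans (he' _)
    · exact (congrArg e (symm_fn a)).trans ((hproj a).trans (congrArg e' (symm_fn a)).symm)
    · exact (congrArg (IsLeftRegular <| e ·) (symm_fn (c.eqn Z))).mpr (hreg Z)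
  ext s
  obtain ⟨s, rfl⟩ := E.symm.surjective s
  exact RingHom.congr_fun hcomp s

theorem VectorField.appLE_der {X Y : Over (Spec (.of k))} (δ : VectorField X) (δ' : VectorField Y)
    {g : Y.left ⟶ X.left} (h : ∀ U s, (g.app U).hom (δ.der U s) = δ'.der _ ((g.app U).hom s))
    {U : X.left.Opens} {V : Y.left.Opens} (hV : V ≤ g ⁻¹ᵁ U) (s : Γ(X.left, U)) :
    (g.appLE U V hV).hom (δ.der U s) = δ'.der V ((g.appLE U V hV).hom s) :=
  (congrArg (LogJets.res hV) (h U s)).trans (δ'.res _ _)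

theorem LCVS.eq_of_comp_logJetProj {Y : LCVS k} {P : LogPair k} (f : LogPair.Hom Y.pair P)
    {G G' : Y.pair.X.left ⟶ P.logJet.left}
    (hG : G ≫ P.logJetProj.left = f.hom.left) (hG' : G' ≫ P.logJetProj.left = f.hom.left)
    (hder : ∀ U s, (G.app U).hom (P.logJetField.der U s) = Y.field.der _ ((G.app U).hom s))
    (hder' : ∀ U s, (G'.app U).hom (P.logJetField.der U s) = Y.field.der _ ((G'.app U).hom s)) :
    G = G' := by
  refine hom_ext_of_affine P.logJetProj.left f.hom.left hG hG' fun x ↦ ?_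
  obtain ⟨U, hU, -, ⟨c⟩⟩ := P.exists_logChart ⊤ (p := x) trivial
  refine ⟨U, hU, CommRingCat.hom_ext (c.sections_hom_ext (d := Y.field.der _)
    (P.logJetField.appLE_der Y.field hder _) (P.logJetField.appLE_der Y.field hder' _)
    (fun a ↦ (appLE_app_of_comp_eq hG U.1 a).trans (appLE_app_of_comp_eq hG' U.1 a).symm)
    fun Z a b hab ↦ ?_)⟩
  simp only [appLE_app_of_comp_eq hG U.1] at hab
  refine Y.pair.res_away_injective _ ((f.isUnit_res_app_eqn c Z).mul_left_cancel ?_)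
  rw [← map_mul, hab, map_mul]

variable [CharZero k]

namespace LogPair

/-- The log jet space as a log commutative vertex scheme. -/
def logJetLCVS (P : LogPair k) : LCVS k :=
  ⟨⟨P.logJet, P.logJetDivisor, P.hasLogChart_logJet⟩, P.logJetField, P.logJetField_isTangent⟩

/-- The projection from the log jet space as a morphism of log pairs: the counit of the
adjunction. -/
def logJetProjHom (P : LogPair k) : P.logJetLCVS.pair ⟶ P :=
  LogPair.Hom.mk P.logJetProj fun _ h ↦ h

end LogPair

namespace LCVS

variable {Y : LCVS k} {P : LogPair k}

theorem exists_evalHom_glued (f : LogPair.Hom Y.pair P) :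
    ∃ G : Y.pair.X.left ⟶ P.logJet.left, ∃ hG : G ≫ P.logJetProj.left = f.hom.left,
      ∀ (U : P.X.left.AffineZariskiSite) (s : Γ(P.logJet.left, P.above U)),
        (G.appLE (P.above U) (f.hom.left ⁻¹ᵁ U.toOpens)
          (preimage_le_of_comp_eq hG U.toOpens)).hom s = evalHom f U (P.logJetSections U s) := by
  obtain ⟨G, hG, happ⟩ := exists_hom_of_affine (π := P.logJetProj.left) (F := f.hom.left)
    (fun U ↦ (evalHom f U).comp (P.logJetSections U))
    (fun U a ↦ (congrArg _ (P.logJetSections_proj U a)).trans (evalHom_fnHom f U a))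
    (fun {U V} h s ↦ (res_evalHom_eq_evalHom_resHom f h _).trans
      (congrArg (evalHom f V) (P.logJetSections_res h s).symm))
  exact ⟨G, hG, fun U s ↦ RingHom.congr_fun (congrArg CommRingCat.Hom.hom (happ U)) s⟩

theorem exists_lift (f : Y.pair ⟶ P) :
    ∃ g : Y ⟶ P.logJetLCVS, (forget k).map g ≫ P.logJetProjHom = f := by
  obtain ⟨G, hG, happ⟩ := exists_evalHom_glued f
  have hw : G ≫ P.logJet.hom = Y.pair.X.hom := by
    rw [← Over.w P.logJetProj, ← Category.assoc, hG]
    exact Over.w f.hom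
  refine ⟨LCVS.Hom.mk (LogPair.Hom.mk (Over.homMk G hw) fun y hy ↦ f.mem_of_mem y ?_)
    (app_der_of_affineCover P.logJetField Y.field G P.above P.isAffineOpen_above
      P.exists_mem_above fun U s ↦ ?_), LogPair.Hom.ext (Over.OverMorphism.ext hG)⟩
  · rw [← hG]
    exact hy
  · have hle : G ⁻¹ᵁ P.above U ≤ f.hom.left ⁻¹ᵁ U.toOpens := by
      rw [← hG]
      exact le_rfl
    have app_eq (t : Γ(P.logJet.left, P.above U)) :
        (G.app (P.above U)).hom t = res hle (evalHom f U (P.logJetSections U t)) := by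
      have h : G.appLE (P.above U) (f.hom.left ⁻¹ᵁ U.toOpens)
          (preimage_le_of_comp_eq hG U.toOpens) ≫ Y.pair.X.left.presheaf.map (homOfLE hle).op =
            G.app (P.above U) := by
        rw [Scheme.Hom.appLE_map, Scheme.Hom.appLE_eq_app]
      rw [← happ]
      exact (RingHom.congr_fun (congrArg CommRingCat.Hom.hom h) t).symm
    rw [app_eq, app_eq, P.logJetSections_der, evalHom_der, Y.field.res]

theorem hom_ext_of_proj {g g' : Y ⟶ P.logJetLCVS}
    (h : (forget k).map g ≫ P.logJetProjHom = (forget k).map g' ≫ P.logJetProjHom) : g = g' :=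
  LCVS.Hom.ext (LogPair.Hom.ext (Over.OverMorphism.ext (eq_of_comp_logJetProj
    ((forget k).map g ≫ P.logJetProjHom) rfl
    (congrArg (fun f : LogPair.Hom Y.pair P ↦ f.hom.left) h.symm) g.map_der g'.map_der)))

/-- The universal property of the log jet space, as the bijection of hom-sets defining the
adjunction. -/
def homEquiv (Y : LCVS k) (P : LogPair k) : ((forget k).obj Y ⟶ P) ≃ (Y ⟶ P.logJetLCVS) :=
  (Equiv.ofBijective (fun g : Y ⟶ P.logJetLCVS ↦ (forget k).map g ≫ P.logJetProjHom)
    ⟨fun _ _ h ↦ hom_ext_of_proj h, fun f ↦ exists_lift f⟩).symm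

theorem homEquiv_naturality (Y' Y : LCVS k) (P : LogPair k) (g : Y' ⟶ Y)
    (f : (forget k).obj Y ⟶ P) :
    homEquiv Y' P ((forget k).map g ≫ f) = g ≫ homEquiv Y P f := by
  obtain ⟨f, rfl⟩ := (homEquiv Y P).symm.surjective f
  rw [Equiv.apply_symm_apply]
  exact (homEquiv Y' P).symm.injective (Equiv.symm_apply_apply ..)

/-- Log jets are right adjoint to the forgetful functor. -/
def logJetAdjunction :
    forget k ⊣ Adjunction.rightAdjointOfEquiv homEquiv (homEquiv_naturality (k := k)) :=
  Adjunction.adjunctionOfEquivRight homEquiv homEquiv_naturality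

theorem logJetAdjunction_counit_app (P : LogPair k) :
    logJetAdjunction.counit.app P = P.logJetProjHom :=
  (Adjunction.adjunctionOfEquivRight_counit_app ..).trans (Category.id_comp P.logJetProjHom)

end LCVS

end

end LogJets

theorem mainTheorem5 (k : Type u) [Field k] [CharZero k] :
    ∃ (hJ : ∀ (P : LogPair k) (p : P.logJet.left), HasLogChart P.logJet P.logJetDivisor p)
      (δ : ∀ P : LogPair k, VectorField P.logJet)
      (hδ : ∀ P : LogPair k, (δ P).IsTangent P.logJetDivisor),
      -- the reduced divisor is the scheme-theoretic pull-back of `D`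
      (∀ P : LogPair k, Scheme.IdealSheafData.vanishingIdeal P.logJetDivisor =
        (Scheme.IdealSheafData.vanishingIdeal P.D).comap P.logJetProj.left) ∧
      -- the vector field is the translation of jets
      (∀ (P : LogPair k) (U : P.X.left.AffineZariskiSite)
        (s : Γ(P.logJet.left, P.logJetProj.left ⁻¹ᵁ U.toOpens)),
        (P.logJetSections U ((δ P).der _ s)).1 =
          JetAlgebra.der (consts P.X (P.away U.toOpens)) (P.logJetSections U s).1) ∧
      -- log jets are right adjoint to the forgetful functor, with the projections as counit
      ∃ (R : LogPair k ⥤ LCVS k) (adj : LCVS.forget k ⊣ R),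
        ∀ P : LogPair k,
          ∃ h : R.obj P = ⟨⟨P.logJet, P.logJetDivisor, hJ P⟩, δ P, hδ P⟩,
            (LCVS.forget k).map (eqToHom h.symm) ≫ adj.counit.app P =
              LogPair.Hom.mk P.logJetProj (fun _ hx ↦ hx) := by
  refine ⟨fun P ↦ P.hasLogChart_logJet, fun P ↦ P.logJetField, fun P ↦ P.logJetField_isTangent,
    fun P ↦ P.vanishingIdeal_logJetDivisor,
    fun P U s ↦ congrArg Subtype.val (P.logJetSections_der U s), _, LCVS.logJetAdjunction,
    fun P ↦ ⟨rfl, ?_⟩⟩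
  exact (Category.id_comp _).trans (LCVS.logJetAdjunction_counit_app P)
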